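/- For a safe prime $p=2q+1$ ($p$, $q$ prime) let $\mathrm{QR}_p=\{x^2 : x\in\mathbb Z_p^*\}$, a cyclic group of order $q$, and define $f_p:\mathrm{QR}_p\to\mathbb Z_q$ by $f_p(y)=y$ if $y\le q$ and $f_p(y)=p-y$ if $y>q$ (representatives $1\le y\le p-1$; value taken modulo $q$). For a generator $g$ of $\mathrm{QR}_p$ put $\mathsf{modexp}_{p,g}(b)=g^b \bmod p$. For $p$ with exactly $n$ bits, $h=g^a$ with $a\in\mathbb Z_q$, a key $b\in\mathbb Z_q$ and an input $x=x_1\dots x_n\in\{0,1\}^n$, define $$F_{(p,g,h)}(b,x)=b_n\in\mathbb Z_q,\qquad b_0=b,\qquad b_j=\begin{cases} f_p(\mathsf{modexp}_{p,g}(b_{j-1})) & x_j=0,\\ f_p(\mathsf{modexp}_{p,h}(b_{j-1})) & x_j=1.\end{cases}$$ Let $\mathcal{IG}$ be any probabilistic polynomial time instance generator for quadratic residues: on input $1^n$ it outputs a pair $(p,g)$ of a safe prime $p$ and a generator $g$ of $\mathrm{QR}_p$, where $p$ has exactly $n$ bits for all sufficiently large $n$. Assume that the decisional Diffie-Hellman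 assumption holds for $\mathcal{IG}$: for every probabilistic polynomial time algorithm $\mathcal A$, every nonzero polynomial $r$ with non-negative integer coefficients, and all sufficiently large $n$, $$\Bigl|\Pr_{(p,g)\leftarrow\mathcal{IG}(1^n);\ a,b\leftarrow\mathbb Z_q}[\mathcal A(p,g,g^a,g^b,g^{ab})=1]-\Pr_{(p,g)\leftarrow\mathcal{IG}(1^n);\ a,b,c\leftarrow\mathbb Z_q}[\mathcal A(p,g,g^a,g^b,g^{c})=1]\Bigr|<\frac1{r(n)} .$$ Then $\{F_{(p,g,g^a)}\}$, with the instance generator that draws $(p,g)\leftarrow\mathcal{IG}(1^n)$ and a uniform $a\in\mathbb Z_q$ and outputs $P=(p,g,g^a)$, is a classical-secure pseudorandom function collection. That is: (i) It is an indexed collection of efficiently computable keyed functions: the set of parameterizations is infinite; for all sufficiently large $n$ the functions generated on input $1^n$ have domain $\{0,1\}^n$; and there are polynomial time algorithms that, respectively, on input $1^n$ output $P=(p,g,g^a)$ with the above distribution together with descriptions of the key space $\mathbb Z_q$, the domain $\{0,1\}^n$ and the codomain $\mathbb Z_q$; on input $P$ output a uniformly random key $b\in\mathbb Z_q$; and on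 input $P,b,x$ output $F_P(b,x)$. (ii) For every probabilistic polynomial time algorithm $\mathcal A$ with classical membership query access to an oracle, every nonzero polynomial $r$ with non-negative integer coefficients, and all sufficiently large $n$, $$\Bigl|\Pr_{P;\ b\leftarrow\mathbb Z_q}[\mathcal A^{F_P(b,\cdot)}(P)=1]-\Pr_{P;\ R}[\mathcal A^{R}(P)=1]\Bigr|<\frac1{r(n)},$$ where $P=(p,g,g^a)$ is output by the instance generator on input $1^n$ and $R$ is a uniformly random function $\{0,1\}^n\to\mathbb Z_q$. Probabilistic polynomial time algorithms are programs of a probabilistic register machine with logarithmic cost (each operation costs at least the bit length of the numbers involved) which may draw exactly uniform elements of $\{0,\dots,m-1\}$, and which halt, for all random choices, on all inputs that can occur and with all oracles for functions $\{0,1\}^n\to\mathbb Z_q$ where an oracle is given, in time polynomial in the input length. -/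

import Mathlib

open Filter

noncomputable section

namespace QRPRF

/-! ## Probabilistic oracle algorithms with a step count

Algorithms are programs of a register machine with logarithmic cost.  Every register holds a natural
number (equivalently, a bit string), and every operation costs at least the bit length of all the
numbers it touches.  A program names only finitely many registers.  Programs can draw an exactly
uniform element of `{0, …, m - 1}` and can query an oracle `ℕ → ℕ`. -/

/-- Contents of the registers. -/
abbrev Store := ℕ → ℕ

/-- Binary arithmetic operations. -/
inductive Op
  | add | sub | mul | div | mod | lt | eq

/-- Value of an operation: subtraction is truncated, `a / 0 = 0`, `a mod 0 = a`, tests give 0 or 1. -/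
def Op.eval : Op → ℕ → ℕ → ℕ
  | .add, a, b => a + b
  | .sub, a, b => a - b
  | .mul, a, b => a * b
  | .div, a, b => a / b
  | .mod, a, b => a % b
  | .lt, a, b => if a < b then 1 else 0
  | .eq, a, b => if a = b then 1 else 0

/-- Arithmetic expressions in the registers. -/
inductive Expr
  | reg (i : ℕ)
  | const (a : ℕ)
  | bin (o : Op) (e₁ e₂ : Expr)

def Expr.eval : Expr → Store → ℕ
  | .reg i, s => s i
  | .const a, _ => a
  | .bin o e₁ e₂, s => o.eval (e₁.eval s) (e₂.eval s)

/-- Cost of an evaluation: the bit lengths of all operands and results, plus one for each node. -/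
def Expr.cost : Expr → Store → ℕ
  | .reg i, s => (s i).size + 1
  | .const a, _ => a.size + 1
  | .bin o e₁ e₂, s => e₁.cost s + e₂.cost s + (o.eval (e₁.eval s) (e₂.eval s)).size + 1

/-- Programs. -/
inductive Prog
  /-- do nothing -/
  | skip
  /-- `i := e` -/
  | assign (i : ℕ) (e : Expr)
  /-- `i :=` a uniformly random element of `{0, …, e - 1}` (and `0` if `e = 0`) -/
  | rand (i : ℕ) (e : Expr)
  /-- `i :=` the answer of the oracle to the query `e` -/
  | query (i : ℕ) (e : Expr)
  /-- `c₁ ; c₂` -/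
  | seq (c₁ c₂ : Prog)
  /-- if `e ≠ 0` then `c₁` else `c₂` -/
  | cond (e : Expr) (c₁ c₂ : Prog)
  /-- while `e ≠ 0` do `c` -/
  | loop (e : Expr) (c : Prog)

/-- The result of a computation: `some (s, t)` if it has halted with register contents `s` after
`t` steps, and `none` if it has exceeded the bound on the number of loop iterations. -/
abbrev Outcome := Option (Store × ℕ)

/-- Add `t` steps to the running time. -/
def Outcome.charge (t : ℕ) (o : Outcome) : Outcome := o.map fun r => (r.1, t + r.2)

/-- Sequential composition; running times add up. -/
def andThen (μ : PMF Outcome) (k : Store → PMF Outcome) : PMF Outcome :=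
  μ.bind fun o =>
    match o with
    | none => PMF.pure none
    | some (s, t) => (k s).map (Outcome.charge t)

/-- The uniform distribution on `{0, …, m - 1}` (the point mass at `0` if `m = 0`). -/
def uniformBelow (m : ℕ) : PMF ℕ := (PMF.uniformOfFintype (Fin (m - 1 + 1))).map Fin.val

/-- At most `fuel` tests of the condition of a while loop. -/
def iterate (e : Expr) (body : Store → PMF Outcome) : ℕ → Store → PMF Outcome
  | 0, _ => PMF.pure none
  | fuel + 1, s =>
    if e.eval s = 0 then PMF.pure (some (s, e.cost s + 1))
    else (andThen (body s) (iterate e body fuel)).map (Outcome.charge (e.cost s + 1))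

/-- The distribution of the outcome of a program with oracle `O`, when started in the store `s`;
every while loop is cut off after `fuel` tests of its condition. -/
def exec (O : ℕ → ℕ) (fuel : ℕ) : Prog → Store → PMF Outcome
  | .skip, s => PMF.pure (some (s, 1))
  | .assign i e, s => PMF.pure (some (Function.update s i (e.eval s), e.cost s + 1))
  | .rand i e, s =>
    (uniformBelow (e.eval s)).map fun r => some (Function.update s i r, e.cost s + 1)
  | .query i e, s =>
    PMF.pure (some (Function.update s i (O (e.eval s)), e.cost s + (O (e.eval s)).size + 1))
  | .seq c₁ c₂, s => andThen (exec O fuel c₁ s) (exec O fuel c₂)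
  | .cond e c₁ c₂, s =>
    (if e.eval s = 0 then exec O fuel c₂ s else exec O fuel c₁ s).map
      (Outcome.charge (e.cost s + 1))
  | .loop e c, s => iterate e (exec O fuel c) fuel s

/-- The input `l` is placed in the first registers; all others are `0`. -/
def load (l : List ℕ) : Store := fun i => l.getD i 0

/-- The bit length of an input. -/
def inputLength (l : List ℕ) : ℕ := (l.map fun a => a.size + 1).sum

/-- The probability that the program halts on input `l` with output `v`, that is, with the numbers
in the list `v` in its first registers. -/
def outProb (c : Prog) (O : ℕ → ℕ) (l v : List ℕ) : ENNReal :=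
  ⨆ fuel : ℕ, (exec O fuel c (load l)).toOuterMeasure
    {o | ∃ s t, o = some (s, t) ∧ (List.range v.length).map s = v}

/-- The program halts, for all its random choices, in time polynomial in the length of its input, on
every pair of an input and an oracle from the set `R`. -/
def PolyTime (c : Prog) (R : Set (List ℕ × (ℕ → ℕ))) : Prop :=
  ∃ T : Polynomial ℕ, ∀ r ∈ R, ∃ fuel : ℕ, ∀ o ∈ (exec r.2 fuel c (load r.1)).support,
    ∃ s t, o = some (s, t) ∧ t ≤ T.eval (inputLength r.1)

/-- The trivial oracle, for algorithms without oracle access. -/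
def noOracle : ℕ → ℕ := fun _ => 0

/-- `μ` is the distribution of the output (encoded by `enc`) of the program on input `l`. -/
def Samples {α : Type} (c : Prog) (l : List ℕ) (enc : α → List ℕ) (μ : PMF α) : Prop :=
  ∀ x, outProb c noOracle l (enc x) = μ x

/-- The input `1ⁿ`: the number whose binary expansion consists of `n` ones. -/
def unary (n : ℕ) : List ℕ := [2 ^ n - 1]

/-- The distributions `D n` can be sampled in polynomial time on input `1ⁿ`. -/
def EfficientGenerator {α : Type} (enc : α → List ℕ) (D : ℕ → PMF α) : Prop :=
  ∃ c : Prog, PolyTime c {r | ∃ n, r = (unary n, noOracle)} ∧ ∀ n, Samples c (unary n) enc (D n)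

/-- The mean of `f` under `μ`. -/
def mean {α : Type} (μ : PMF α) (f : α → ENNReal) : ENNReal := ∑' x, μ x * f x

/-- The two sequences of probabilities differ by less than the inverse of any polynomial, for all
sufficiently large `n`. -/
def Indistinguishable (P₀ P₁ : ℕ → ENNReal) : Prop :=
  ∀ r : Polynomial ℕ, r ≠ 0 → ∀ᶠ n : ℕ in atTop,
    |(P₀ n).toReal - (P₁ n).toReal| < 1 / ((r.eval n : ℕ) : ℝ)

/-! ## Collections of keyed functions and classical-secure pseudorandom functions -/

/-- An indexed collection of keyed functions `F_P : ℤ_K × {0,1}^ℓ → ℤ_M`, where `K`, `ℓ`, `M` depend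
on the parameterization `P`; parameterizations are written down as `arity` many numbers. -/
structure KeyedCollection where
  Param : Type
  arity : ℕ
  enc : Param → List ℕ
  enc_length : ∀ P, (enc P).length = arity
  enc_injective : Function.Injective enc
  keys : Param → ℕ
  inLen : Param → ℕ
  vals : Param → ℕ
  keys_ne : ∀ P, NeZero (keys P)
  vals_ne : ∀ P, NeZero (vals P)
  F : (P : Param) → ZMod (keys P) → (Fin (inLen P) → Bool) → ZMod (vals P)

attribute [instance] KeyedCollection.keys_ne KeyedCollection.vals_ne

/-- The collection is efficiently computable, with the distributions `gen n` of the output of the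
instance generator on input `1ⁿ`. -/
structure KeyedCollection.IsEfficient (C : KeyedCollection) (gen : ℕ → PMF C.Param) : Prop where
  infinite : Infinite C.Param
  /-- For all large `n`, the functions generated for `n` have domain `{0,1}ⁿ`; in particular the
  sets of parameterizations for distinct `n` are disjoint, and determine `n`. -/
  security_parameter : ∀ᶠ n in atTop, ∀ P ∈ (gen n).support, C.inLen P = n
  /-- The instance generator outputs `P`, with descriptions of key space, domain and codomain. -/
  instance_generation :
    EfficientGenerator (fun P => C.enc P ++ [C.keys P, C.inLen P, C.vals P]) gen
  /-- On input `P`, a key can be chosen uniformly at random. -/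
  key_selection : ∃ c : Prog, PolyTime c {r | ∃ P, r = (C.enc P, noOracle)} ∧
    ∀ P, Samples c (C.enc P) (fun k : ZMod (C.keys P) => [k.val])
      (PMF.uniformOfFintype (ZMod (C.keys P)))
  /-- On input `P, k, x`, the value `F_P(k, x)` can be computed. -/
  evaluation : ∃ c : Prog,
    PolyTime c {r | ∃ (P : C.Param) (k : ZMod (C.keys P)) (x : Fin (C.inLen P) → Bool),
      r = (C.enc P ++ [k.val, Nat.ofBits x], noOracle)} ∧
    ∀ (P : C.Param) (k : ZMod (C.keys P)) (x : Fin (C.inLen P) → Bool),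
      outProb c noOracle (C.enc P ++ [k.val, Nat.ofBits x]) [(C.F P k x).val] = 1

/-- The membership query oracle of `f : {0,1}^ℓ → ℤ_M`. A string `x` is given as the number with
binary digits `x`; a query outside the domain is answered by `0`. -/
def membershipQuery {l M : ℕ} (f : (Fin l → Bool) → ZMod M) : ℕ → ℕ :=
  fun x => if x < 2 ^ l then (f fun j => x.testBit j).val else 0

/-- The collection is a classical-secure pseudorandom function collection: it is efficiently
computable, and no probabilistic polynomial time algorithm with membership queries distinguishes
`F_P(k, ·)`, for a random key `k`, from a uniformly random function. -/
def KeyedCollection.IsClassicalSecurePRF (C : KeyedCollection) (gen : ℕ → PMF C.Param) : Prop :=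
  C.IsEfficient gen ∧
  ∀ A : Prog,
    PolyTime A {r | ∃ (n : ℕ) (P : C.Param) (f : (Fin (C.inLen P) → Bool) → ZMod (C.vals P)),
      P ∈ (gen n).support ∧ r = (C.enc P, membershipQuery f)} →
    Indistinguishable
      (fun n => mean (gen n) fun P =>
        mean (PMF.uniformOfFintype (ZMod (C.keys P))) fun k =>
          outProb A (membershipQuery (C.F P k)) (C.enc P) [1])
      (fun n => mean (gen n) fun P =>
        mean (PMF.uniformOfFintype ((Fin (C.inLen P) → Bool) → ZMod (C.vals P))) fun R =>
          outProb A (membershipQuery R) (C.enc P) [1])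

/-! ## Quadratic residues modulo a safe prime and the DDH assumption -/

/-- `p = 2q + 1` with `p` and `q` prime (then `q = p / 2` in integer division). -/
def IsSafePrime (p : ℕ) : Prop := p.Prime ∧ ∃ q : ℕ, q.Prime ∧ p = 2 * q + 1

/-- The group of quadratic residues modulo `N`. -/
def QR (N : ℕ) : Subgroup (ZMod N)ˣ := (powMonoidHom 2).range

/-- The number in `{0, …, N - 1}` that represents a quadratic residue. -/
def rep {N : ℕ} (y : QR N) : ℕ := ((y : (ZMod N)ˣ) : ZMod N).val

/-- A safe prime `p` and a generator `g` of the group of quadratic residues modulo `p`. -/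
structure QRInstance where
  p : ℕ
  safe : IsSafePrime p
  g : QR p
  generates : ∀ y : QR p, y ∈ Subgroup.zpowers g

/-- The order `q = (p - 1) / 2` of the group. -/
def QRInstance.q (G : QRInstance) : ℕ := G.p / 2

theorem QRInstance.q_prime (G : QRInstance) : G.q.Prime := by
  obtain ⟨_, q, hq, h⟩ := G.safe
  have : G.q = q := by unfold QRInstance.q; omega
  rwa [this]

instance (G : QRInstance) : NeZero G.q := ⟨G.q_prime.ne_zero⟩

instance (G : QRInstance) : NeZero G.p := ⟨G.safe.1.ne_zero⟩

def QRInstance.enc (G : QRInstance) : List ℕ := [G.p, rep G.g]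

/-- `IG n` is the distribution of the output, on input `1ⁿ`, of an efficient instance generator for
the group family of quadratic residues: a polynomial time algorithm whose outputs are pairs `(p, g)`
of a safe prime and a generator, where `p` has exactly `n` bits. (There is no safe prime with fewer
than three bits, so the number of bits is prescribed for all large `n` only.) -/
def IsInstanceGenerator (IG : ℕ → PMF QRInstance) : Prop :=
  EfficientGenerator QRInstance.enc IG ∧
    ∀ᶠ n in atTop, ∀ G ∈ (IG n).support, G.p.size = n

/-- The decisional Diffie-Hellman assumption for the quadratic residues with generator `IG`. -/
def DDH (IG : ℕ → PMF QRInstance) : Prop :=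
  ∀ A : Prog,
    PolyTime A {r | ∃ (n : ℕ) (G : QRInstance) (u v w : QR G.p), G ∈ (IG n).support ∧
      r = ([G.p, rep G.g, rep u, rep v, rep w], noOracle)} →
    Indistinguishable
      (fun n => mean (IG n) fun G =>
        mean (PMF.uniformOfFintype (ZMod G.q)) fun a =>
        mean (PMF.uniformOfFintype (ZMod G.q)) fun b =>
          outProb A noOracle [G.p, rep G.g, rep (G.g ^ a.val), rep (G.g ^ b.val),
            rep (G.g ^ (a.val * b.val))] [1])
      (fun n => mean (IG n) fun G =>
        mean (PMF.uniformOfFintype (ZMod G.q)) fun a =>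
        mean (PMF.uniformOfFintype (ZMod G.q)) fun b =>
        mean (PMF.uniformOfFintype (ZMod G.q)) fun c =>
          outProb A noOracle [G.p, rep G.g, rep (G.g ^ a.val), rep (G.g ^ b.val),
            rep (G.g ^ c.val)] [1])

/-! ## The keyed functions -/

/-- A parameterization `(p, g, h)` with `h = g ^ a`. -/
structure GGMParam extends QRInstance where
  h : QR p

def GGMParam.enc (P : GGMParam) : List ℕ := [P.p, rep P.g, rep P.h]

theorem GGMParam.enc_injective : Function.Injective GGMParam.enc := by
  have key : ∀ {N : ℕ} [NeZero N] (y z : QR N), rep y = rep z → y = z := fun y z hyz =>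
    Subtype.ext (Units.ext (ZMod.val_injective _ hyz))
  rintro ⟨⟨p, hp, g, hg⟩, h⟩ ⟨⟨p', hp', g', hg'⟩, h'⟩ e
  simp only [GGMParam.enc, List.cons.injEq] at e
  obtain ⟨rfl, e₁, e₂, -⟩ := e
  have : NeZero p := ⟨hp.1.ne_zero⟩
  obtain rfl := key _ _ e₁
  obtain rfl := key _ _ e₂
  rfl

/-- `modexp_{p,g}(b) = g ^ b mod p`. -/
def modexp {p : ℕ} (g : QR p) (b : ℕ) : QR p := g ^ b

/-- `f_p : QR_p → ℤ_q`, `f_p(x) = x` if `x ≤ q` and `f_p(x) = p - x` if `x > q`. -/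
def fold {p : ℕ} (y : QR p) : ZMod (p / 2) :=
  if rep y ≤ p / 2 then (rep y : ZMod (p / 2)) else ((p - rep y : ℕ) : ZMod (p / 2))

/-- One level of the tree: `f_p ∘ modexp_{p,g}` for the bit 0, `f_p ∘ modexp_{p,h}` for the bit 1. -/
def GGMParam.step (P : GGMParam) (bit : Bool) (b : ZMod P.q) : ZMod P.q :=
  fold (modexp (if bit then P.h else P.g) b.val)

/-- `F_{(p,g,h)}(b, x)` for `x = x₁ … xₙ`: apply the steps for `x₁`, …, `xₙ` in this order. -/
def GGMParam.F (P : GGMParam) (b : ZMod P.q) {n : ℕ} (x : Fin n → Bool) : ZMod P.q :=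
  (List.ofFn x).foldl (fun c bit => P.step bit c) b

/-- The collection `{F_{(p,g,h)}}`, `F_{(p,g,h)} : ℤ_q × {0,1}ⁿ → ℤ_q`, for `n`-bit `p`. -/
abbrev ggmCollection : KeyedCollection where
  Param := GGMParam
  arity := 3
  enc := GGMParam.enc
  enc_length := fun _ => rfl
  enc_injective := GGMParam.enc_injective
  keys := fun P => P.q
  inLen := fun P => P.p.size
  vals := fun P => P.q
  keys_ne := fun _ => inferInstance
  vals_ne := fun _ => inferInstance
  F := fun P b x => P.F b x

/-- The instance generator of the collection: generate `(p, g)`, choose `a ∈ ℤ_q` uniformly at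
random, and output `(p, g, g ^ a)`. -/
def ggmGenerator (IG : ℕ → PMF QRInstance) (n : ℕ) : PMF ggmCollection.Param :=
  (IG n).bind fun G =>
    (PMF.uniformOfFintype (ZMod G.q)).map fun a => (⟨G, G.g ^ a.val⟩ : GGMParam)

end QRPRF

end

noncomputable section

namespace QRPRF

/-! ## Means -/

section Mean

variable {α β : Type}

/-! The function is a tree construction of Goldreich-Goldwasser-Micali type. With `h = g ^ a`, a
seed `b` has the two children `f_p(g ^ b)` and `f_p(h ^ b)`. By DDH the pair `(g ^ b, g ^ (a * b))`
looks like two independent random group elements. For odd `q` the map `f_p` is a bijection from the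
residues onto `ℤ_q`, because `-1` is not a square (`QRInstance.fold_injective`), so the children
look like two independent random seeds.

Security follows by a hybrid argument. The hybrid with number `j` applies a uniformly random
function to the first `j` bits and the tree to the remaining ones; number `0` is the keyed function
(`hybridProb_zero`), number `n` the random function (`hybridProb_last`). Passing from `j` to `j + 1`
needs one pair for every node that is queried, all with the same `a`. Random self-reducibility
provides them without loss: from `u = g ^ a`, `v = g ^ b`, `w = g ^ c` and random `s`, `r` form `v ^
s * g ^ r` and `w ^ s * u ^ r`, with exponents `b * s + r` and `c * s + a * r`. If `c = a * b`, the
second exponent is `a` times the first, which is uniform: this is hybrid `j`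
(`mean_tupleHybrid_real`). If `c ≠ a * b`, the linear map is invertible and the exponents are
uniform and independent: this is hybrid `j + 1` (`mean_tupleHybrid_random`). A distinguisher that
draws `j` at random loses a factor `n` by telescoping (`telescope`, `abs_hybrid_sub_le`), and the
exceptional event `c = a * b` has the negligible probability `1 / q`.

Most of the work is to realise this distinguisher as a program. Programs are analysed through `wp`,
the mean of a function of final store and running time, which is computed along the syntax. Fuel is
harmless since each loop test costs a step (`wp_fuel_le`). The random function has exponentially
many values and is therefore sampled lazily: `lazyWp_completions` says that this gives the same
means as drawing it in advance, and `AnswersQueries.le_wp` transfers the lazy semantics to a program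
that keeps a table in its working registers. The simulation is only bounded from below. Doing so for
acceptance and rejection alike, two events of total probability one since `A` halts, forces equality
(`eq_of_le_of_add_eq_one`, `distinguisher_spec`).

Efficiency rests on square and multiply (`powLoop_runs`); the output distribution of the instance
generator is again obtained from lower bounds alone (`samples_of_le`). -/

theorem mean_pure (a : α) (f : α → ENNReal) : mean (PMF.pure a) f = f a := by
  unfold mean
  rw [tsum_eq_single a]
  · simp
  · intro b hb; simp [PMF.pure_apply, hb]

theorem mean_bind (μ : PMF α) (k : α → PMF β) (f : β → ENNReal) :
    mean (μ.bind k) f = mean μ fun a => mean (k a) f := by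
  unfold mean
  simp_rw [PMF.bind_apply, ← ENNReal.tsum_mul_right, ← ENNReal.tsum_mul_left]
  rw [ENNReal.tsum_comm]
  simp_rw [mul_assoc]

theorem mean_map (μ : PMF α) (k : α → β) (f : β → ENNReal) :
    mean (μ.map k) f = mean μ fun a => f (k a) := by
  unfold PMF.map
  rw [mean_bind]
  simp [mean_pure]

theorem mean_mono_support {μ : PMF α} {f g : α → ENNReal} (h : ∀ a ∈ μ.support, f a ≤ g a) :
    mean μ f ≤ mean μ g := by
  refine ENNReal.tsum_le_tsum fun a => ?_
  by_cases ha : μ a = 0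
  · simp [ha]
  · gcongr; exact h a ((PMF.mem_support_iff _ _).2 ha)

theorem mean_mono {μ : PMF α} {f g : α → ENNReal} (h : ∀ a, f a ≤ g a) : mean μ f ≤ mean μ g :=
  mean_mono_support fun a _ => h a

theorem mean_congr_support {μ : PMF α} {f g : α → ENNReal} (h : ∀ a ∈ μ.support, f a = g a) :
    mean μ f = mean μ g :=
  le_antisymm (mean_mono_support fun a ha => (h a ha).le)
    (mean_mono_support fun a ha => (h a ha).ge)

theorem mean_add (μ : PMF α) (f g : α → ENNReal) :
    mean μ (fun a => f a + g a) = mean μ f + mean μ g := by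
  simp [mean, mul_add, ENNReal.tsum_add]

theorem mean_const_mul (μ : PMF α) (c : ENNReal) (f : α → ENNReal) :
    mean μ (fun a => c * f a) = c * mean μ f := by
  simp [mean, mul_left_comm, ENNReal.tsum_mul_left]

theorem mean_const (μ : PMF α) (c : ENNReal) : mean μ (fun _ => c) = c := by
  simp [mean, ENNReal.tsum_mul_right, μ.tsum_coe]

theorem mean_le_one {μ : PMF α} {f : α → ENNReal} (h : ∀ a, f a ≤ 1) : mean μ f ≤ 1 :=
  (mean_mono h).trans (mean_const μ 1).le

theorem mean_ne_top {μ : PMF α} {f : α → ENNReal} (h : ∀ a, f a ≤ 1) : mean μ f ≠ ⊤ :=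
  ((mean_le_one h).trans_lt ENNReal.one_lt_top).ne

theorem mean_comm (μ : PMF α) (ν : PMF β) (f : α → β → ENNReal) :
    mean μ (fun a => mean ν (f a)) = mean ν fun b => mean μ fun a => f a b := by
  unfold mean
  simp_rw [← ENNReal.tsum_mul_left]
  rw [ENNReal.tsum_comm]
  simp_rw [mul_left_comm]

theorem mean_uniform [Fintype α] [Nonempty α] (f : α → ENNReal) :
    mean (PMF.uniformOfFintype α) f = (Fintype.card α : ENNReal)⁻¹ * ∑ a, f a := by
  simp [mean, tsum_fintype, Finset.mul_sum]

/-- A function all of whose fibres have the same size maps uniform elements to uniform ones. -/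
theorem mean_uniform_comp [Fintype α] [Nonempty α] [Fintype β] [Nonempty β] [DecidableEq β]
    (φ : α → β) (k : ℕ) (hφ : ∀ b, (Finset.univ.filter fun a => φ a = b).card = k)
    (f : β → ENNReal) :
    mean (PMF.uniformOfFintype α) (fun a => f (φ a)) = mean (PMF.uniformOfFintype β) f := by
  have h1 : Fintype.card α = Fintype.card β * k := by
    rw [← Finset.card_univ, Finset.card_eq_sum_card_fiberwise (f := φ) (t := Finset.univ)
      (fun _ _ => by simp)]
    simp [hφ]
  have h2 : ∑ a, f (φ a) = k * ∑ b, f b := by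
    rw [← Finset.sum_fiberwise (s := Finset.univ) (g := φ), Finset.mul_sum]
    refine Finset.sum_congr rfl fun b _ => ?_
    rw [Finset.sum_congr rfl (g := fun _ => f b) fun a ha => by simp_all]
    simp [hφ]
  have hk : (k : ENNReal) ≠ 0 := by
    rintro h
    have : Fintype.card α = 0 := by rw [h1, Nat.cast_eq_zero.1 h, mul_zero]
    exact Fintype.card_ne_zero this
  rw [mean_uniform, mean_uniform, h1, h2, Nat.cast_mul, ENNReal.mul_inv (by simp) (by simp),
    mul_assoc, ← mul_assoc _ (k : ENNReal), ENNReal.inv_mul_cancel hk (by simp), one_mul]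

theorem mean_uniform_equiv [Fintype α] [Nonempty α] [Fintype β] [Nonempty β]
    (φ : α ≃ β) (f : β → ENNReal) :
    mean (PMF.uniformOfFintype α) (fun a => f (φ a)) = mean (PMF.uniformOfFintype β) f := by
  classical
  refine mean_uniform_comp φ 1 (fun b => ?_) f
  rw [Finset.card_eq_one]
  exact ⟨φ.symm b, by ext a; simp [Equiv.eq_symm_apply]⟩

/-- Composing a uniformly random function with an equidistributed function. -/
theorem mean_uniform_fun_comp {ι : Type} [Fintype ι] [DecidableEq ι] [Fintype α] [Nonempty α]
    [Fintype β] [Nonempty β] [DecidableEq α] [DecidableEq β] (φ : α → β) (k : ℕ)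
    (hφ : ∀ b, (Finset.univ.filter fun a => φ a = b).card = k) (F : (ι → β) → ENNReal) :
    mean (PMF.uniformOfFintype (ι → α)) (fun f => F fun i => φ (f i)) =
      mean (PMF.uniformOfFintype (ι → β)) F := by
  refine mean_uniform_comp (fun (f : ι → α) i => φ (f i)) (k ^ Fintype.card ι) (fun h => ?_) F
  -- A fibre of pointwise composition is a product of fibres of `φ`, hence of constant size `k ^
  -- Fintype.card ι`.
  have : (Finset.univ.filter fun f : ι → α => (fun i => φ (f i)) = h) =
      Fintype.piFinset fun i => Finset.univ.filter fun a => φ a = h i := by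
    ext f; simp [funext_iff]
  rw [this, Fintype.card_piFinset]
  simp [hφ]

/-- Resampling one value of a uniformly random function. -/
theorem mean_uniform_update {ι : Type} [Fintype ι] [DecidableEq ι] [Fintype α] [Nonempty α]
    (i : ι) (F : (ι → α) → ENNReal) :
    mean (PMF.uniformOfFintype (ι → α)) F =
      mean (PMF.uniformOfFintype α) fun a =>
        mean (PMF.uniformOfFintype (ι → α)) fun f => F (Function.update f i a) := by
  -- Exchanging the fresh value with the value stored at `i` is an involution on pairs, so it
  -- permutes the terms of the double sum.
  let e : (α × (ι → α)) ≃ (α × (ι → α)) :=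
    { toFun := fun x => (x.2 i, Function.update x.2 i x.1)
      invFun := fun x => (x.2 i, Function.update x.2 i x.1)
      left_inv := fun x => by simp
      right_inv := fun x => by simp }
  have h : ∑ a, ∑ f : ι → α, F (Function.update f i a) = Fintype.card α * ∑ f : ι → α, F f := by
    rw [← Fintype.sum_prod_type' (f := fun a f => F (Function.update f i a)),
      ← Equiv.sum_comp e.symm, Fintype.sum_prod_type]
    simp [e]
  rw [mean_uniform, mean_uniform]
  simp_rw [mean_uniform]
  rw [← Finset.mul_sum, h, mul_left_comm, ← mul_assoc (_⁻¹ : ENNReal) _ (∑ f, F f),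
    ENNReal.inv_mul_cancel (by simp) (by simp), one_mul]

theorem mean_uniformBelow {m : ℕ} (hm : 0 < m) (f : ℕ → ENNReal) :
    mean (uniformBelow m) f = (m : ENNReal)⁻¹ * ∑ r ∈ Finset.range m, f r := by
  obtain ⟨k, rfl⟩ : ∃ k, m = k + 1 := ⟨m - 1, by omega⟩
  rw [uniformBelow, mean_map, mean_uniform, Fin.sum_univ_eq_sum_range]
  simp

theorem mean_uniformBelow_eq (m : ℕ) (f : ℕ → ENNReal) :
    mean (uniformBelow m) f = mean (PMF.uniformOfFintype (Fin (m - 1 + 1))) fun r => f r := by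
  rw [uniformBelow, mean_map]

theorem mem_support_uniformBelow {m r : ℕ} (h : r ∈ (uniformBelow m).support) : r ≤ m - 1 := by
  simp only [uniformBelow, PMF.support_map, Set.mem_image] at h
  obtain ⟨a, -, rfl⟩ := h
  omega

theorem mean_zmod {q : ℕ} [NeZero q] (f : ℕ → ENNReal) :
    mean (PMF.uniformOfFintype (ZMod q)) (fun a => f a.val) = mean (uniformBelow q) f := by
  rw [mean_uniformBelow (NeZero.pos q), mean_uniform, ZMod.card]
  congr 1
  obtain ⟨k, rfl⟩ : ∃ k, q = k + 1 := ⟨q - 1, by have := NeZero.pos q; omega⟩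
  exact Fin.sum_univ_eq_sum_range f (k + 1)

end Mean

/-! ## Mean values over the runs of a program -/

/-- Extend a function of final store and running time by `0` to all outcomes. -/
def onHalt (φ : Store → ℕ → ENNReal) : Outcome → ENNReal
  | none => 0
  | some (s, t) => φ s t

/-- The mean of `φ` over the halting runs. -/
def wp (O : ℕ → ℕ) (F : ℕ) (c : Prog) (s : Store) (φ : Store → ℕ → ENNReal) : ENNReal :=
  mean (exec O F c s) (onHalt φ)

/-- The mean of `φ` over the halting runs of a loop with at most `k` tests. -/
def wpIter (O : ℕ → ℕ) (F : ℕ) (e : Expr) (c : Prog) (k : ℕ) (s : Store)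
    (φ : Store → ℕ → ENNReal) : ENNReal :=
  mean (iterate e (exec O F c) k s) (onHalt φ)

theorem mean_charge (μ : PMF Outcome) (t : ℕ) (φ : Store → ℕ → ENNReal) :
    mean (μ.map (Outcome.charge t)) (onHalt φ) = mean μ (onHalt fun s t' => φ s (t + t')) := by
  rw [mean_map]
  congr 1
  ext o
  rcases o with _ | ⟨s, t'⟩ <;> rfl

theorem mean_andThen (μ : PMF Outcome) (k : Store → PMF Outcome) (φ : Store → ℕ → ENNReal) :
    mean (andThen μ k) (onHalt φ) =
      mean μ (onHalt fun s t => mean (k s) (onHalt fun s' t' => φ s' (t + t'))) := by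
  rw [andThen, mean_bind]
  congr 1
  ext o
  rcases o with _ | ⟨s, t⟩
  · simp [mean_pure, onHalt]
  · simp [mean_charge, onHalt]

section wp

variable (O : ℕ → ℕ) (F : ℕ) (s : Store) (φ : Store → ℕ → ENNReal)

theorem wp_skip : wp O F .skip s φ = φ s 1 := by simp [wp, exec, mean_pure, onHalt]

theorem wp_assign (i : ℕ) (e : Expr) :
    wp O F (.assign i e) s φ = φ (Function.update s i (e.eval s)) (e.cost s + 1) := by
  simp [wp, exec, mean_pure, onHalt]

theorem wp_rand (i : ℕ) (e : Expr) :
    wp O F (.rand i e) s φ =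
      mean (uniformBelow (e.eval s)) fun r => φ (Function.update s i r) (e.cost s + 1) := by
  simp [wp, exec, mean_map, onHalt]

theorem wp_query (i : ℕ) (e : Expr) :
    wp O F (.query i e) s φ =
      φ (Function.update s i (O (e.eval s))) (e.cost s + (O (e.eval s)).size + 1) := by
  simp [wp, exec, mean_pure, onHalt]

theorem wp_seq (c₁ c₂ : Prog) :
    wp O F (.seq c₁ c₂) s φ =
      wp O F c₁ s fun s₁ t₁ => wp O F c₂ s₁ fun s₂ t₂ => φ s₂ (t₁ + t₂) := by
  simp [wp, exec, mean_andThen]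

theorem wp_cond (e : Expr) (c₁ c₂ : Prog) :
    wp O F (.cond e c₁ c₂) s φ =
      wp O F (if e.eval s = 0 then c₂ else c₁) s fun s' t => φ s' (e.cost s + 1 + t) := by
  unfold wp
  rw [exec, mean_charge]
  split_ifs <;> rfl

theorem wp_loop (e : Expr) (c : Prog) :
    wp O F (.loop e c) s φ = wpIter O F e c F s φ := by
  simp [wp, wpIter, exec]

theorem wpIter_zero (e : Expr) (c : Prog) : wpIter O F e c 0 s φ = 0 := by
  simp [wpIter, iterate, mean_pure, onHalt]

theorem wpIter_succ (e : Expr) (c : Prog) (k : ℕ) :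
    wpIter O F e c (k + 1) s φ =
      if e.eval s = 0 then φ s (e.cost s + 1)
      else wp O F c s fun s₁ t₁ => wpIter O F e c k s₁ fun s₂ t₂ =>
        φ s₂ (e.cost s + 1 + (t₁ + t₂)) := by
  unfold wpIter wp
  rw [iterate]
  split_ifs
  · simp [mean_pure, onHalt]
  · rw [mean_charge, mean_andThen]

end wp

section wpBasic

variable {O : ℕ → ℕ} {F : ℕ} {c : Prog} {s : Store} {φ ψ : Store → ℕ → ENNReal}

theorem onHalt_mono (h : ∀ s t, φ s t ≤ ψ s t) (o : Outcome) : onHalt φ o ≤ onHalt ψ o := by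
  rcases o with _ | ⟨s, t⟩
  · exact le_rfl
  · exact h s t

theorem wp_mono (h : ∀ s t, φ s t ≤ ψ s t) : wp O F c s φ ≤ wp O F c s ψ :=
  mean_mono (onHalt_mono h)

theorem wp_add : wp O F c s (fun s t => φ s t + ψ s t) = wp O F c s φ + wp O F c s ψ := by
  unfold wp
  rw [← mean_add]
  congr 1; ext o
  rcases o with _ | ⟨s, t⟩ <;> simp [onHalt]

theorem wp_const_mul (a : ENNReal) :
    wp O F c s (fun s t => a * φ s t) = a * wp O F c s φ := by
  unfold wp
  rw [← mean_const_mul]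
  congr 1; ext o
  rcases o with _ | ⟨s, t⟩ <;> simp [onHalt]

theorem onHalt_le_one (h : ∀ s t, φ s t ≤ 1) (o : Outcome) : onHalt φ o ≤ 1 := by
  rcases o with _ | ⟨s, t⟩
  · exact zero_le
  · exact h s t

theorem wp_le_one (h : ∀ s t, φ s t ≤ 1) : wp O F c s φ ≤ 1 :=
  mean_le_one (onHalt_le_one h)

theorem wp_zero : wp O F c s (fun _ _ => 0) = 0 := by
  have : onHalt (fun _ _ => 0) = fun _ => 0 := by
    ext o; rcases o with _ | ⟨s, t⟩ <;> rfl
  rw [wp, this, mean_const]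

theorem wpIter_zero_fun {e : Expr} {k : ℕ} : wpIter O F e c k s (fun _ _ => 0) = 0 := by
  have : onHalt (fun _ _ => 0) = fun _ => 0 := by
    ext o; rcases o with _ | ⟨s, t⟩ <;> rfl
  rw [wpIter, this, mean_const]

theorem wpIter_eq_zero {e : Expr} {k : ℕ} (h : ∀ s t, φ s t = 0) :
    wpIter O F e c k s φ = 0 := by
  have : φ = fun _ _ => 0 := by ext; exact h _ _
  rw [this, wpIter_zero_fun]

theorem wp_eq_zero (h : ∀ s t, φ s t = 0) : wp O F c s φ = 0 := by
  have : φ = fun _ _ => 0 := by ext; exact h _ _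
  rw [this, wp_zero]

end wpBasic

open Classical in
/-- The indicator function of a proposition. -/
def ind (p : Prop) : ENNReal := if p then 1 else 0

theorem ind_true {p : Prop} (h : p) : ind p = 1 := by simp [ind, h]
theorem ind_false {p : Prop} (h : ¬p) : ind p = 0 := by simp [ind, h]
theorem ind_le_one (p : Prop) : ind p ≤ 1 := by unfold ind; split_ifs <;> simp
theorem ind_mono {p q : Prop} (h : p → q) : ind p ≤ ind q := by
  by_cases hp : p
  · rw [ind_true hp, ind_true (h hp)]
  · rw [ind_false hp]; exact zero_le
theorem ind_congr {p q : Prop} (h : p ↔ q) : ind p = ind q := by rw [propext h]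

/-- Moves output probabilities into the calculus of means, where all later computations take place.
-/
theorem outProb_eq (c : Prog) (O : ℕ → ℕ) (l v : List ℕ) :
    outProb c O l v =
      ⨆ F, wp O F c (load l) fun s _ => ind ((List.range v.length).map s = v) := by
  unfold outProb wp mean
  congr 1; ext F
  rw [PMF.toOuterMeasure_apply]
  congr 1; ext o
  rcases o with _ | ⟨s, t⟩
  · simp [onHalt, Set.indicator]
  · by_cases h : (List.range v.length).map s = v
    · rw [Set.indicator_of_mem]
      · simp [onHalt, ind, h]
      · exact ⟨s, t, rfl, h⟩
    · rw [Set.indicator_of_notMem]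
      · simp [onHalt, ind, h]
      · rintro ⟨s', t', h', h''⟩
        simp only [Option.some.injEq, Prod.mk.injEq] at h'
        exact h (h'.1 ▸ h'')

/-- A mean of a function bounded by one equals one only if the function is one on the whole support.
Halting for all random choices thus becomes an equation between means. -/
theorem forall_support_iff (μ : PMF Outcome) (T : ℕ) :
    (∀ o ∈ μ.support, ∃ s t, o = some (s, t) ∧ t ≤ T) ↔
      mean μ (onHalt fun _ t => ind (t ≤ T)) = 1 := by
  constructor
  · intro h
    rw [← mean_const μ 1]
    refine mean_congr_support fun o ho => ?_
    obtain ⟨s, t, rfl, ht⟩ := h o ho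
    simp [onHalt, ind, ht]
  · intro h o ho
    have key : onHalt (fun _ t => ind (t ≤ T)) o = 1 := by
      by_contra hne
      have hlt : onHalt (fun _ t => ind (t ≤ T)) o < 1 :=
        lt_of_le_of_ne (onHalt_le_one (fun _ _ => ind_le_one _) o) hne
      have : mean μ (onHalt fun _ t => ind (t ≤ T)) < mean μ fun _ => 1 := by
        refine ENNReal.tsum_lt_tsum (i := o) ?_ (fun a => ?_) ?_
        · exact mean_ne_top (onHalt_le_one fun _ _ => ind_le_one _)
        · gcongr; exact onHalt_le_one (fun _ _ => ind_le_one _) a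
        · rw [ENNReal.mul_lt_mul_iff_right ((PMF.mem_support_iff _ _).1 ho) (PMF.apply_ne_top _ _)]
          exact hlt
      rw [mean_const, h] at this
      exact lt_irrefl _ this
    rcases o with _ | ⟨s, t⟩
    · simp [onHalt] at key
    · refine ⟨s, t, rfl, ?_⟩
      by_contra ht
      simp [onHalt, ind, ht] at key

theorem polyTime_iff (c : Prog) (R : Set (List ℕ × (ℕ → ℕ))) :
    PolyTime c R ↔ ∃ T : Polynomial ℕ, ∀ r ∈ R, ∃ F,
      wp r.2 F c (load r.1) (fun _ t => ind (t ≤ T.eval (inputLength r.1))) = 1 := by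
  simp only [PolyTime, wp, ← forall_support_iff]

/-! ## Fuel, halting and sizes -/

section Fuel

variable {O : ℕ → ℕ} {F F' : ℕ}

/-- Each test of a loop costs at least one step, so a run of at most `F'` steps never exhausts the
fuel `F'`. Hence fuel may even be decreased to `F'` if `φ` ignores the longer runs; this is the
second alternative. -/
theorem wp_fuel_le {c : Prog} : ∀ {s : Store} {φ : Store → ℕ → ENNReal},
    (F ≤ F' ∨ ∀ s t, F' < t → φ s t = 0) → wp O F c s φ ≤ wp O F' c s φ := by
  induction c with
  | skip => intro s φ _; simp [wp_skip]
  | assign i e => intro s φ _; simp [wp_assign]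
  | rand i e => intro s φ _; simp [wp_rand]
  | query i e => intro s φ _; simp [wp_query]
  | cond e c₁ c₂ ih₁ ih₂ =>
    intro s φ h
    have h' : F ≤ F' ∨ ∀ s' t, F' < t → φ s' (e.cost s + 1 + t) = 0 :=
      h.imp_right fun h s' t ht => h _ _ (by omega)
    rw [wp_cond, wp_cond]
    split_ifs
    · exact ih₂ h'
    · exact ih₁ h'
  | seq c₁ c₂ ih₁ ih₂ =>
    intro s φ h
    rw [wp_seq, wp_seq]
    refine (wp_mono fun s₁ t₁ => ih₂ ?_).trans (ih₁ ?_)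
    · exact h.imp_right fun h s t ht => h _ _ (by omega)
    · exact h.imp_right fun h s t ht => wp_eq_zero fun s' t' => h _ _ (by omega)
  | loop e c ih =>
    intro s φ h
    rw [wp_loop, wp_loop]
    -- The number of remaining tests is separated from the fuel of the body, since only the former
    -- decreases from round to round.
    have key : ∀ k k' s φ, (F ≤ F' ∧ k ≤ k' ∨ (∀ s t, F' < t → φ s t = 0) ∧
        ∀ s t, k' < t → φ s t = 0) → wpIter O F e c k s φ ≤ wpIter O F' e c k' s φ := by
      intro k
      induction k with
      | zero => intro k' s φ _; rw [wpIter_zero]; exact zero_le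
      | succ k ihk =>
        intro k' s φ h
        rcases k' with _ | k'
        · rcases h with h | h
          · omega
          · rw [wpIter_succ]
            split_ifs
            · rw [h.2 _ _ (by omega)]; exact zero_le
            · refine (wp_eq_zero fun s' t' => wpIter_eq_zero fun s' t' => ?_).le.trans zero_le
              exact h.2 _ _ (by omega)
        · rw [wpIter_succ, wpIter_succ]
          split_ifs
          · exact le_rfl
          · refine (wp_mono fun s₁ t₁ => ihk k' _ _ ?_).trans (ih ?_)
            · rcases h with h | h
              · exact .inl ⟨h.1, by omega⟩
              · exact .inr ⟨fun s t ht => h.1 _ _ (by omega), fun s t ht => h.2 _ _ (by omega)⟩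
            · rcases h with h | h
              · exact .inl h.1
              · exact .inr fun s t ht => wpIter_eq_zero fun s' t' => h.1 _ _ (by omega)
    refine key _ _ _ _ ?_
    rcases h with h | h
    · exact .inl ⟨h, h⟩
    · exact .inr ⟨h, h⟩

theorem Expr.size_eval_le (e : Expr) (s : Store) : (e.eval s).size ≤ e.cost s := by
  cases e <;> simp only [Expr.eval, Expr.cost] <;> omega

theorem size_update_le {s : Store} {B B' i v : ℕ} (h : ∀ i, (s i).size ≤ B) (hB : B ≤ B')
    (hv : v.size ≤ B') (j : ℕ) : (Function.update s i v j).size ≤ B' := by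
  by_cases hj : j = i
  · subst hj; simpa using hv
  · simpa [hj] using (h j).trans hB

/-- The numbers in the registers grow by at most one bit in each step. -/
theorem wp_mono_size {c : Prog} : ∀ {s : Store} {B : ℕ} {φ ψ : Store → ℕ → ENNReal},
    (∀ i, (s i).size ≤ B) →
    (∀ s' t, (∀ i, (s' i).size ≤ B + t) → φ s' t ≤ ψ s' t) → wp O F c s φ ≤ wp O F c s ψ := by
  induction c with
  | skip =>
    intro s B φ ψ hs h
    simp only [wp_skip]
    exact h _ _ fun i => (hs i).trans (by omega)
  | assign i e =>
    intro s B φ ψ hs h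
    simp only [wp_assign]
    have := e.size_eval_le s
    exact h _ _ (size_update_le hs (by omega) (by omega))
  | rand i e =>
    intro s B φ ψ hs h
    simp only [wp_rand]
    have := e.size_eval_le s
    refine mean_mono_support fun r hr => h _ _ (size_update_le hs (by omega) ?_)
    have hr' : r ≤ e.eval s := (mem_support_uniformBelow hr).trans (by omega)
    exact (Nat.size_le_size hr').trans (by omega)
  | query i e =>
    intro s B φ ψ hs h
    simp only [wp_query]
    exact h _ _ (size_update_le hs (by omega) (by omega))
  | cond e c₁ c₂ ih₁ ih₂ =>
    intro s B φ ψ hs h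
    simp only [wp_cond]
    split_ifs
    · exact ih₂ hs fun s' t hs' => h _ _ fun i => (hs' i).trans (by omega)
    · exact ih₁ hs fun s' t hs' => h _ _ fun i => (hs' i).trans (by omega)
  | seq c₁ c₂ ih₁ ih₂ =>
    intro s B φ ψ hs h
    simp only [wp_seq]
    refine ih₁ hs fun s₁ t₁ hs₁ => ih₂ hs₁ fun s₂ t₂ hs₂ => h _ _ fun i => ?_
    exact (hs₂ i).trans (by omega)
  | loop e c ih =>
    intro s B φ ψ hs h
    simp only [wp_loop]
    have key : ∀ k s B φ ψ, (∀ i, (s i).size ≤ B) →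
        (∀ s' t, (∀ i, (s' i).size ≤ B + t) → φ s' t ≤ ψ s' t) →
        wpIter O F e c k s φ ≤ wpIter O F e c k s ψ := by
      intro k
      induction k with
      | zero => intros; rw [wpIter_zero]; exact zero_le
      | succ k ihk =>
        intro s B φ ψ hs h
        rw [wpIter_succ, wpIter_succ]
        split_ifs
        · exact h _ _ fun i => (hs i).trans (by omega)
        · refine ih hs fun s₁ t₁ hs₁ => ihk _ _ _ _ hs₁ fun s₂ t₂ hs₂ => h _ _ fun i => ?_
          exact (hs₂ i).trans (by omega)
    exact key _ _ _ _ _ hs h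

end Fuel

/-! ### Programs that halt within a known time bound. -/

section Halting

variable {O : ℕ → ℕ} {F₀ T : ℕ} {c : Prog} {s : Store} {φ : Store → ℕ → ENNReal}

/-- The second alternative of `wp_fuel_le` permits the change of fuel even if `F` is smaller than
`F₀`. -/
theorem wp_halts_of_le (h : wp O F₀ c s (fun _ t => ind (t ≤ T)) = 1) {F : ℕ} (hF : T ≤ F) :
    wp O F c s (fun _ t => ind (t ≤ T)) = 1 :=
  le_antisymm (wp_le_one fun _ _ => ind_le_one _) <| h ▸ wp_fuel_le (.inr fun _ _ ht =>
    ind_false (by omega))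

/-- The runs within time `T` already have total mass one, so the longer ones have mass zero and do
not contribute. -/
theorem wp_eq_of_halts (h : wp O F₀ c s (fun _ t => ind (t ≤ T)) = 1) (hφ : ∀ s t, φ s t ≤ 1)
    {F : ℕ} (hF : T ≤ F) :
    wp O F c s φ = wp O F c s (fun s t => ind (t ≤ T) * φ s t) := by
  have h₁ := wp_halts_of_le h hF
  have h₂ : wp O F c s (fun _ t => ind (¬t ≤ T)) = 0 := by
    have h₃ : wp O F c s (fun _ t => ind (t ≤ T) + ind (¬t ≤ T)) ≤ 1 := wp_le_one fun _ t => by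
      by_cases ht : t ≤ T <;> simp [ind, ht]
    rw [wp_add, h₁] at h₃
    by_contra hne
    exact absurd h₃ (not_le.2 (ENNReal.lt_add_right ENNReal.one_ne_top hne))
  have h₄ : wp O F c s φ = wp O F c s (fun s t => ind (t ≤ T) * φ s t + ind (¬t ≤ T) * φ s t) := by
    congr 1; ext s t
    by_cases ht : t ≤ T <;> simp [ind, ht]
  have h₅ : wp O F c s (fun s t => ind (¬t ≤ T) * φ s t) = 0 := by
    refine le_antisymm ?_ zero_le
    rw [← h₂]
    exact wp_mono fun s t => mul_le_of_le_one_right' (hφ s t)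
  rw [h₄, wp_add, h₅, add_zero]

/-- Once runs are cut off at time `T`, fuel beyond `T` changes nothing, and the supremum is attained
at every `F ≥ T`. -/
theorem iSup_wp_of_halts (h : wp O F₀ c s (fun _ t => ind (t ≤ T)) = 1) (hφ : ∀ s t, φ s t ≤ 1)
    {F : ℕ} (hF : T ≤ F) :
    ⨆ F, wp O F c s φ = wp O F c s (fun s t => ind (t ≤ T) * φ s t) := by
  refine le_antisymm (iSup_le fun G => ?_) ?_
  · refine (wp_fuel_le (F' := max F G) (.inl (le_max_right _ _))).trans ?_
    rw [wp_eq_of_halts h hφ (hF.trans (le_max_left _ _))]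
    refine wp_fuel_le (.inr fun s t ht => ?_)
    rw [ind_false (by omega), zero_mul]
  · rw [← wp_eq_of_halts h hφ hF]
    exact le_iSup (fun F => wp O F c s φ) F

theorem outProb_of_halts {l v : List ℕ} (h : wp O F₀ c (load l) (fun _ t => ind (t ≤ T)) = 1)
    {F : ℕ} (hF : T ≤ F) :
    outProb c O l v =
      wp O F c (load l) fun s t => ind (t ≤ T ∧ (List.range v.length).map s = v) := by
  rw [outProb_eq, iSup_wp_of_halts h (fun _ _ => ind_le_one _) hF]
  congr 1; ext s t
  by_cases h1 : t ≤ T <;> simp [ind, h1]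

theorem le_outProb {l v : List ℕ} {F : ℕ} (hφ : ∀ s t, φ s t ≤ ind ((List.range v.length).map s = v)) :
    wp O F c (load l) φ ≤ outProb c O l v := by
  rw [outProb_eq]
  exact (wp_mono hφ).trans (le_iSup (fun F => wp O F c (load l) fun s _ =>
    ind ((List.range v.length).map s = v)) F)

theorem outProb_le_one {l v : List ℕ} : outProb c O l v ≤ 1 := by
  rw [outProb_eq]
  exact iSup_le fun F => wp_le_one fun _ _ => ind_le_one _

end Halting

/-! ## Deterministic runs -/

/-- Started in `s`, the program halts in `s'` after at most `T` steps, without using randomness or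
the oracle. -/
def Runs (c : Prog) (s s' : Store) (T : ℕ) : Prop :=
  ∃ t ≤ T, ∀ O F, t ≤ F → ∀ φ, wp O F c s φ = φ s' t

section Runs

variable {c c₁ c₂ : Prog} {s s' s'' : Store} {T T₁ T₂ : ℕ} {e : Expr}

theorem Runs.mono (h : Runs c s s' T₁) (hT : T₁ ≤ T₂) : Runs c s s' T₂ := by
  obtain ⟨t, ht, h⟩ := h
  exact ⟨t, ht.trans hT, h⟩

theorem Runs.seq (h₁ : Runs c₁ s s' T₁) (h₂ : Runs c₂ s' s'' T₂) :
    Runs (.seq c₁ c₂) s s'' (T₁ + T₂) := by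
  obtain ⟨t₁, ht₁, h₁⟩ := h₁
  obtain ⟨t₂, ht₂, h₂⟩ := h₂
  refine ⟨t₁ + t₂, by omega, fun O F hF φ => ?_⟩
  rw [wp_seq, h₁ O F (by omega), h₂ O F (by omega)]

theorem Runs.assign (i : ℕ) (e : Expr) (s : Store) :
    Runs (.assign i e) s (Function.update s i (e.eval s)) (e.cost s + 1) :=
  ⟨_, le_rfl, fun _ _ _ _ => wp_assign _ _ _ _ _ _⟩

theorem Runs.cond (h : Runs (if e.eval s = 0 then c₂ else c₁) s s' T) :
    Runs (.cond e c₁ c₂) s s' (e.cost s + 1 + T) := by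
  obtain ⟨t, ht, h⟩ := h
  refine ⟨e.cost s + 1 + t, by omega, fun O F hF φ => ?_⟩
  rw [wp_cond, h O F (by omega)]

/-- While loops: `I k` is an invariant that ensures at most `k` further iterations. -/
theorem Runs.loop (I : ℕ → Store → Prop) (a D : ℕ)
    (hcost : ∀ k s, I k s → e.cost s ≤ a)
    (hzero : ∀ s, I 0 s → e.eval s = 0)
    (hsucc : ∀ k s, I (k + 1) s → e.eval s ≠ 0 → ∃ s', I k s' ∧ Runs c s s' D)
    (k : ℕ) (s : Store) (h : I k s) :
    ∃ s', (∃ k', I k' s') ∧ e.eval s' = 0 ∧ Runs (.loop e c) s s' ((k + 1) * (a + 1 + D)) := by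
  -- As in `wp_fuel_le`, the number `f` of remaining tests is kept apart from the fuel `F` of the
  -- body.
  have key : ∀ k s, I k s → ∃ s', (∃ k', I k' s') ∧ e.eval s' = 0 ∧
      ∃ t ≤ (k + 1) * (a + 1 + D), ∀ O F, t ≤ F → ∀ f, t ≤ f → ∀ φ,
        wpIter O F e c f s φ = φ s' t := by
    intro k
    induction k with
    | zero =>
      intro s h
      refine ⟨s, ⟨0, h⟩, hzero s h, e.cost s + 1, ?_, fun O F hF f hf φ => ?_⟩
      · have := hcost _ _ h; omega
      · obtain ⟨f, rfl⟩ : ∃ f', f = f' + 1 := ⟨f - 1, by omega⟩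
        rw [wpIter_succ, if_pos (hzero s h)]
    | succ k ih =>
      intro s h
      by_cases he : e.eval s = 0
      · refine ⟨s, ⟨_, h⟩, he, e.cost s + 1, ?_, fun O F hF f hf φ => ?_⟩
        · have := hcost _ _ h
          nlinarith
        · obtain ⟨f, rfl⟩ : ∃ f', f = f' + 1 := ⟨f - 1, by omega⟩
          rw [wpIter_succ, if_pos he]
      · obtain ⟨s₁, h₁, t₁, ht₁, hr⟩ := hsucc k s h he
        obtain ⟨s', hk', he', t, ht, hr'⟩ := ih s₁ h₁
        refine ⟨s', hk', he', e.cost s + 1 + (t₁ + t), ?_, fun O F hF f hf φ => ?_⟩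
        · have := hcost _ _ h
          nlinarith
        · obtain ⟨f, rfl⟩ : ∃ f', f = f' + 1 := ⟨f - 1, by omega⟩
          rw [wpIter_succ, if_neg he, hr O F (by omega), hr' O F (by omega) f (by omega)]
  obtain ⟨s', h₁, h₂, t, ht, h₃⟩ := key k s h
  exact ⟨s', h₁, h₂, t, ht, fun O F hF φ => by rw [wp_loop, h₃ O F hF F hF]⟩

end Runs

/-! ## Straight-line code on the working registers -/

/-- The registers below `workRegs` are the working registers of the programs below. -/
abbrev workRegs : ℕ := 25

/-- All working registers hold numbers of at most `b` bits. -/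
def Bd (b : ℕ) (s : Store) : Prop := ∀ i < workRegs, (s i).size ≤ b

/-- The expression reads working registers only. -/
def Expr.Work : Expr → Prop
  | .reg i => i < workRegs
  | .const _ => True
  | .bin _ e₁ e₂ => e₁.Work ∧ e₂.Work

/-- Loop-free, deterministic code on the working registers. -/
def Prog.Straight : Prog → Prop
  | .skip => True
  | .assign i e => i < workRegs ∧ e.Work
  | .seq c₁ c₂ => c₁.Straight ∧ c₂.Straight
  | .cond e c₁ c₂ => e.Work ∧ c₁.Straight ∧ c₂.Straight
  | _ => False

/-- The effect of loop-free, deterministic code. -/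
def Prog.run : Prog → Store → Store
  | .assign i e, s => Function.update s i (e.eval s)
  | .seq c₁ c₂, s => c₂.run (c₁.run s)
  | .cond e c₁ c₂, s => if e.eval s = 0 then c₂.run s else c₁.run s
  | _, s => s

theorem size_add_le (a b : ℕ) : (a + b).size ≤ a.size + b.size + 1 := by
  rw [Nat.size_le]
  have ha := Nat.lt_size_self a
  have hb := Nat.lt_size_self b
  have h1 : 2 ^ a.size ≤ 2 ^ (a.size + b.size) := Nat.pow_le_pow_right (by omega) (by omega)
  have h2 : 2 ^ b.size ≤ 2 ^ (a.size + b.size) := Nat.pow_le_pow_right (by omega) (by omega)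
  rw [pow_succ]; omega

theorem size_mul_le (a b : ℕ) : (a * b).size ≤ a.size + b.size := by
  rw [Nat.size_le, pow_add]
  exact Nat.mul_lt_mul'' (Nat.lt_size_self a) (Nat.lt_size_self b)

theorem Op.size_eval_le (o : Op) (a b : ℕ) : (o.eval a b).size ≤ a.size + b.size + 1 := by
  have h1 : (1 : ℕ).size = 1 := Nat.size_one
  cases o <;> simp only [Op.eval]
  · exact size_add_le a b
  · exact (Nat.size_le_size (Nat.sub_le a b)).trans (by omega)
  · exact (size_mul_le a b).trans (by omega)
  · exact (Nat.size_le_size (Nat.div_le_self a b)).trans (by omega)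
  · exact (Nat.size_le_size (Nat.mod_le a b)).trans (by omega)
  · split_ifs <;> simp
  · split_ifs <;> simp

theorem Expr.cost_le (e : Expr) (he : e.Work) :
    ∃ K, ∀ b s, Bd b s → e.cost s ≤ K * (b + 1) := by
  induction e with
  | reg i => exact ⟨1, fun b s h => by simpa [Expr.cost] using h i he⟩
  | const a => exact ⟨a.size + 1, fun b s h => by simp only [Expr.cost]; nlinarith⟩
  | bin o e₁ e₂ ih₁ ih₂ =>
    obtain ⟨K₁, h₁⟩ := ih₁ he.1
    obtain ⟨K₂, h₂⟩ := ih₂ he.2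
    refine ⟨2 * K₁ + 2 * K₂ + 2, fun b s h => ?_⟩
    have := o.size_eval_le (e₁.eval s) (e₂.eval s)
    have := e₁.size_eval_le s
    have := e₂.size_eval_le s
    have := h₁ b s h
    have := h₂ b s h
    simp only [Expr.cost]
    nlinarith

theorem Bd.update {b i v : ℕ} {s : Store} (h : Bd b s) (hv : v.size ≤ b) :
    Bd b (Function.update s i v) := by
  intro j hj
  by_cases hij : j = i
  · subst hij; simpa using hv
  · simpa [hij] using h j hj

theorem Bd.mono {b b' : ℕ} {s : Store} (h : Bd b s) (hb : b ≤ b') : Bd b' s :=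
  fun i hi => (h i hi).trans hb

/-- Each of the fixed number of operations increases bit lengths at most linearly. The bound on the
final registers grows by the factor `K` and serves the induction over sequences; the loops below
re-establish the original bound `b` by their invariants, so that factors do not accumulate. -/
theorem Prog.Straight.runs {c : Prog} (hc : c.Straight) :
    ∃ K, ∀ b s, Bd b s → Runs c s (c.run s) (K * (b + 1)) ∧ Bd (K * (b + 1)) (c.run s) := by
  induction c with
  | skip =>
    refine ⟨1, fun b s h => ⟨⟨1, by omega, fun _ _ _ _ => wp_skip _ _ _ _⟩, h.mono (by omega)⟩⟩
  | assign i e =>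
    obtain ⟨K, hK⟩ := e.cost_le hc.2
    refine ⟨K + 1, fun b s h => ⟨(Runs.assign i e s).mono ?_, ?_⟩⟩
    · have := hK b s h; nlinarith
    · refine (h.mono (by nlinarith)).update ?_
      have := hK b s h
      have := e.size_eval_le s
      nlinarith
  | seq c₁ c₂ ih₁ ih₂ =>
    obtain ⟨K₁, h₁⟩ := ih₁ hc.1
    obtain ⟨K₂, h₂⟩ := ih₂ hc.2
    refine ⟨K₁ + K₂ * (K₁ + 1), fun b s h => ?_⟩
    obtain ⟨r₁, b₁⟩ := h₁ b s h
    obtain ⟨r₂, b₂⟩ := h₂ _ _ b₁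
    have hle : K₂ * (K₁ * (b + 1) + 1) ≤ K₂ * (K₁ + 1) * (b + 1) := by
      rw [mul_assoc]; gcongr; nlinarith
    refine ⟨(r₁.seq r₂).mono ?_, b₂.mono ?_⟩
    · rw [add_mul]; omega
    · rw [add_mul]; omega
  | cond e c₁ c₂ ih₁ ih₂ =>
    obtain ⟨K, hK⟩ := e.cost_le hc.1
    obtain ⟨K₁, h₁⟩ := ih₁ hc.2.1
    obtain ⟨K₂, h₂⟩ := ih₂ hc.2.2
    refine ⟨K + 1 + K₁ + K₂, fun b s h => ?_⟩
    have := hK b s h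
    simp only [Prog.run]
    by_cases he : e.eval s = 0
    · rw [if_pos he]
      obtain ⟨r, hb⟩ := h₂ b s h
      exact ⟨(Runs.cond (by rwa [if_pos he])).mono (by nlinarith), hb.mono (by nlinarith)⟩
    · rw [if_neg he]
      obtain ⟨r, hb⟩ := h₁ b s h
      exact ⟨(Runs.cond (by rwa [if_neg he])).mono (by nlinarith), hb.mono (by nlinarith)⟩
  | rand | query | loop => exact hc.elim

/-! ## Subroutines -/

/-- The invariant itself has to contain the bound `b` on the registers. Then every round costs a
constant times `b + 1`, with a constant that depends on the code alone. -/
theorem Expr.Work.loop {e : Expr} {c : Prog} (he : e.Work) (hc : c.Straight) :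
    ∃ K, ∀ (b : ℕ) (I : ℕ → Store → Prop), (∀ k s, I k s → Bd b s) →
      (∀ s, I 0 s → e.eval s = 0) →
      (∀ k s, I (k + 1) s → e.eval s ≠ 0 → I k (c.run s)) →
      ∀ k s, I k s → ∃ s', (∃ k', I k' s') ∧ e.eval s' = 0 ∧
        Runs (.loop e c) s s' ((k + 1) * (K * (b + 1))) := by
  obtain ⟨K₁, h₁⟩ := e.cost_le he
  obtain ⟨K₂, h₂⟩ := hc.runs
  refine ⟨K₁ + 1 + K₂, fun b I hI h0 hs k s h => ?_⟩
  obtain ⟨s', h3, h4, h5⟩ := Runs.loop (c := c) I (K₁ * (b + 1)) (K₂ * (b + 1))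
    (fun k s h => h₁ b s (hI k s h)) h0
    (fun k s h he => ⟨_, hs k s h he, (h₂ b s (hI _ s h)).1⟩) k s h
  refine ⟨s', h3, h4, h5.mono ?_⟩
  gcongr
  nlinarith

/-- Only the registers in `l` differ. -/
def Frame (l : List ℕ) (s s' : Store) : Prop := ∀ i, i ∉ l → s' i = s i

theorem Frame.refl (l : List ℕ) (s : Store) : Frame l s s := fun _ _ => rfl

theorem Frame.trans {l : List ℕ} {s s' s'' : Store} (h : Frame l s s') (h' : Frame l s' s'') :
    Frame l s s'' := fun i hi => (h' i hi).trans (h i hi)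

theorem Frame.update {l : List ℕ} {s s' : Store} (h : Frame l s s') {i : ℕ} (hi : i ∈ l) (v : ℕ) :
    Frame l s (Function.update s' i v) := fun j hj => by
  rw [Function.update_of_ne (fun hji => hj (by rwa [hji])), h j hj]

theorem size_le_of_le {m n b : ℕ} (h : m ≤ n) (hn : n.size ≤ b) : m.size ≤ b :=
  (Nat.size_le_size h).trans hn

theorem size_le_of_self_le {m b : ℕ} (h : m ≤ b) : m.size ≤ b :=
  Nat.size_le.2 (h.trans_lt Nat.lt_two_pow_self)

/-- Bit length is the variant of the loops that halve a register. -/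
theorem size_half {m : ℕ} (h : m ≠ 0) : m.size = (m / 2).size + 1 := by
  have h1 : Nat.bit (decide (m % 2 = 1)) (m / 2) = m := by
    simpa [Nat.shiftRight_one] using Nat.bit_decide_mod_two_eq_one_shiftRight_one m
  conv_lhs => rw [← h1]
  rw [Nat.size_bit (by rwa [h1])]

/-- One round of square and multiply. -/
def powBody : Prog :=
  .seq (.cond (.bin .mod (.reg 20) (.const 2))
      (.assign 18 (.bin .mod (.bin .mul (.reg 18) (.reg 19)) (.reg 0))) .skip)
    (.seq (.assign 19 (.bin .mod (.bin .mul (.reg 19) (.reg 19)) (.reg 0)))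
      (.assign 20 (.bin .div (.reg 20) (.const 2))))

/-- Square and multiply: register 18 is multiplied by register 19 to the power of register 20,
modulo register 0. -/
def powLoop : Prog := .loop (.reg 20) powBody

theorem pow_step_odd (a b e p : ℕ) (h : e % 2 ≠ 0) :
    (a * b % p) * (b * b % p) ^ (e / 2) ≡ a * b ^ e [MOD p] := by
  have he : e = 2 * (e / 2) + 1 := by omega
  calc (a * b % p) * (b * b % p) ^ (e / 2) ≡ (a * b) * (b * b) ^ (e / 2) [MOD p] :=
        (Nat.mod_modEq _ _).mul ((Nat.mod_modEq _ _).pow _)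
    _ = a * b ^ (2 * (e / 2) + 1) := by rw [pow_succ, pow_mul, sq]; ring
    _ = a * b ^ e := by rw [← he]

theorem pow_step_even (a b e p : ℕ) (h : e % 2 = 0) :
    a * (b * b % p) ^ (e / 2) ≡ a * b ^ e [MOD p] := by
  have he : e = 2 * (e / 2) := by omega
  calc a * (b * b % p) ^ (e / 2) ≡ a * (b * b) ^ (e / 2) [MOD p] :=
        ((Nat.mod_modEq _ _).pow _).mul_left _
    _ = a * b ^ (2 * (e / 2)) := by rw [pow_mul, sq]
    _ = a * b ^ e := by rw [← he]

theorem powLoop_runs : ∃ K, ∀ b s, Bd b s → s 18 < s 0 → s 19 < s 0 →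
    ∃ s', Runs powLoop s s' (K * (b + 1) ^ 2) ∧ s' 18 = s 18 * s 19 ^ s 20 % s 0 ∧ Bd b s' ∧
      Frame [18, 19, 20] s s' := by
  obtain ⟨K, hK⟩ := Expr.Work.loop (e := .reg 20) (c := powBody)
    (by simp [Expr.Work, workRegs]) (by simp [powBody, Prog.Straight, Expr.Work, workRegs])
  refine ⟨K, fun b s hb h18 h19 => ?_⟩
  -- The product of the accumulator with the current base to the remaining exponent is invariant
  -- modulo register 0; the bit length of the exponent bounds the number of rounds.
  let I : ℕ → Store → Prop := fun k t => Bd b t ∧ Frame [18, 19, 20] s t ∧ t 18 < s 0 ∧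
    t 19 < s 0 ∧ t 18 * t 19 ^ t 20 % s 0 = s 18 * s 19 ^ s 20 % s 0 ∧ (t 20).size ≤ k
  have hp : (s 0).size ≤ b := hb 0 (by norm_num)
  obtain ⟨s', ⟨k', hI⟩, h0, hr⟩ := hK b I (fun k t h => h.1)
    (fun t h => by simpa [Expr.eval, Nat.size_eq_zero] using h.2.2.2.2.2)
    (fun k t hI he => by
      obtain ⟨h1, h2, h3, h4, h5, h6⟩ := hI
      simp only [Expr.eval] at he
      have ht0 : t 0 = s 0 := h2 0 (by simp)
      have hpos : 0 < s 0 := by omega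
      have h20 : (t 20 / 2).size ≤ k := by have := size_half he; omega
      have h20b : (t 20 / 2).size ≤ b := size_le_of_le (Nat.div_le_self _ _) (h1 20 (by norm_num))
      have hm : ∀ x, x % s 0 < s 0 := fun x => Nat.mod_lt _ hpos
      have hmb : ∀ x, (x % s 0).size ≤ b := fun x => size_le_of_le (hm x).le hp
      by_cases hodd : t 20 % 2 = 0
      · have hrun : powBody.run t = Function.update (Function.update t 19 (t 19 * t 19 % s 0)) 20
            (t 20 / 2) := by
          simp [powBody, Prog.run, Expr.eval, Op.eval, hodd, ht0]
        rw [hrun]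
        refine ⟨(h1.update (hmb _)).update h20b, (h2.update (by simp) _).update (by simp) _, ?_⟩
        have h5' : _ % _ = _ % _ := pow_step_even (t 18) (t 19) (t 20) (s 0) hodd
        simp [hm, h3, h20, ← h5, h5']
      · have hrun : powBody.run t = Function.update (Function.update (Function.update t 18
            (t 18 * t 19 % s 0)) 19 (t 19 * t 19 % s 0)) 20 (t 20 / 2) := by
          simp [powBody, Prog.run, Expr.eval, Op.eval, hodd, ht0]
        rw [hrun]
        refine ⟨((h1.update (hmb _)).update (hmb _)).update h20b,
          ((h2.update (by simp) _).update (by simp) _).update (by simp) _, ?_⟩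
        have h5' : _ % _ = _ % _ := pow_step_odd (t 18) (t 19) (t 20) (s 0) hodd
        simp [hm, h20, ← h5, h5'])
    b s ⟨hb, .refl _ _, h18, h19, rfl, hb 20 (by norm_num)⟩
  obtain ⟨h1, h2, h3, h4, h5, -⟩ := hI
  simp only [Expr.eval] at h0
  refine ⟨s', hr.mono (by nlinarith), ?_, h1, h2⟩
  rw [h0, pow_zero, mul_one] at h5
  rw [← h5, Nat.mod_eq_of_lt h3]

/-- `f_p` on representatives. -/
def foldN (p q z : ℕ) : ℕ := if q < z then (p - z) % q else z % q

/-- One level of the tree on representatives; the bit is the parity of `x`. -/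
def stepN (p q g h x y : ℕ) : ℕ := foldN p q ((if x % 2 = 0 then g else h) ^ y % p)

/-- Several levels of the tree on representatives; the bits are the lowest binary digits of `x`. -/
def stepsN (p q g h : ℕ) : ℕ → ℕ → ℕ → ℕ
  | 0, _, y => y
  | k + 1, x, y => stepsN p q g h k (x / 2) (stepN p q g h x y)

theorem foldN_lt {p q z : ℕ} (hq : 0 < q) : foldN p q z < q := by
  unfold foldN; split_ifs <;> exact Nat.mod_lt _ hq

theorem stepsN_lt {p q g h : ℕ} (hq : 0 < q) (k : ℕ) :
    ∀ {x y : ℕ}, y < q → stepsN p q g h k x y < q := by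
  induction k with
  | zero => intro x y hy; exact hy
  | succ k ih => intro x y _; exact ih (foldN_lt hq)

/-- Register 21 becomes `f_p` of register 18. -/
def foldProg : Prog :=
  .cond (.bin .lt (.reg 5) (.reg 18))
    (.assign 21 (.bin .mod (.bin .sub (.reg 0) (.reg 18)) (.reg 5)))
    (.assign 21 (.bin .mod (.reg 18) (.reg 5)))

theorem foldProg_straight : foldProg.Straight := by
  simp [foldProg, Prog.Straight, Expr.Work, workRegs]

theorem foldProg_run (s : Store) :
    foldProg.run s = Function.update s 21 (foldN (s 0) (s 5) (s 18)) := by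
  by_cases h : s 5 < s 18 <;> simp [foldProg, Prog.run, Expr.eval, Op.eval, foldN, h]

/-- Prepare the exponentiation for one level of the tree. -/
def stepInit : Prog :=
  .seq (.assign 18 (.const 1))
    (.seq (.cond (.bin .mod (.reg 22) (.const 2)) (.assign 19 (.reg 2)) (.assign 19 (.reg 1)))
      (.assign 20 (.reg 21)))

theorem stepInit_straight : stepInit.Straight := by
  simp [stepInit, Prog.Straight, Expr.Work, workRegs]

theorem stepInit_run (s : Store) :
    stepInit.run s = Function.update (Function.update (Function.update s 18 1) 19
      (if s 22 % 2 = 0 then s 1 else s 2)) 20 (s 21) := by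
  by_cases h : s 22 % 2 = 0 <;> simp [stepInit, Prog.run, Expr.eval, Op.eval, h]

/-- Complete one level of the tree. -/
def stepFinish : Prog :=
  .seq foldProg (.seq (.assign 22 (.bin .div (.reg 22) (.const 2)))
    (.assign 23 (.bin .sub (.reg 23) (.const 1))))

theorem stepFinish_straight : stepFinish.Straight := by
  simp [stepFinish, Prog.Straight, Expr.Work, workRegs, foldProg_straight]

theorem stepFinish_run (s : Store) :
    stepFinish.run s = Function.update (Function.update (Function.update s 21
      (foldN (s 0) (s 5) (s 18))) 22 (s 22 / 2)) 23 (s 23 - 1) := by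
  simp [stepFinish, Prog.run, Expr.eval, Op.eval, foldProg_run]

/-- Register 23 is the number of levels, register 22 contains the bits, register 21 the value. -/
def stepLoop : Prog := .loop (.reg 23) (.seq stepInit (.seq powLoop stepFinish))

theorem stepLoop_runs : ∃ K, ∀ b s, Bd b s → 1 < s 0 → s 1 < s 0 → s 2 < s 0 → 0 < s 5 →
    ∃ s', Runs stepLoop s s' ((s 23 + 1) * (K * (b + 1) ^ 2)) ∧
      s' 21 = stepsN (s 0) (s 5) (s 1) (s 2) (s 23) (s 22) (s 21) ∧ Bd b s' ∧
      Frame [18, 19, 20, 21, 22, 23] s s' := by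
  obtain ⟨K₁, h₁⟩ := stepInit_straight.runs
  obtain ⟨K₂, h₂⟩ := powLoop_runs
  obtain ⟨K₃, h₃⟩ := stepFinish_straight.runs
  refine ⟨2 + K₁ + K₂ + K₃, fun b s hb hp hg hh hq => ?_⟩
  -- Applying the remaining levels to the current value always gives the final value.
  let I : ℕ → Store → Prop := fun k t => Bd b t ∧ Frame [18, 19, 20, 21, 22, 23] s t ∧
    stepsN (s 0) (s 5) (s 1) (s 2) (t 23) (t 22) (t 21) =
      stepsN (s 0) (s 5) (s 1) (s 2) (s 23) (s 22) (s 21) ∧ t 23 = k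
  have hb1 : 1 ≤ b := (Nat.size_pos.2 (by omega : 0 < s 0)).trans_le (hb 0 (by norm_num))
  obtain ⟨s', ⟨k', hI⟩, h0, hr⟩ := Runs.loop (e := .reg 23)
    (c := .seq stepInit (.seq powLoop stepFinish)) I (b + 1)
    (K₁ * (b + 1) + (K₂ * (b + 1) ^ 2 + K₃ * (b + 1)))
    (fun k t h => by simpa [Expr.cost] using h.1 23 (by norm_num))
    (fun t h => by simpa [Expr.eval] using h.2.2.2)
    (fun k t ⟨i1, i2, i3, i4⟩ he => by
      obtain ⟨r₁, -⟩ := h₁ b t i1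
      have e0 : t 0 = s 0 := i2 0 (by simp)
      have e1 : t 1 = s 1 := i2 1 (by simp)
      have e2 : t 2 = s 2 := i2 2 (by simp)
      have e5 : t 5 = s 5 := i2 5 (by simp)
      rw [stepInit_run, e1, e2] at r₁
      set t₁ := Function.update (Function.update (Function.update t 18 1) 19
        (if t 22 % 2 = 0 then s 1 else s 2)) 20 (t 21) with ht₁
      have hbt₁ : Bd b t₁ := by
        refine ((i1.update (by simpa using hb1)).update ?_).update (i1 21 (by norm_num))
        split_ifs
        · exact hb 1 (by norm_num)
        · exact hb 2 (by norm_num)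
      have f₁ : Frame [18, 19, 20, 21, 22, 23] s t₁ :=
        ((i2.update (by simp) _).update (by simp) _).update (by simp) _
      have e0' : t₁ 0 = s 0 := f₁ 0 (by simp)
      obtain ⟨t₂, r₂, v₂, hbt₂, f₂⟩ := h₂ b t₁ hbt₁
        (by rw [e0']; simpa [ht₁, Function.update_apply] using hp)
        (by rw [e0']; simp only [ht₁, Function.update_apply]; simp; split_ifs <;> assumption)
      obtain ⟨r₃, -⟩ := h₃ b t₂ hbt₂
      have g0 : t₂ 0 = s 0 := (f₂ 0 (by simp)).trans e0'
      have g5 : t₂ 5 = s 5 := (f₂ 5 (by simp)).trans (f₁ 5 (by simp))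
      have g22 : t₂ 22 = t 22 := (f₂ 22 (by simp)).trans (by simp [ht₁])
      have g23 : t₂ 23 = t 23 := (f₂ 23 (by simp)).trans (by simp [ht₁])
      have g18 : t₂ 18 = (if t 22 % 2 = 0 then s 1 else s 2) ^ t 21 % s 0 := by
        rw [v₂, e0']; simp [ht₁]
      refine ⟨_, ⟨?_, ?_, ?_, ?_⟩, r₁.seq (r₂.seq r₃)⟩
      · rw [stepFinish_run]
        refine ((hbt₂.update ?_).update ?_).update ?_
        · refine size_le_of_le (foldN_lt ?_).le (hbt₂ 5 (by norm_num))
          rwa [g5]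
        · exact size_le_of_le (Nat.div_le_self _ _) (hbt₂ 22 (by norm_num))
        · exact size_le_of_le (Nat.sub_le _ _) (hbt₂ 23 (by norm_num))
      · rw [stepFinish_run]
        have f₂' : Frame [18, 19, 20, 21, 22, 23] t₁ t₂ := fun i hi =>
          f₂ i (by simp at hi ⊢; omega)
        exact (((f₁.trans f₂').update (by simp) _).update (by simp) _).update (by simp) _
      · rw [← i3, i4, stepFinish_run, stepsN]
        simp [g0, g5, g22, g23, g18, i4, stepN]
      · rw [stepFinish_run]
        simp [g23, i4])
    (s 23) s ⟨hb, .refl _ _, rfl, rfl⟩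
  obtain ⟨i1, i2, i3, -⟩ := hI
  simp only [Expr.eval] at h0
  rw [h0, stepsN] at i3
  refine ⟨s', hr.mono ?_, i3, i1, i2⟩
  gcongr
  have : b + 1 ≤ (b + 1) ^ 2 := Nat.le_self_pow (by norm_num) _
  calc _ ≤ 2 * (b + 1) ^ 2 + (K₁ * (b + 1) ^ 2 + (K₂ * (b + 1) ^ 2 + K₃ * (b + 1) ^ 2)) := by
        gcongr; omega
    _ = _ := by ring

/-- Register 6 becomes the bit length `n` of register 15, and register 7 becomes `2 ^ n`. -/
def sizeLoop : Prog :=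
  .loop (.reg 15) (.seq (.assign 15 (.bin .div (.reg 15) (.const 2)))
    (.seq (.assign 6 (.bin .add (.reg 6) (.const 1)))
      (.assign 7 (.bin .mul (.const 2) (.reg 7)))))

/-- The spare bit in the hypothesis is needed because `2 ^ n` has `n + 1` bits. -/
theorem sizeLoop_runs : ∃ K, ∀ b s, Bd b s → (s 15).size + 1 ≤ b → s 6 = 0 → s 7 = 1 →
    ∃ s', Runs sizeLoop s s' (K * (b + 1) ^ 2) ∧ s' 6 = (s 15).size ∧ s' 7 = 2 ^ (s 15).size ∧
      Bd b s' ∧ Frame [15, 6, 7] s s' := by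
  obtain ⟨K, hK⟩ := Expr.Work.loop (e := .reg 15)
    (c := .seq (.assign 15 (.bin .div (.reg 15) (.const 2)))
      (.seq (.assign 6 (.bin .add (.reg 6) (.const 1)))
        (.assign 7 (.bin .mul (.const 2) (.reg 7)))))
    (by simp [Expr.Work, workRegs]) (by simp [Prog.Straight, Expr.Work, workRegs])
  refine ⟨K, fun b s hb hsz h6 h7 => ?_⟩
  let I : ℕ → Store → Prop := fun k t => Bd b t ∧ Frame [15, 6, 7] s t ∧
    t 6 + (t 15).size = (s 15).size ∧ t 7 = 2 ^ t 6 ∧ (t 15).size ≤ k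
  obtain ⟨s', ⟨k', hI⟩, h0, hr⟩ := hK b I (fun k t h => h.1)
    (fun t h => by simpa [Expr.eval, Nat.size_eq_zero] using h.2.2.2.2)
    (fun k t ⟨h1, h2, h3, h4, h5⟩ he => by
      simp only [Expr.eval] at he
      have hs := size_half he
      simp only [Prog.run, Expr.eval, Op.eval, I]
      refine ⟨((h1.update ?_).update ?_).update ?_, ((h2.update (by simp) _).update (by simp) _).update
        (by simp) _, ?_, ?_, ?_⟩
      · exact size_le_of_le (Nat.div_le_self _ _) (h1 15 (by norm_num))
      · simp only [Function.update_apply]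
        exact size_le_of_self_le (by simp; omega)
      · have : 2 * t 7 = 2 ^ (t 6 + 1) := by rw [h4, pow_succ]; ring
        simp only [Function.update_apply]
        simp [this, Nat.size_pow]; omega
      · simp; omega
      · simp [h4, pow_succ, mul_comm]
      · simp; omega)
    b s ⟨hb, .refl _ _, by omega, by simp [h6, h7], by omega⟩
  obtain ⟨h1, h2, h3, h4, -⟩ := hI
  simp only [Expr.eval] at h0
  have h6' : s' 6 = (s 15).size := by rw [← h3, h0]; simp
  exact ⟨s', hr.mono (by nlinarith), h6', by rw [h4, h6'], h1, h2⟩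

/-- Register 9 is multiplied by two to the power of register 15. -/
def powTwoLoop : Prog :=
  .loop (.reg 15) (.seq (.assign 15 (.bin .sub (.reg 15) (.const 1)))
    (.assign 9 (.bin .mul (.const 2) (.reg 9))))

/-- Here the content of register 15, and not only its bit length, must be below `b`: it is both the
number of rounds and the bit length of the result, less one. -/
theorem powTwoLoop_runs : ∃ K, ∀ b s, Bd b s → s 15 + 1 ≤ b → s 9 = 1 →
    ∃ s', Runs powTwoLoop s s' (K * (b + 1) ^ 2) ∧ s' 9 = 2 ^ s 15 ∧
      Bd b s' ∧ Frame [15, 9] s s' := by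
  obtain ⟨K, hK⟩ := Expr.Work.loop (e := .reg 15)
    (c := .seq (.assign 15 (.bin .sub (.reg 15) (.const 1)))
      (.assign 9 (.bin .mul (.const 2) (.reg 9))))
    (by simp [Expr.Work, workRegs]) (by simp [Prog.Straight, Expr.Work, workRegs])
  refine ⟨K, fun b s hb hsz h9 => ?_⟩
  let I : ℕ → Store → Prop := fun k t => Bd b t ∧ Frame [15, 9] s t ∧
    t 9 * 2 ^ t 15 = 2 ^ s 15 ∧ t 15 ≤ k
  obtain ⟨s', ⟨k', hI⟩, h0, hr⟩ := hK b I (fun k t h => h.1)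
    (fun t h => by simpa [Expr.eval] using h.2.2.2)
    (fun k t ⟨h1, h2, h3, h4⟩ he => by
      simp only [Expr.eval] at he
      have hx : 2 * t 9 * 2 ^ (t 15 - 1) = 2 ^ s 15 := by
        rw [← h3]
        obtain ⟨m, hm⟩ : ∃ m, t 15 = m + 1 := ⟨t 15 - 1, by omega⟩
        rw [hm, pow_succ, Nat.add_sub_cancel]; ring
      simp only [Prog.run, Expr.eval, Op.eval, I]
      refine ⟨(h1.update ?_).update ?_, (h2.update (by simp) _).update (by simp) _, ?_, ?_⟩
      · exact size_le_of_le (Nat.sub_le _ _) (h1 15 (by norm_num))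
      · have : 2 * t 9 ≤ 2 ^ s 15 := by
          rw [← hx]; exact Nat.le_mul_of_pos_right _ (by positivity)
        simp only [Function.update_apply]
        exact size_le_of_le (by simpa using this) (by rw [Nat.size_pow]; omega)
      · simpa using hx
      · simp; omega)
    b s ⟨hb, .refl _ _, by simp [h9], by omega⟩
  obtain ⟨h1, h2, h3, -⟩ := hI
  simp only [Expr.eval] at h0
  exact ⟨s', hr.mono (by nlinarith), by simpa [h0] using h3, h1, h2⟩

/-! ### Tables encoded as numbers, and searching them. -/

/-- A table with entries below `J`, with values below `M`, as a number. -/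
def encodeTable (J M : ℕ) : List (ℕ × ℕ) → ℕ
  | [] => 0
  | (z, r) :: l => 1 + z + J * r + (J * M + 1) * encodeTable J M l

def ValidTable (J M : ℕ) (l : List (ℕ × ℕ)) : Prop := ∀ x ∈ l, x.1 < J ∧ x.2 < M

/-- Search the table in register 15 for register 14. -/
def lookupLoop : Prog :=
  .loop (.bin .mul (.reg 15) (.bin .eq (.reg 17) (.reg 12)))
    (.seq (.assign 16 (.bin .sub (.bin .mod (.reg 15) (.reg 11)) (.const 1)))
      (.seq (.assign 15 (.bin .div (.reg 15) (.reg 11)))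
        (.cond (.bin .eq (.bin .mod (.reg 16) (.reg 9)) (.reg 14))
          (.assign 17 (.bin .div (.reg 16) (.reg 9))) .skip)))

/-- An entry is a digit between `1` and `J * M` in base `J * M + 1`. As the digit `0` does not
occur, the number `0` encodes the empty table only. The value `M`, which no entry can have, signals
that nothing has been found yet. -/
theorem lookupLoop_runs : ∃ K, ∀ b s J M l, Bd b s → ValidTable J M l → s 9 = J → s 12 = M →
    s 11 = J * M + 1 → s 15 = encodeTable J M l → s 17 = M →
    ∃ s', Runs lookupLoop s s' ((l.length + 1) * (K * (b + 1))) ∧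
      s' 17 = (l.lookup (s 14)).getD M ∧ Bd b s' ∧ Frame [15, 16, 17] s s' := by
  obtain ⟨K, hK⟩ := Expr.Work.loop
    (e := .bin .mul (.reg 15) (.bin .eq (.reg 17) (.reg 12)))
    (c := .seq (.assign 16 (.bin .sub (.bin .mod (.reg 15) (.reg 11)) (.const 1)))
      (.seq (.assign 15 (.bin .div (.reg 15) (.reg 11)))
        (.cond (.bin .eq (.bin .mod (.reg 16) (.reg 9)) (.reg 14))
          (.assign 17 (.bin .div (.reg 16) (.reg 9))) .skip)))
    (by simp [Expr.Work, workRegs]) (by simp [Prog.Straight, Expr.Work, workRegs])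
  refine ⟨K, fun b s J M l hb hl h9 h12 h11 h15 h17 => ?_⟩
  -- Either the signal value is still present and the answer is decided by the remaining entries
  -- `l'`, or the answer has been found.
  let I : ℕ → Store → Prop := fun k t => Bd b t ∧ Frame [15, 16, 17] s t ∧
    ∃ l', l'.length = k ∧ ValidTable J M l' ∧ t 15 = encodeTable J M l' ∧
      (t 17 = M ∧ l'.lookup (s 14) = l.lookup (s 14) ∨
        t 17 < M ∧ l.lookup (s 14) = some (t 17))
  obtain ⟨s', ⟨k', hI⟩, h0, hr⟩ := hK b I (fun k t h => h.1)
    (fun t ⟨_, _, l', hl', _, h, _⟩ => by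
      rw [List.length_eq_zero_iff.1 hl'] at h
      simp [Expr.eval, Op.eval, h, encodeTable])
    (fun k t ⟨h1, h2, l', hl', hv, h, h'⟩ he => by
      have e9 : t 9 = J := (h2 9 (by simp)).trans h9
      have e11 : t 11 = J * M + 1 := (h2 11 (by simp)).trans h11
      have e12 : t 12 = M := (h2 12 (by simp)).trans h12
      have e14 : t 14 = s 14 := h2 14 (by simp)
      simp only [Expr.eval, Op.eval, e12] at he
      have h17' : t 17 = M := by
        by_contra hne; simp [hne] at he
      replace h' : l'.lookup (s 14) = l.lookup (s 14) := by
        rcases h' with h' | h'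
        · exact h'.2
        · omega
      obtain ⟨⟨z, r⟩, l'', rfl⟩ : ∃ x l'', l' = x :: l'' := by
        cases l' with
        | nil => simp at hl'
        | cons x l'' => exact ⟨x, l'', rfl⟩
      have hzr : z < J ∧ r < M := hv (z, r) (by simp)
      have hv'' : ValidTable J M l'' := fun x hx => hv x (by simp [hx])
      have hlt : 1 + z + J * r < J * M + 1 := by nlinarith
      have hmod : t 15 % (J * M + 1) = 1 + z + J * r := by
        rw [h, encodeTable, Nat.add_mul_mod_self_left, Nat.mod_eq_of_lt hlt]
      have hdiv : t 15 / (J * M + 1) = encodeTable J M l'' := by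
        rw [h, encodeTable, Nat.add_mul_div_left _ _ (by omega), Nat.div_eq_of_lt hlt, zero_add]
      have hmod' : (1 + z + J * r - 1) % J = z := by
        rw [show 1 + z + J * r - 1 = z + J * r by omega, Nat.add_mul_mod_self_left,
          Nat.mod_eq_of_lt hzr.1]
      have hdiv' : (1 + z + J * r - 1) / J = r := by
        rw [show 1 + z + J * r - 1 = z + J * r by omega, Nat.add_mul_div_left _ _ (by omega),
          Nat.div_eq_of_lt hzr.1, zero_add]
      have hbT : (encodeTable J M l'').size ≤ b :=
        size_le_of_le (hdiv ▸ Nat.div_le_self _ _) (h1 15 (by norm_num))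
      have hbE : (1 + z + J * r - 1).size ≤ b := by
        refine size_le_of_le ?_ (h1 11 (by norm_num))
        omega
      have hbr : r.size ≤ b := by
        refine size_le_of_le ?_ (h1 12 (by norm_num))
        omega
      have hlook : List.lookup (s 14) ((z, r) :: l'') =
          if z = s 14 then some r else l''.lookup (s 14) := by
        rw [List.lookup_cons]
        by_cases hz : z = s 14
        · simp [hz]
        · have : (s 14 == z) = false := by simpa using fun h => hz h.symm
          simp [hz, this]
      by_cases hz : z = s 14
      · have : Prog.run (.seq (.assign 16 (.bin .sub (.bin .mod (.reg 15) (.reg 11)) (.const 1)))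
            (.seq (.assign 15 (.bin .div (.reg 15) (.reg 11)))
              (.cond (.bin .eq (.bin .mod (.reg 16) (.reg 9)) (.reg 14))
                (.assign 17 (.bin .div (.reg 16) (.reg 9))) .skip))) t =
            Function.update (Function.update (Function.update t 16 (1 + z + J * r - 1)) 15
              (encodeTable J M l'')) 17 r := by
          simp only [Prog.run, Expr.eval, Op.eval, Function.update_apply, e9, e11, e14, hmod]
          simp only [Nat.reduceEqDiff, if_false, if_true, hdiv, hmod', hdiv']
          simp [hz]
        rw [this]
        refine ⟨((h1.update hbE).update hbT).update hbr,
          ((h2.update (by simp) _).update (by simp) _).update (by simp) _, l'', by simpa using hl',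
          hv'', by simp, .inr ⟨by simpa using hzr.2, ?_⟩⟩
        rw [← h', hlook, if_pos hz]; simp
      · have : Prog.run (.seq (.assign 16 (.bin .sub (.bin .mod (.reg 15) (.reg 11)) (.const 1)))
            (.seq (.assign 15 (.bin .div (.reg 15) (.reg 11)))
              (.cond (.bin .eq (.bin .mod (.reg 16) (.reg 9)) (.reg 14))
                (.assign 17 (.bin .div (.reg 16) (.reg 9))) .skip))) t =
            Function.update (Function.update t 16 (1 + z + J * r - 1)) 15
              (encodeTable J M l'') := by
          simp only [Prog.run, Expr.eval, Op.eval, Function.update_apply, e9, e11, e14, hmod]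
          simp only [Nat.reduceEqDiff, if_false, if_true, hdiv, hmod', hdiv', hz]
        rw [this]
        refine ⟨(h1.update hbE).update hbT,
          (h2.update (by simp) _).update (by simp) _, l'', by simpa using hl',
          hv'', by simp, .inl ⟨by simpa using h17', ?_⟩⟩
        rw [← h', hlook, if_neg hz])
    l.length s ⟨hb, .refl _ _, l, rfl, hl, h15, .inl ⟨h17, rfl⟩⟩
  obtain ⟨h1, h2, l', -, -, h3, h4⟩ := hI
  refine ⟨s', hr, ?_, h1, h2⟩
  rcases h4 with ⟨h4, h5⟩ | ⟨h4, h5⟩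
  · have e12 : s' 12 = M := (h2 12 (by simp)).trans h12
    -- With the signal value still in register 17, the loop can only have stopped because the table
    -- is exhausted.
    have : s' 15 = 0 := by simpa [Expr.eval, Op.eval, e12, h4] using h0
    rw [h3] at this
    have hnil : l' = [] := by
      rcases l' with _ | ⟨⟨z, r⟩, l'⟩
      · rfl
      · simp [encodeTable] at this
    rw [h4, ← h5, hnil]; rfl
  · rw [h5]; rfl

/-! ## Lazy sampling -/

/-- The part of a random function that has been fixed so far. -/
abbrev Table := List (ℕ × ℕ)

section Lazy

variable (key : ℕ → ℕ) (ans : ℕ → ℕ → ℕ) (M : ℕ)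

/-- At most `k` tests of the condition of a while loop. -/
def lazyIter (e : Expr) (body : Store → Table → (Store → Table → ℕ → ENNReal) → ENNReal) :
    ℕ → Store → Table → (Store → Table → ℕ → ENNReal) → ENNReal
  | 0, _, _, _ => 0
  | k + 1, s, τ, φ =>
    if e.eval s = 0 then φ s τ (e.cost s + 1)
    else body s τ fun s₁ τ₁ t₁ => lazyIter e body k s₁ τ₁ fun s₂ τ₂ t₂ =>
      φ s₂ τ₂ (e.cost s + 1 + (t₁ + t₂))

/-- The mean of `φ` over the halting runs with an oracle whose answer to `x` is `ans x y` for a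
random `y < M` that belongs to `key x` and is drawn when it is needed for the first time. -/
def lazyWp (F : ℕ) : Prog → Store → Table → (Store → Table → ℕ → ENNReal) → ENNReal
  | .skip, s, τ, φ => φ s τ 1
  | .assign i e, s, τ, φ => φ (Function.update s i (e.eval s)) τ (e.cost s + 1)
  | .rand i e, s, τ, φ =>
    mean (uniformBelow (e.eval s)) fun r => φ (Function.update s i r) τ (e.cost s + 1)
  | .query i e, s, τ, φ =>
    match τ.lookup (key (e.eval s)) with
    | some y => φ (Function.update s i (ans (e.eval s) y)) τ
        (e.cost s + (ans (e.eval s) y).size + 1)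
    | none => mean (uniformBelow M) fun y =>
        φ (Function.update s i (ans (e.eval s) y)) ((key (e.eval s), y) :: τ)
          (e.cost s + (ans (e.eval s) y).size + 1)
  | .seq c₁ c₂, s, τ, φ =>
    lazyWp F c₁ s τ fun s₁ τ₁ t₁ => lazyWp F c₂ s₁ τ₁ fun s₂ τ₂ t₂ => φ s₂ τ₂ (t₁ + t₂)
  | .cond e c₁ c₂, s, τ, φ =>
    if e.eval s = 0 then lazyWp F c₂ s τ fun s' τ' t => φ s' τ' (e.cost s + 1 + t)
    else lazyWp F c₁ s τ fun s' τ' t => φ s' τ' (e.cost s + 1 + t)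
  | .loop e c, s, τ, φ => lazyIter e (lazyWp F c) F s τ φ

/-- A function on `{0, …, K - 1}` that takes the values in the table where these are given. -/
def complete (K M : ℕ) (τ : Table) (f : Fin K → Fin (M - 1 + 1)) (z : ℕ) : ℕ :=
  (τ.lookup z).getD (if h : z < K then f ⟨z, h⟩ else 0)

/-- The mean over the functions that extend the table. -/
def completions (K M : ℕ) (τ : Table) (Ψ : (ℕ → ℕ) → ENNReal) : ENNReal :=
  mean (PMF.uniformOfFintype (Fin K → Fin (M - 1 + 1))) fun f => Ψ (complete K M τ f)

variable {K : ℕ}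

/-- Resampling a uniformly random function at a point where the table is silent does not change its
distribution. -/
theorem completions_none {τ : Table} {z : ℕ} (hz : z < K) (h : τ.lookup z = none)
    (Ψ : (ℕ → ℕ) → ENNReal) :
    completions K M τ Ψ = mean (uniformBelow M) fun y => completions K M ((z, y) :: τ) Ψ := by
  unfold completions
  rw [mean_uniform_update ⟨z, hz⟩, mean_uniformBelow_eq]
  congr 1; ext y
  congr 1; ext f
  congr 1; ext x
  unfold complete
  rw [List.lookup_cons]
  by_cases hx : x = z
  · subst hx; simp [h, hz]
  · have : (x == z) = false := by simpa using hx
    simp only [this]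
    congr 1
    by_cases hxK : x < K
    · simp [hxK, hx]
    · simp [hxK]

variable {key} {M}

/-- Lazy and eager sampling agree: at any time, the final function is a uniformly random completion
of the current table. The integrand `φ` may depend on that function; otherwise the induction would
fail for sequences, whose second half queries the same function. -/
theorem lazyWp_completions (F : ℕ) (hkey : ∀ x, key x < K) (c : Prog) :
    ∀ (s : Store) (τ : Table) (φ : (ℕ → ℕ) → Store → ℕ → ENNReal),
      lazyWp key ans M F c s τ (fun s' τ' t => completions K M τ' fun g => φ g s' t) =
        completions K M τ fun g => wp (fun x => ans x (g (key x))) F c s (φ g) := by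
  induction c with
  | skip => intro s τ φ; simp only [lazyWp, wp_skip]
  | assign i e => intro s τ φ; simp only [lazyWp, wp_assign]
  | rand i e =>
    intro s τ φ
    simp only [lazyWp, wp_rand, completions]
    rw [mean_comm]
  | query i e =>
    intro s τ φ
    simp only [lazyWp, wp_query]
    cases h : τ.lookup (key (e.eval s)) with
    | some y =>
      simp only [completions]
      congr 1; ext f
      simp [complete, h]
    | none =>
      rw [completions_none M (hkey _) h]
      simp only
      congr 1; ext y
      unfold completions
      congr 1; ext f
      simp [complete]
  | seq c₁ c₂ ih₁ ih₂ =>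
    intro s τ φ
    simp only [lazyWp, wp_seq]
    rw [← ih₁]
    congr 1; ext s₁ τ₁ t₁
    rw [ih₂ s₁ τ₁ fun g s₂ t₂ => φ g s₂ (t₁ + t₂)]
  | cond e c₁ c₂ ih₁ ih₂ =>
    intro s τ φ
    simp only [lazyWp, wp_cond]
    split_ifs
    · rw [← ih₂]
    · rw [← ih₁]
  | loop e c ih =>
    intro s τ φ
    simp only [lazyWp, wp_loop]
    have aux : ∀ k s τ (φ : (ℕ → ℕ) → Store → ℕ → ENNReal),
        lazyIter e (lazyWp key ans M F c) k s τ
          (fun s' τ' t => completions K M τ' fun g => φ g s' t) =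
        completions K M τ fun g => wpIter (fun x => ans x (g (key x))) F e c k s (φ g) := by
      intro k
      induction k with
      | zero => intro s τ φ; simp [lazyIter, wpIter_zero, completions, mean_const]
      | succ k ihk =>
        intro s τ φ
        simp only [lazyIter, wpIter_succ]
        split_ifs
        · rfl
        · rw [← ih]
          congr 1; ext s₁ τ₁ t₁
          rw [ihk s₁ τ₁ fun g s₂ t₂ => φ g s₂ (e.cost s + 1 + (t₁ + t₂))]
    exact aux F s τ φ

/-- From the empty table, the completion is the random function itself. -/
theorem lazyWp_nil (F : ℕ) (hkey : ∀ x, key x < K) (c : Prog) (s : Store)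
    (φ : Store → ℕ → ENNReal) :
    lazyWp key ans M F c s [] (fun s' _ t => φ s' t) =
      mean (PMF.uniformOfFintype (Fin K → Fin (M - 1 + 1))) fun f =>
        wp (fun x => ans x (f ⟨key x, hkey x⟩)) F c s φ := by
  have := lazyWp_completions (M := M) ans F hkey c s [] fun _ => φ
  simp only [completions, mean_const] at this
  rw [this]
  simp [complete, hkey]

end Lazy

/-! ## Simulation of oracle programs -/

/-- Move all registers of an expression behind the working registers. -/
def Expr.shift : Expr → Expr
  | .reg i => .reg (i + workRegs)
  | .const a => .const a
  | .bin o e₁ e₂ => .bin o e₁.shift e₂.shift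

/-- Move all registers behind the working registers, and replace the oracle queries. -/
def Prog.simulate (Q : ℕ → Expr → Prog) : Prog → Prog
  | .skip => .skip
  | .assign i e => .assign (i + workRegs) e.shift
  | .rand i e => .rand (i + workRegs) e.shift
  | .query i e => Q i e
  | .seq c₁ c₂ => .seq (c₁.simulate Q) (c₂.simulate Q)
  | .cond e c₁ c₂ => .cond e.shift (c₁.simulate Q) (c₂.simulate Q)
  | .loop e c => .loop e.shift (c.simulate Q)

/-- The registers behind the working registers of the second store are those of the first. -/
def Shifted (s s' : Store) : Prop := ∀ i, s' (i + workRegs) = s i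

theorem Shifted.update {s s' : Store} (h : Shifted s s') (i v : ℕ) :
    Shifted (Function.update s i v) (Function.update s' (i + workRegs) v) := fun j => by
  by_cases hj : j = i
  · subst hj; simp
  · simp [hj, h j]

theorem Shifted.eval {s s' : Store} (h : Shifted s s') (e : Expr) :
    e.shift.eval s' = e.eval s := by
  induction e with
  | reg i => exact h i
  | const a => rfl
  | bin o e₁ e₂ ih₁ ih₂ => simp only [Expr.shift, Expr.eval, ih₁, ih₂]

theorem Shifted.cost {s s' : Store} (h : Shifted s s') (e : Expr) :
    e.shift.cost s' = e.cost s := by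
  induction e with
  | reg i => simp only [Expr.shift, Expr.cost, h i]
  | const a => rfl
  | bin o e₁ e₂ ih₁ ih₂ => simp only [Expr.shift, Expr.cost, ih₁, ih₂, h.eval]

section Simulation

variable {key : ℕ → ℕ} {ans : ℕ → ℕ → ℕ} {M : ℕ}

theorem lazyIter_eq_zero {e : Expr}
    {body : Store → Table → (Store → Table → ℕ → ENNReal) → ENNReal}
    (hb : ∀ s τ φ, (∀ s τ t, φ s τ t = 0) → body s τ φ = 0) (k : ℕ) :
    ∀ s τ φ, (∀ s τ t, φ s τ t = 0) → lazyIter e body k s τ φ = 0 := by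
  induction k with
  | zero => intros; rfl
  | succ k ih =>
    intro s τ φ h
    simp only [lazyIter]
    split_ifs
    · exact h _ _ _
    · exact hb _ _ _ fun _ _ _ => ih _ _ _ fun _ _ _ => h _ _ _

theorem lazyWp_eq_zero {F : ℕ} (c : Prog) : ∀ (s : Store) (τ : Table)
    (φ : Store → Table → ℕ → ENNReal), (∀ s τ t, φ s τ t = 0) → lazyWp key ans M F c s τ φ = 0 := by
  induction c with
  | skip => intro s τ φ h; exact h _ _ _
  | assign i e => intro s τ φ h; exact h _ _ _
  | rand i e => intro s τ φ h; simp [lazyWp, h, mean_const]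
  | query i e =>
    intro s τ φ h
    simp only [lazyWp]
    split
    · exact h _ _ _
    · simp [h, mean_const]
  | seq c₁ c₂ ih₁ ih₂ => intro s τ φ h; exact ih₁ _ _ _ fun _ _ _ => ih₂ _ _ _ fun _ _ _ => h _ _ _
  | cond e c₁ c₂ ih₁ ih₂ =>
    intro s τ φ h
    simp only [lazyWp]
    split_ifs
    · exact ih₂ _ _ _ fun _ _ _ => h _ _ _
    · exact ih₁ _ _ _ fun _ _ _ => h _ _ _
  | loop e c ih =>
    intro s τ φ h
    exact lazyIter_eq_zero ih _ _ _ _ h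

/-- `Q` answers queries within time `D`, as long as at most `L` queries have been asked; the table is
stored in the working registers as described by `W`. -/
structure AnswersQueries (key : ℕ → ℕ) (ans : ℕ → ℕ → ℕ) (M : ℕ) (Q : ℕ → Expr → Prog)
    (W : Table → Store → Prop) (L D : ℕ) : Prop where
  update : ∀ {τ s}, W τ s → ∀ i v, W τ (Function.update s (i + workRegs) v)
  found : ∀ {i e s τ s' y}, Shifted s s' → W τ s' → τ.length < L → e.cost s ≤ L →
    τ.lookup (key (e.eval s)) = some y → ∃ t,
      Shifted (Function.update s i (ans (e.eval s) y)) t ∧ W τ t ∧ Runs (Q i e) s' t D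
  sampled : ∀ {i e s τ s'}, Shifted s s' → W τ s' → τ.length < L → e.cost s ≤ L →
    τ.lookup (key (e.eval s)) = none → ∃ (t : ℕ → Store) (θ : ℕ → ℕ),
      (∀ y < M, Shifted (Function.update s i (ans (e.eval s) y)) (t y) ∧
        W ((key (e.eval s), y) :: τ) (t y) ∧ θ y ≤ D) ∧
      ∀ O F, D ≤ F → ∀ φ,
        mean (uniformBelow M) (fun y => φ (t y) (θ y)) ≤ wp O F (Q i e) s' φ

variable {Q : ℕ → Expr → Prog} {W : Table → Store → Prop} {L D : ℕ}

/-- Each step of the simulated program is paid for by at most `D` steps. A query costs at least one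
step, so the table gains at most one entry per step and stays within the limit `L` during the `T`
steps that matter; later runs have `φ = 0`. An inequality suffices, since it is applied to
complementary events. -/
theorem AnswersQueries.le_wp (hQ : AnswersQueries key ans M Q W L D) (hM : 0 < M) (hD : 0 < D)
    {O : ℕ → ℕ} {F F' : ℕ} (hF : F ≤ F') (hDF : D ≤ F') (c : Prog) :
    ∀ (s : Store) (τ : Table) (s' : Store) (T : ℕ) (φ : Store → Table → ℕ → ENNReal)
      (ψ : Store → ℕ → ENNReal), Shifted s s' → W τ s' → τ.length + T ≤ L →
      (∀ s τ t, T < t → φ s τ t = 0) →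
      (∀ s₁ τ₁ s₁' t t', Shifted s₁ s₁' → W τ₁ s₁' → τ₁.length ≤ τ.length + t → t ≤ T →
        t' ≤ D * t → φ s₁ τ₁ t ≤ ψ s₁' t') →
      lazyWp key ans M F c s τ φ ≤ wp O F' (c.simulate Q) s' ψ := by
  induction c with
  | skip =>
    intro s τ s' T φ ψ hs hW hL h0 h
    simp only [lazyWp, Prog.simulate, wp_skip]
    by_cases hT : T < 1
    · rw [h0 _ _ _ hT]; exact zero_le
    · exact h _ _ _ _ _ hs hW (by omega) (by omega) (by omega)
  | assign i e =>
    intro s τ s' T φ ψ hs hW hL h0 h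
    simp only [lazyWp, Prog.simulate, wp_assign, hs.eval, hs.cost]
    by_cases hT : T < e.cost s + 1
    · rw [h0 _ _ _ hT]; exact zero_le
    · exact h _ _ _ _ _ (hs.update _ _) (hQ.update hW _ _) (by omega) (by omega)
        (Nat.le_mul_of_pos_left _ hD)
  | rand i e =>
    intro s τ s' T φ ψ hs hW hL h0 h
    simp only [lazyWp, Prog.simulate, wp_rand, hs.eval, hs.cost]
    refine mean_mono fun r => ?_
    by_cases hT : T < e.cost s + 1
    · rw [h0 _ _ _ hT]; exact zero_le
    · exact h _ _ _ _ _ (hs.update _ _) (hQ.update hW _ _) (by omega) (by omega)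
        (Nat.le_mul_of_pos_left _ hD)
  | query i e =>
    intro s τ s' T φ ψ hs hW hL h0 h
    by_cases hT : T < e.cost s + 1
    · refine le_of_eq_of_le ?_ zero_le
      simp only [lazyWp]
      split
      · exact h0 _ _ _ (by omega)
      · rw [← mean_const (uniformBelow M) 0]
        congr 1; ext y
        exact h0 _ _ _ (by omega)
    have hpos : ∀ a, D ≤ D * (e.cost s + a + 1) := fun a => Nat.le_mul_of_pos_right _ (by omega)
    simp only [lazyWp, Prog.simulate]
    split
    next y hy =>
      obtain ⟨t, h1, h2, t', ht', h3⟩ := hQ.found (i := i) hs hW (by omega) (by omega) hy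
      rw [h3 O F' (by omega)]
      by_cases hT' : T < e.cost s + (ans (e.eval s) y).size + 1
      · rw [h0 _ _ _ hT']; exact zero_le
      · exact h _ _ _ _ _ h1 h2 (by omega) (by omega) (ht'.trans (hpos _))
    next hy =>
      obtain ⟨t, θ, h1, h2⟩ := hQ.sampled (i := i) hs hW (by omega) (by omega) hy
      refine le_trans (mean_mono_support fun y hy => ?_) (h2 O F' hDF ψ)
      have hyM : y < M := by have := mem_support_uniformBelow hy; omega
      obtain ⟨h3, h4, h5⟩ := h1 y hyM
      by_cases hT' : T < e.cost s + (ans (e.eval s) y).size + 1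
      · rw [h0 _ _ _ hT']; exact zero_le
      · exact h _ _ _ _ _ h3 h4 (by simp only [List.length_cons]; omega) (by omega)
          (h5.trans (hpos _))
  | seq c₁ c₂ ih₁ ih₂ =>
    intro s τ s' T φ ψ hs hW hL h0 h
    simp only [lazyWp, Prog.simulate, wp_seq]
    refine ih₁ s τ s' T _ _ hs hW hL (fun s τ t ht => ?_) fun s₁ τ₁ s₁' t t' hs₁ hW₁ hl ht ht' => ?_
    · exact lazyWp_eq_zero _ _ _ _ fun _ _ _ => h0 _ _ _ (by omega)
    -- The second program gets the remaining budget `T - t`. The table has gained at most `t`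
    -- entries, so its length plus this budget is still at most `L`.
    · refine ih₂ s₁ τ₁ s₁' (T - t) _ _ hs₁ hW₁ (by omega) (fun _ _ _ _ => h0 _ _ _ (by omega))
        fun s₂ τ₂ s₂' u u' hs₂ hW₂ hl₂ hu hu' => ?_
      exact h _ _ _ _ _ hs₂ hW₂ (by omega) (by omega) (by rw [mul_add]; omega)
  | cond e c₁ c₂ ih₁ ih₂ =>
    intro s τ s' T φ ψ hs hW hL h0 h
    simp only [lazyWp, Prog.simulate, wp_cond, hs.eval, hs.cost]
    have h' : ∀ s₁ τ₁ s₁' t t', Shifted s₁ s₁' → W τ₁ s₁' → τ₁.length ≤ τ.length + t →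
        t ≤ T - (e.cost s + 1) → t' ≤ D * t →
        φ s₁ τ₁ (e.cost s + 1 + t) ≤ ψ s₁' (e.cost s + 1 + t') := by
      intro s₁ τ₁ s₁' t t' hs₁ hW₁ hl ht ht'
      by_cases hT : T < e.cost s + 1 + t
      · rw [h0 _ _ _ hT]; exact zero_le
      · refine h _ _ _ _ _ hs₁ hW₁ (by omega) (by omega) ?_
        have := Nat.le_mul_of_pos_left (e.cost s + 1) hD
        rw [mul_add D (e.cost s + 1)]; omega
    split_ifs
    · exact ih₂ s τ s' (T - (e.cost s + 1)) _ _ hs hW (by omega)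
        (fun _ _ _ _ => h0 _ _ _ (by omega)) h'
    · exact ih₁ s τ s' (T - (e.cost s + 1)) _ _ hs hW (by omega)
        (fun _ _ _ _ => h0 _ _ _ (by omega)) h'
  | loop e c ih =>
    intro s τ s' T φ ψ hs hW hL h0 h
    simp only [lazyWp, Prog.simulate, wp_loop]
    have aux : ∀ k k' s τ s' T (φ : Store → Table → ℕ → ENNReal) (ψ : Store → ℕ → ENNReal), k ≤ k' →
        Shifted s s' → W τ s' → τ.length + T ≤ L →
        (∀ s τ t, T < t → φ s τ t = 0) →
        (∀ s₁ τ₁ s₁' t t', Shifted s₁ s₁' → W τ₁ s₁' → τ₁.length ≤ τ.length + t → t ≤ T →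
          t' ≤ D * t → φ s₁ τ₁ t ≤ ψ s₁' t') →
        lazyIter e (lazyWp key ans M F c) k s τ φ ≤
          wpIter O F' e.shift (c.simulate Q) k' s' ψ := by
      intro k
      induction k with
      | zero => intros; exact zero_le
      | succ k ihk =>
        intro k' s τ s' T φ ψ hk hs hW hL h0 h
        obtain ⟨k', rfl⟩ : ∃ m, k' = m + 1 := ⟨k' - 1, by omega⟩
        simp only [lazyIter, wpIter_succ, hs.eval, hs.cost]
        have hc := Nat.le_mul_of_pos_left (e.cost s + 1) hD
        split_ifs
        · by_cases hT : T < e.cost s + 1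
          · rw [h0 _ _ _ hT]; exact zero_le
          · exact h _ _ _ _ _ hs hW (by omega) (by omega) hc
        · refine ih s τ s' T _ _ hs hW hL (fun s τ t ht => ?_)
            fun s₁ τ₁ s₁' t t' hs₁ hW₁ hl ht ht' => ?_
          · exact lazyIter_eq_zero (lazyWp_eq_zero c) _ _ _ _ fun _ _ _ => h0 _ _ _ (by omega)
          · refine ihk k' s₁ τ₁ s₁' (T - t) _ _ (by omega) hs₁ hW₁ (by omega)
              (fun _ _ _ _ => h0 _ _ _ (by omega)) fun s₂ τ₂ s₂' u u' hs₂ hW₂ hl₂ hu hu' => ?_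
            by_cases hT : T < e.cost s + 1 + (t + u)
            · rw [h0 _ _ _ hT]; exact zero_le
            · exact h _ _ _ _ _ hs₂ hW₂ (by omega) (by omega) (by
                rw [mul_add D (e.cost s + 1), mul_add D t]; omega)
    exact aux F F' s τ s' T φ ψ hF hs hW hL h0 h

end Simulation

/-! ## The hybrid oracles as programs -/

/-- The data of a hybrid: the instance `(p, g, h)` with two further elements `v`, `w`, the number
`n` of input bits and the number `j` of bits that are treated by the random function. -/
structure Hybrid where
  p : ℕ
  g : ℕ
  h : ℕ
  v : ℕ
  w : ℕ
  n : ℕ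
  j : ℕ

namespace Hybrid

variable (H : Hybrid)

def q : ℕ := H.p / 2

/-- The node of the tree at level `j + 1` above `x`, where `r` is the random number for its parent. -/
def child (x r : ℕ) : ℕ :=
  foldN H.p H.q ((if x / 2 ^ H.j % 2 = 0 then H.v else H.w) ^ (r % H.q) % H.p *
    (if x / 2 ^ H.j % 2 = 0 then H.g else H.h) ^ (r / H.q) % H.p)

/-- The answer to the query `x`, where `r` is the random number for the first `j` bits of `x`. -/
def answer (x r : ℕ) : ℕ :=
  if x < 2 ^ H.n then
    stepsN H.p H.q H.g H.h (H.n - H.j - 1) (x / 2 ^ H.j / 2) (H.child x r)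
  else 0

/-- The contents of the registers that do not change during the simulation. -/
def Regs (s : Store) : Prop :=
  s 0 = H.p ∧ s 1 = H.g ∧ s 2 = H.h ∧ s 3 = H.v ∧ s 4 = H.w ∧ s 5 = H.q ∧ s 6 = H.n ∧
    s 7 = 2 ^ H.n ∧ s 8 = H.j ∧ s 9 = 2 ^ H.j ∧ s 11 = 2 ^ H.j * (H.q * H.q) + 1 ∧
    s 12 = H.q * H.q

/-- The preconditions of the exponentiation loops, which expect reduced bases, and of reductions
modulo `q`. -/
structure Ok : Prop where
  g_lt : H.g < H.p
  h_lt : H.h < H.p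
  v_lt : H.v < H.p
  w_lt : H.w < H.p
  q_pos : 0 < H.q

variable {H}

theorem Ok.one_lt (hH : H.Ok) : 1 < H.p := by
  have := hH.q_pos
  unfold q at this; omega

theorem Ok.q_le (_ : H.Ok) : H.q ≤ H.p := Nat.div_le_self _ _

/-- Register 10 is exempt because it holds the encoded table, which grows. -/
theorem Regs.congr {s s' : Store} (h : H.Regs s) (hs : ∀ i < 13, i ≠ 10 → s' i = s i) :
    H.Regs s' := by
  unfold Regs at h ⊢
  rw [hs 0 (by norm_num) (by norm_num), hs 1 (by norm_num) (by norm_num),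
    hs 2 (by norm_num) (by norm_num), hs 3 (by norm_num) (by norm_num),
    hs 4 (by norm_num) (by norm_num), hs 5 (by norm_num) (by norm_num),
    hs 6 (by norm_num) (by norm_num), hs 7 (by norm_num) (by norm_num),
    hs 8 (by norm_num) (by norm_num), hs 9 (by norm_num) (by norm_num),
    hs 11 (by norm_num) (by norm_num), hs 12 (by norm_num) (by norm_num)]
  exact h

theorem Regs.frame {s s' : Store} {l : List ℕ} (h : H.Regs s) (hs : Frame l s s')
    (hl : ∀ i ∈ l, i = 10 ∨ 13 ≤ i) : H.Regs s' :=
  h.congr fun i hi hi' => hs i fun hil => by have := hl i hil; omega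

end Hybrid

/-- Prepare the exponentiation with base `v` or `w`. -/
def childInit : Prog :=
  .seq (.assign 18 (.const 1))
    (.seq (.cond (.bin .mod (.bin .div (.reg 13) (.reg 9)) (.const 2))
        (.assign 19 (.reg 4)) (.assign 19 (.reg 3)))
      (.assign 20 (.bin .mod (.reg 17) (.reg 5))))

theorem childInit_straight : childInit.Straight := by
  simp [childInit, Prog.Straight, Expr.Work, workRegs]

theorem childInit_run (s : Store) :
    childInit.run s = Function.update (Function.update (Function.update s 18 1) 19
      (if s 13 / s 9 % 2 = 0 then s 3 else s 4)) 20 (s 17 % s 5) := by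
  by_cases h : s 13 / s 9 % 2 = 0 <;> simp [childInit, Prog.run, Expr.eval, Op.eval, h]

/-- Prepare the exponentiation with base `g` or `h`. -/
def childMid : Prog :=
  .seq (.cond (.bin .mod (.bin .div (.reg 13) (.reg 9)) (.const 2))
      (.assign 19 (.reg 2)) (.assign 19 (.reg 1)))
    (.assign 20 (.bin .div (.reg 17) (.reg 5)))

theorem childMid_straight : childMid.Straight := by
  simp [childMid, Prog.Straight, Expr.Work, workRegs]

theorem childMid_run (s : Store) :
    childMid.run s = Function.update (Function.update s 19
      (if s 13 / s 9 % 2 = 0 then s 1 else s 2)) 20 (s 17 / s 5) := by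
  by_cases h : s 13 / s 9 % 2 = 0 <;> simp [childMid, Prog.run, Expr.eval, Op.eval, h]

/-- Prepare the remaining levels of the tree. -/
def childFinish : Prog :=
  .seq foldProg (.seq (.assign 22 (.bin .div (.bin .div (.reg 13) (.reg 9)) (.const 2)))
    (.assign 23 (.bin .sub (.bin .sub (.reg 6) (.reg 8)) (.const 1))))

theorem childFinish_straight : childFinish.Straight := by
  simp [childFinish, Prog.Straight, Expr.Work, workRegs, foldProg_straight]

theorem childFinish_run (s : Store) :
    childFinish.run s = Function.update (Function.update (Function.update s 21
      (foldN (s 0) (s 5) (s 18))) 22 (s 13 / s 9 / 2)) 23 (s 6 - s 8 - 1) := by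
  simp [childFinish, Prog.run, Expr.eval, Op.eval, foldProg_run]

/-- Compute the node at level `j + 1`. -/
def childProg : Prog :=
  .seq childInit (.seq powLoop (.seq childMid (.seq powLoop childFinish)))

/-- One random number below `q * q` carries two exponents: its remainder modulo `q` for the base `v`
or `w`, its quotient for `g` or `h`. The second exponentiation starts with the result of the first
in the accumulator, which yields the product. -/
theorem childProg_runs : ∃ K, ∀ (H : Hybrid) b s, H.Ok → H.Regs s → Bd b s →
    ∃ s', Runs childProg s s' (K * (b + 1) ^ 2) ∧ s' 21 = H.child (s 13) (s 17) ∧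
      s' 22 = s 13 / 2 ^ H.j / 2 ∧ s' 23 = H.n - H.j - 1 ∧ Bd b s' ∧
      Frame [18, 19, 20, 21, 22, 23] s s' := by
  obtain ⟨K₁, h₁⟩ := childInit_straight.runs
  obtain ⟨K₂, h₂⟩ := powLoop_runs
  obtain ⟨K₃, h₃⟩ := childMid_straight.runs
  obtain ⟨K₄, h₄⟩ := childFinish_straight.runs
  refine ⟨K₁ + K₂ + K₃ + K₂ + K₄, fun H b s hH hs hb => ?_⟩
  have hb1 : 1 ≤ b := (Nat.size_pos.2 (by rw [hs.1]; exact hH.one_lt.le : 0 < s 0)).trans_le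
    (hb 0 (by norm_num))
  have hp := hH.one_lt
  have hg := hH.g_lt
  have hh := hH.h_lt
  have hv := hH.v_lt
  have hw := hH.w_lt
  have hsub : ∀ i ∈ [18, 19, 20, 21, 22, 23], i = 10 ∨ 13 ≤ i := by simp
  obtain ⟨r₁, -⟩ := h₁ b s hb
  rw [childInit_run] at r₁
  set t₁ := Function.update (Function.update (Function.update s 18 1) 19
      (if s 13 / s 9 % 2 = 0 then s 3 else s 4)) 20 (s 17 % s 5) with ht₁
  have f₁ : Frame [18, 19, 20, 21, 22, 23] s t₁ :=
    (((Frame.refl _ _).update (by simp) _).update (by simp) _).update (by simp) _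
  have b₁ : Bd b t₁ := by
    refine ((hb.update (by simpa using hb1)).update ?_).update ?_
    · split_ifs
      · exact hb 3 (by norm_num)
      · exact hb 4 (by norm_num)
    · exact size_le_of_le (Nat.mod_le _ _) (hb 17 (by norm_num))
  have g₁ := hs.frame f₁ hsub
  have a18 : t₁ 18 = 1 := by simp [ht₁]
  have a19 : t₁ 19 = if s 13 / 2 ^ H.j % 2 = 0 then H.v else H.w := by
    unfold Hybrid.Regs at hs
    simp [ht₁, hs]
  have a20 : t₁ 20 = s 17 % H.q := by
    unfold Hybrid.Regs at hs
    simp [ht₁, hs]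
  obtain ⟨t₂, r₂, v₂, b₂, f₂'⟩ := h₂ b t₁ b₁ (by rw [a18, g₁.1]; exact hp)
    (by rw [a19, g₁.1]; split_ifs <;> assumption)
  have f₂ : Frame [18, 19, 20, 21, 22, 23] s t₂ := f₁.trans fun i hi =>
    f₂' i (by simp at hi ⊢; omega)
  have g₂ := hs.frame f₂ hsub
  rw [a18, a19, a20, one_mul, g₁.1] at v₂
  obtain ⟨r₃, -⟩ := h₃ b t₂ b₂
  rw [childMid_run] at r₃
  set t₃ := Function.update (Function.update t₂ 19
      (if t₂ 13 / t₂ 9 % 2 = 0 then t₂ 1 else t₂ 2)) 20 (t₂ 17 / t₂ 5) with ht₃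
  have f₃ : Frame [18, 19, 20, 21, 22, 23] s t₃ :=
    (f₂.update (by simp) _).update (by simp) _
  have b₃ : Bd b t₃ := by
    refine (b₂.update ?_).update ?_
    · split_ifs
      · exact b₂ 1 (by norm_num)
      · exact b₂ 2 (by norm_num)
    · exact size_le_of_le (Nat.div_le_self _ _) (b₂ 17 (by norm_num))
  have g₃ := hs.frame f₃ hsub
  have x₂ : t₂ 13 = s 13 := f₂ 13 (by simp)
  have y₂ : t₂ 17 = s 17 := f₂ 17 (by simp)
  have c18 : t₃ 18 = t₂ 18 := by simp [ht₃]
  have c19 : t₃ 19 = if s 13 / 2 ^ H.j % 2 = 0 then H.g else H.h := by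
    unfold Hybrid.Regs at g₂
    simp [ht₃, g₂, x₂]
  have c20 : t₃ 20 = s 17 / H.q := by
    unfold Hybrid.Regs at g₂
    simp [ht₃, g₂, y₂]
  obtain ⟨t₄, r₄, v₄, b₄, f₄'⟩ := h₂ b t₃ b₃
    (by rw [c18, g₃.1, v₂]; exact Nat.mod_lt _ (by omega))
    (by rw [c19, g₃.1]; split_ifs <;> assumption)
  have f₄ : Frame [18, 19, 20, 21, 22, 23] s t₄ := f₃.trans fun i hi =>
    f₄' i (by simp at hi ⊢; omega)
  have g₄ := hs.frame f₄ hsub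
  rw [c18, c19, c20, v₂, g₃.1] at v₄
  obtain ⟨r₅, -⟩ := h₄ b t₄ b₄
  have x₄ : t₄ 13 = s 13 := f₄ 13 (by simp)
  refine ⟨_, (r₁.seq (r₂.seq (r₃.seq (r₄.seq r₅)))).mono ?_, ?_, ?_, ?_, ?_, ?_⟩
  · have : b + 1 ≤ (b + 1) ^ 2 := Nat.le_self_pow (by norm_num) _
    calc _ ≤ K₁ * (b + 1) ^ 2 + (K₂ * (b + 1) ^ 2 + (K₃ * (b + 1) ^ 2 + (K₂ * (b + 1) ^ 2 +
          K₄ * (b + 1) ^ 2))) := by gcongr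
      _ = _ := by ring
  · unfold Hybrid.Regs at g₄
    rw [childFinish_run]
    simp [g₄, v₄, Hybrid.child]
  · unfold Hybrid.Regs at g₄
    rw [childFinish_run]
    simp [g₄, x₄]
  · unfold Hybrid.Regs at g₄
    rw [childFinish_run]
    simp [g₄]
  · rw [childFinish_run]
    refine ((b₄.update ?_).update ?_).update ?_
    · refine size_le_of_le (foldN_lt ?_).le (b₄ 5 (by norm_num))
      unfold Hybrid.Regs at g₄
      rw [g₄.2.2.2.2.2.1]; exact hH.q_pos
    · exact size_le_of_le ((Nat.div_le_self _ _).trans (Nat.div_le_self _ _)) (b₄ 13 (by norm_num))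
    · exact size_le_of_le ((Nat.sub_le _ _).trans (Nat.sub_le _ _)) (b₄ 6 (by norm_num))
  · rw [childFinish_run]
    exact ((f₄.update (by simp) _).update (by simp) _).update (by simp) _

/-- Answer a query, and store the answer in register `i` of the simulated program. -/
def respond (i : ℕ) : Prog :=
  .seq childProg (.seq stepLoop (.seq
    (.cond (.bin .lt (.reg 13) (.reg 7)) .skip (.assign 21 (.const 0)))
    (.assign (i + workRegs) (.reg 21))))

/-- At most `n ≤ b` levels of quadratic cost give the third power. The bounds and the frame refer to
the store before the answer is written, because register `i + workRegs` is not a working register.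
-/
theorem respond_runs : ∃ K, ∀ (H : Hybrid) b s i, H.Ok → H.Regs s → Bd b s → H.n ≤ b →
    ∃ s', Runs (respond i) s (Function.update s' (i + workRegs) (H.answer (s 13) (s 17)))
        (K * (b + 1) ^ 3) ∧ Bd b s' ∧ Frame [18, 19, 20, 21, 22, 23] s s' := by
  obtain ⟨K₁, h₁⟩ := childProg_runs
  obtain ⟨K₂, h₂⟩ := stepLoop_runs
  obtain ⟨K₃, h₃⟩ := (show Prog.Straight (.cond (.bin .lt (.reg 13) (.reg 7)) .skip
    (.assign 21 (.const 0))) by simp [Prog.Straight, Expr.Work, workRegs]).runs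
  refine ⟨K₁ + K₂ + K₃ + 2, fun H b s i hH hs hb hn => ?_⟩
  have hsub : ∀ i ∈ [18, 19, 20, 21, 22, 23], i = 10 ∨ 13 ≤ i := by simp
  obtain ⟨t₁, r₁, v21, v22, v23, b₁, f₁⟩ := h₁ H b s hH hs hb
  have g₁ := hs.frame f₁ hsub
  have g₁' := g₁
  unfold Hybrid.Regs at g₁'
  obtain ⟨t₂, r₂, v₂, b₂, f₂'⟩ := h₂ b t₁ b₁ (by rw [g₁.1]; exact hH.one_lt)
    (by rw [g₁.1, g₁.2.1]; exact hH.g_lt) (by rw [g₁.1, g₁.2.2.1]; exact hH.h_lt)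
    (by rw [g₁'.2.2.2.2.2.1]; exact hH.q_pos)
  have f₂ := f₁.trans f₂'
  have g₂ := hs.frame f₂ hsub
  have x₂ : t₂ 13 = s 13 := f₂ 13 (by simp)
  have v₂' : t₂ 21 = stepsN H.p H.q H.g H.h (H.n - H.j - 1) (s 13 / 2 ^ H.j / 2)
      (H.child (s 13) (s 17)) := by
    rw [v₂, v21, v22, v23]; simp only [g₁']
  obtain ⟨r₃, -⟩ := h₃ b t₂ b₂
  have hrun : Prog.run (.cond (.bin .lt (.reg 13) (.reg 7)) .skip (.assign 21 (.const 0))) t₂ =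
      Function.update t₂ 21 (H.answer (s 13) (s 17)) := by
    unfold Hybrid.Regs at g₂
    by_cases hx : s 13 < 2 ^ H.n
    · simp [Prog.run, Expr.eval, Op.eval, x₂, g₂, Hybrid.answer, hx, ← v₂']
    · simp [Prog.run, Expr.eval, Op.eval, x₂, g₂, Hybrid.answer, hx]
  rw [hrun] at r₃
  have hsz : (H.answer (s 13) (s 17)).size ≤ b := by
    unfold Hybrid.answer
    split_ifs
    · rw [← v₂']; exact b₂ 21 (by norm_num)
    · simp
  have r₄ := Runs.assign (i + workRegs) (.reg 21)
    (Function.update t₂ 21 (H.answer (s 13) (s 17)))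
  rw [show Expr.eval (.reg 21) (Function.update t₂ 21 (H.answer (s 13) (s 17))) =
    H.answer (s 13) (s 17) by simp [Expr.eval]] at r₄
  refine ⟨_, (r₁.seq (r₂.seq (r₃.seq r₄))).mono ?_, b₂.update hsz, f₂.update (by simp) _⟩
  have e1 : b + 1 ≤ (b + 1) ^ 3 := Nat.le_self_pow (by norm_num) _
  have e2 : (b + 1) ^ 2 ≤ (b + 1) ^ 3 := Nat.pow_le_pow_right (by omega) (by norm_num)
  have e3 : t₁ 23 + 1 ≤ b + 1 := by rw [v23]; omega
  have e4 : Expr.cost (.reg 21) (Function.update t₂ 21 (H.answer (s 13) (s 17))) + 1 ≤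
      2 * (b + 1) ^ 3 := by
    simp only [Expr.cost, Function.update_self]
    omega
  calc _ ≤ K₁ * (b + 1) ^ 3 + ((b + 1) * (K₂ * (b + 1) ^ 2) + (K₃ * (b + 1) ^ 3 +
        2 * (b + 1) ^ 3)) := by gcongr
    _ = _ := by ring

/-- Replace a value that has not been found in the table by a random one. -/
def sampleProg : Prog :=
  .cond (.bin .eq (.reg 17) (.reg 12))
    (.seq (.rand 17 (.reg 12))
      (.assign 10 (.bin .add (.bin .add (.bin .add (.const 1) (.reg 14))
        (.bin .mul (.reg 9) (.reg 17))) (.bin .mul (.reg 11) (.reg 10)))))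
    .skip

/-- Look up the first `j` bits of the query in the table. -/
def findProg (e : Expr) : Prog :=
  .seq (.assign 13 e) (.seq
    (.seq (.assign 14 (.bin .mod (.reg 13) (.reg 9)))
      (.seq (.assign 15 (.reg 10)) (.assign 17 (.reg 12))))
    lookupLoop)

/-- Answer the query `e`, and store the answer in register `i` of the simulated program. -/
def queryProg (i : ℕ) (e : Expr) : Prog :=
  .seq (findProg e.shift) (.seq sampleProg (respond i))

/-- The state of the working registers during the simulation. -/
def Hybrid.Inv (H : Hybrid) (b : ℕ) (τ : Table) (s : Store) : Prop :=
  H.Regs s ∧ s 10 = encodeTable (2 ^ H.j) (H.q * H.q) τ ∧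
    ValidTable (2 ^ H.j) (H.q * H.q) τ ∧ Bd b s

theorem Shifted.frame {s s' t : Store} {l : List ℕ} (h : Shifted s s') (hf : Frame l s' t)
    (hl : ∀ i ∈ l, i < workRegs) : Shifted s t := fun i => by
  rw [hf _ fun hi => by have := hl _ hi; omega, h i]

/-- The expression `e` comes from the simulated program and reads registers without a size bound, so
its cost is limited by a hypothesis. -/
theorem findProg_runs : ∃ K, ∀ (H : Hybrid) b τ e s, H.Inv b τ s →
    e.cost s ≤ b → τ.length ≤ b → ∃ s', Runs (findProg e) s s' (K * (b + 1) ^ 2) ∧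
      s' 13 = e.eval s ∧ s' 14 = e.eval s % 2 ^ H.j ∧
      s' 17 = (τ.lookup (e.eval s % 2 ^ H.j)).getD (H.q * H.q) ∧
      H.Inv b τ s' ∧ Frame [13, 14, 15, 16, 17] s s' := by
  obtain ⟨K₁, h₁⟩ := (show Prog.Straight (.seq (.assign 14 (.bin .mod (.reg 13) (.reg 9)))
      (.seq (.assign 15 (.reg 10)) (.assign 17 (.reg 12))))
      by simp [Prog.Straight, Expr.Work, workRegs]).runs
  obtain ⟨K₂, h₂⟩ := lookupLoop_runs
  refine ⟨1 + K₁ + K₂, fun H b τ e s hs he hτ => ?_⟩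
  obtain ⟨hregs, hT, hval, hb⟩ := hs
  have hsub : ∀ i ∈ [13, 14, 15, 16, 17], i = 10 ∨ 13 ≤ i := by simp
  have r₀ := Runs.assign 13 e s
  set t₀ := Function.update s 13 (e.eval s) with ht₀
  have b₀ : Bd b t₀ := hb.update ((e.size_eval_le s).trans he)
  have f₀ : Frame [13, 14, 15, 16, 17] s t₀ := (Frame.refl _ _).update (by simp) _
  obtain ⟨r₁, -⟩ := h₁ b t₀ b₀
  have hregs' := hregs
  unfold Hybrid.Regs at hregs'
  rw [show Prog.run _ t₀ = Function.update (Function.update (Function.update t₀ 14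
      (e.eval s % 2 ^ H.j)) 15 (s 10)) 17 (H.q * H.q) by
    simp [Prog.run, Expr.eval, Op.eval, ht₀, hregs']] at r₁
  set t₁ := Function.update (Function.update (Function.update t₀ 14
      (e.eval s % 2 ^ H.j)) 15 (s 10)) 17 (H.q * H.q) with ht₁
  have f₁ : Frame [13, 14, 15, 16, 17] s t₁ :=
    ((f₀.update (by simp) _).update (by simp) _).update (by simp) _
  have b₁ : Bd b t₁ := by
    refine ((b₀.update ?_).update (hb 10 (by norm_num))).update ?_
    · exact size_le_of_le (Nat.mod_le _ _) ((e.size_eval_le s).trans he)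
    · have := hb 12 (by norm_num)
      rwa [hregs'.2.2.2.2.2.2.2.2.2.2.2] at this
  have g₁ := hregs.frame f₁ hsub
  unfold Hybrid.Regs at g₁
  obtain ⟨t₂, r₂, v₂, b₂, f₂'⟩ := h₂ b t₁ (2 ^ H.j) (H.q * H.q) τ b₁ hval (by simp [g₁])
    (by simp [g₁]) (by simp [g₁]) (by simp [ht₁, hT]) (by simp [ht₁])
  have f₂ : Frame [13, 14, 15, 16, 17] s t₂ := f₁.trans fun i hi =>
    f₂' i (by simp at hi ⊢; omega)
  refine ⟨t₂, (r₀.seq (r₁.seq r₂)).mono ?_, ?_, ?_, ?_, ⟨hregs.frame f₂ hsub, ?_, hval, b₂⟩, f₂⟩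
  · have e1 : b + 1 ≤ (b + 1) ^ 2 := Nat.le_self_pow (by norm_num) _
    calc _ ≤ 1 * (b + 1) ^ 2 + (K₁ * (b + 1) ^ 2 + (b + 1) * (K₂ * (b + 1))) := by
          gcongr; omega
      _ = _ := by ring
  · rw [f₂' 13 (by simp)]; simp [ht₁, ht₀]
  · rw [f₂' 14 (by simp)]; simp [ht₁]
  · rw [v₂]; simp [ht₁]
  · rw [f₂ 10 (by simp), hT]

theorem mem_of_lookup_eq_some {l : List (ℕ × ℕ)} {z y : ℕ} (h : l.lookup z = some y) : (z, y) ∈ l := by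
  induction l with
  | nil => simp at h
  | cons x l ih =>
    obtain ⟨a, b⟩ := x
    rw [List.lookup_cons] at h
    by_cases hz : z = a
    · subst hz; simp at h; simp [h]
    · have : (z == a) = false := by simpa using hz
      simp only [this] at h
      exact List.mem_cons_of_mem _ (ih h)

/-- Bounds the bit length of the register that stores the table. -/
theorem encodeTable_lt {J M : ℕ} : ∀ {l : Table}, ValidTable J M l →
    encodeTable J M l < (J * M + 1) ^ l.length
  | [], _ => by simp [encodeTable]
  | (z, r) :: l, h => by
    have ih := encodeTable_lt (J := J) (M := M) (l := l) fun x hx => h x (by simp [hx])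
    obtain ⟨hz, hr⟩ : z < J ∧ r < M := h (z, r) (by simp)
    have h1 : 1 + z + J * r ≤ J * M := by
      have : J * (r + 1) ≤ J * M := Nat.mul_le_mul_left _ hr
      rw [mul_add] at this; omega
    rw [encodeTable, List.length_cons, pow_succ]
    generalize encodeTable J M l = x at *
    generalize (J * M + 1) ^ l.length = y at *
    have : (J * M + 1) * (x + 1) ≤ (J * M + 1) * y := Nat.mul_le_mul_left _ ih
    rw [mul_comm y]
    linarith

/-- With at most `L` entries and a base of at most `2 ^ d`, the encoded table has at most `d * L ≤
b` bits and fits into the working registers. The constant `K` does not depend on the hybrid. -/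
theorem Hybrid.answersQueries : ∃ K > 0, ∀ (H : Hybrid) (b L d : ℕ), H.Ok → H.n ≤ b → L ≤ b →
    2 ^ H.j * (H.q * H.q) + 1 ≤ 2 ^ d → d * L ≤ b →
    AnswersQueries (fun x => x % 2 ^ H.j) H.answer (H.q * H.q) queryProg (H.Inv b) L
      (K * (b + 1) ^ 3) := by
  obtain ⟨K₁, h₁⟩ := findProg_runs
  obtain ⟨K₂, h₂⟩ := respond_runs
  obtain ⟨K₃, h₃⟩ := Expr.cost_le (.bin .eq (.reg 17) (.reg 12)) (by simp [Expr.Work, workRegs])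
  obtain ⟨K₄, h₄⟩ := (show Prog.Straight (.assign 10 (.bin .add (.bin .add (.bin .add (.const 1)
      (.reg 14)) (.bin .mul (.reg 9) (.reg 17))) (.bin .mul (.reg 11) (.reg 10))))
      by simp [Prog.Straight, Expr.Work, workRegs]).runs
  refine ⟨K₁ + K₂ + K₃ + K₄ + 4, by omega, fun H b L d hH hn hLb hd hdL => ?_⟩
  have hM : 0 < H.q * H.q := Nat.mul_pos hH.q_pos hH.q_pos
  have e1 : b + 1 ≤ (b + 1) ^ 3 := Nat.le_self_pow (by norm_num) _
  have e2 : (b + 1) ^ 2 ≤ (b + 1) ^ 3 := Nat.pow_le_pow_right (by omega) (by norm_num)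
  have hinv : ∀ {τ s}, H.Inv b τ s → ∀ i v, H.Inv b τ (Function.update s (i + workRegs) v) := by
    rintro τ s ⟨i1, i2, i3, i4⟩ i v
    have hne : ∀ k < workRegs, Function.update s (i + workRegs) v k = s k := fun k hk =>
      Function.update_of_ne (by omega) _ _
    exact ⟨i1.congr fun k hk _ => hne k (by unfold workRegs; omega),
      by rw [hne 10 (by norm_num), i2], i3, fun k hk => by rw [hne k hk]; exact i4 k hk⟩
  have hsub1 : ∀ i ∈ [13, 14, 15, 16, 17], i < workRegs := by simp [workRegs]
  have hsub2 : ∀ i ∈ [18, 19, 20, 21, 22, 23], i < workRegs := by simp [workRegs]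
  have hsub3 : ∀ i ∈ [18, 19, 20, 21, 22, 23], i = 10 ∨ 13 ≤ i := by simp
  have hrespond : ∀ {i : ℕ} {e : Expr} {s τ t x y}, Shifted s t → H.Inv b τ t → t 13 = x → t 17 = y →
      e.eval s = x → ∃ t', Shifted (Function.update s i (H.answer (e.eval s) y)) t' ∧
        H.Inv b τ t' ∧ Runs (respond i) t t' (K₂ * (b + 1) ^ 3) := by
    rintro i e s τ t x y hs hW rfl rfl he
    obtain ⟨t', r, bd, fr⟩ := h₂ H b t i hH hW.1 hW.2.2.2 hn
    refine ⟨_, (hs.frame fr hsub2).update i (H.answer (e.eval s) (t 17)), ?_, by rw [he]; exact r⟩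
    exact hinv ⟨hW.1.frame fr hsub3, by rw [fr 10 (by simp), hW.2.1], hW.2.2.1, bd⟩ _ _
  refine ⟨hinv, ?_, ?_⟩
  · intro i e s τ s' y hs hW hl he hy
    obtain ⟨t₁, r₁, v13, v14, v17, w₁, f₁⟩ := h₁ H b τ e.shift s' hW
      (by rw [hs.cost]; omega) (by omega)
    rw [hs.eval] at v13 v14 v17
    rw [hy, Option.getD_some] at v17
    have hyM : y < H.q * H.q := (hW.2.2.1 _ (mem_of_lookup_eq_some hy)).2
    -- A stored value is below `q * q`, hence different from the signal value in register 12, and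
    -- nothing is drawn.
    have r₂ : Runs sampleProg t₁ t₁ (K₃ * (b + 1) + 1 + 1) := by
      have h12 : t₁ 12 = H.q * H.q := by
        have := w₁.1
        unfold Hybrid.Regs at this
        exact this.2.2.2.2.2.2.2.2.2.2.2
      refine (Runs.cond (T := 1) ?_).mono (by have := h₃ b t₁ w₁.2.2.2; omega)
      rw [if_pos (by simp [Expr.eval, Op.eval, v17, h12]; omega)]
      exact ⟨1, le_rfl, fun _ _ _ _ => wp_skip _ _ _ _⟩
    obtain ⟨t', hs', hW', r₃⟩ := hrespond (i := i) (e := e) (hs.frame f₁ hsub1) w₁ v13 v17 rfl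
    refine ⟨t', hs', hW', (r₁.seq (r₂.seq r₃)).mono ?_⟩
    calc _ ≤ K₁ * (b + 1) ^ 3 + ((K₃ * (b + 1) ^ 3 + (b + 1) ^ 3 + (b + 1) ^ 3) +
          K₂ * (b + 1) ^ 3) := by gcongr <;> omega
      _ = (K₁ + K₂ + K₃ + 2) * (b + 1) ^ 3 := by ring
      _ ≤ _ := Nat.mul_le_mul_right _ (by omega)
  · intro i e s τ s' hs hW hl he hy
    obtain ⟨t₁, ⟨u₁, hu₁, r₁⟩, v13, v14, v17, w₁, f₁⟩ := h₁ H b τ e.shift s' hW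
      (by rw [hs.cost]; omega) (by omega)
    rw [hs.eval] at v13 v14 v17
    rw [hy, Option.getD_none] at v17
    have hregs := w₁.1
    unfold Hybrid.Regs at hregs
    have h12 : t₁ 12 = H.q * H.q := hregs.2.2.2.2.2.2.2.2.2.2.2
    -- Stated for all `y`, with irrelevant stores when `y` is out of range, so that `choose` yields
    -- total functions.
    have key : ∀ y, ∃ t₂ t' θ₁ θ₂, y < H.q * H.q →
        Shifted (Function.update s i (H.answer (e.eval s) y)) t' ∧
        H.Inv b ((e.eval s % 2 ^ H.j, y) :: τ) t' ∧ θ₁ ≤ K₄ * (b + 1) ∧ θ₂ ≤ K₂ * (b + 1) ^ 3 ∧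
        (∀ O F, θ₁ ≤ F → ∀ φ, wp O F (.assign 10 (.bin .add (.bin .add (.bin .add (.const 1)
          (.reg 14)) (.bin .mul (.reg 9) (.reg 17))) (.bin .mul (.reg 11) (.reg 10))))
          (Function.update t₁ 17 y) φ = φ t₂ θ₁) ∧
        (∀ O F, θ₂ ≤ F → ∀ φ, wp O F (respond i) t₂ φ = φ t' θ₂) := by
      intro y
      by_cases hyM : y < H.q * H.q
      swap
      · exact ⟨s, s, 0, 0, fun h => absurd h hyM⟩
      have bU : Bd b (Function.update t₁ 17 y) := by
        refine w₁.2.2.2.update (size_le_of_le hyM.le ?_)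
        rw [← h12]; exact w₁.2.2.2 12 (by norm_num)
      obtain ⟨⟨θ₁, hθ₁, r₂⟩, -⟩ := h₄ b _ bU
      have hval : ValidTable (2 ^ H.j) (H.q * H.q) ((e.eval s % 2 ^ H.j, y) :: τ) := by
        intro x hx
        rcases List.mem_cons.1 hx with rfl | hx
        · exact ⟨Nat.mod_lt _ (by positivity), hyM⟩
        · exact w₁.2.2.1 x hx
      have henc : (encodeTable (2 ^ H.j) (H.q * H.q) ((e.eval s % 2 ^ H.j, y) :: τ)).size ≤ b := by
        rw [Nat.size_le]
        refine (encodeTable_lt hval).trans_le ?_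
        calc _ ≤ (2 ^ d) ^ (τ.length + 1) := by
              rw [List.length_cons]; gcongr
          _ = 2 ^ (d * (τ.length + 1)) := by rw [pow_mul]
          _ ≤ 2 ^ b := Nat.pow_le_pow_right (by norm_num)
            ((Nat.mul_le_mul_left _ (by omega)).trans hdL)
      rw [show Prog.run _ (Function.update t₁ 17 y) = Function.update (Function.update t₁ 17 y) 10
          (encodeTable (2 ^ H.j) (H.q * H.q) ((e.eval s % 2 ^ H.j, y) :: τ)) by
        simp [Prog.run, Expr.eval, Op.eval, encodeTable, v14, hregs, w₁.2.1]] at r₂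
      set t₂ := Function.update (Function.update t₁ 17 y) 10
          (encodeTable (2 ^ H.j) (H.q * H.q) ((e.eval s % 2 ^ H.j, y) :: τ)) with ht₂
      have f₂ : Frame [17, 10] t₁ t₂ := ((Frame.refl _ _).update (by simp) _).update (by simp) _
      have w₂ : H.Inv b ((e.eval s % 2 ^ H.j, y) :: τ) t₂ :=
        ⟨w₁.1.frame f₂ (by simp), by simp [ht₂], hval, bU.update henc⟩
      obtain ⟨t', hs', hW', θ₂, hθ₂, r₃⟩ := hrespond (i := i) (e := e) (t := t₂) (y := y)
        ((hs.frame f₁ hsub1).frame f₂ (by simp [workRegs])) w₂ (x := e.eval s)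
        (by simp [ht₂, v13]) (by simp [ht₂]) rfl
      exact ⟨t₂, t', θ₁, θ₂, fun _ => ⟨hs', hW', hθ₁, hθ₂, r₂, r₃⟩⟩
    choose t₂ t' θ₁ θ₂ hkey using key
    have hc := h₃ b t₁ w₁.2.2.2
    have hc12 : Expr.cost (.reg 12) t₁ ≤ b + 1 := by
      simpa [Expr.cost] using w₁.2.2.2 12 (by norm_num)
    have hDle : K₁ * (b + 1) ^ 2 + (K₃ * (b + 1) + 1 + (b + 1 + 1 + K₄ * (b + 1)) +
        K₂ * (b + 1) ^ 3) ≤ (K₁ + K₂ + K₃ + K₄ + 4) * (b + 1) ^ 3 := by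
      calc _ ≤ K₁ * (b + 1) ^ 3 + ((K₃ * (b + 1) ^ 3 + (b + 1) ^ 3 + ((b + 1) ^ 3 + (b + 1) ^ 3 +
            K₄ * (b + 1) ^ 3)) + K₂ * (b + 1) ^ 3) := by gcongr <;> omega
        _ = (K₁ + K₂ + K₃ + K₄ + 3) * (b + 1) ^ 3 := by ring
        _ ≤ _ := by gcongr; omega
    refine ⟨t', fun y => u₁ + ((Expr.cost (.bin .eq (.reg 17) (.reg 12)) t₁ + 1 +
      ((Expr.cost (.reg 12) t₁ + 1) + θ₁ y)) + θ₂ y), fun y hy => ?_, fun O F hF φ => ?_⟩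
    · obtain ⟨k1, k2, k3, k4, -⟩ := hkey y hy
      refine ⟨k1, k2, ?_⟩
      beta_reduce
      omega
    · rw [queryProg, wp_seq, r₁ O F (by omega), wp_seq, sampleProg, wp_cond,
        if_neg (by simp [Expr.eval, Op.eval, v17, h12]), wp_seq, wp_rand]
      rw [show Expr.eval (.reg 12) t₁ = H.q * H.q from h12]
      refine mean_mono_support fun y hy => ?_
      have hyM : y < H.q * H.q := by have := mem_support_uniformBelow hy; omega
      obtain ⟨k1, k2, k3, k4, k5, k6⟩ := hkey y hyM
      rw [k5 O F (by omega), k6 O F (by omega)]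

/-! ## The distinguisher for Diffie-Hellman tuples -/

/-- Registers 5, 6, 7 become `p / 2`, the bit length `n` of `p`, and `2 ^ n`. -/
def sizeProg : Prog :=
  .seq (.seq (.assign 5 (.bin .div (.reg 0) (.const 2)))
    (.seq (.assign 15 (.reg 0)) (.seq (.assign 6 (.const 0)) (.assign 7 (.const 1))))) sizeLoop

theorem sizeProg_runs : ∃ K, ∀ b s, Bd b s → (s 0).size + 1 ≤ b →
    ∃ s', Runs sizeProg s s' (K * (b + 1) ^ 2) ∧ s' 5 = s 0 / 2 ∧ s' 6 = (s 0).size ∧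
      s' 7 = 2 ^ (s 0).size ∧ Bd b s' ∧ Frame [5, 6, 7, 15] s s' := by
  obtain ⟨K₁, h₁⟩ := (show Prog.Straight (.seq (.assign 5 (.bin .div (.reg 0) (.const 2)))
    (.seq (.assign 15 (.reg 0)) (.seq (.assign 6 (.const 0)) (.assign 7 (.const 1)))))
    by simp [Prog.Straight, Expr.Work, workRegs]).runs
  obtain ⟨K₂, h₂⟩ := sizeLoop_runs
  refine ⟨K₁ + K₂, fun b s hb hs => ?_⟩
  obtain ⟨r₁, -⟩ := h₁ b s hb
  rw [show Prog.run _ s = Function.update (Function.update (Function.update (Function.update s 5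
    (s 0 / 2)) 15 (s 0)) 6 0) 7 1 by simp [Prog.run, Expr.eval, Op.eval]] at r₁
  set t := Function.update (Function.update (Function.update (Function.update s 5
    (s 0 / 2)) 15 (s 0)) 6 0) 7 1 with ht
  have f₁ : Frame [5, 6, 7, 15] s t := ((((Frame.refl _ _).update (by simp) _).update (by simp)
    _).update (by simp) _).update (by simp) _
  have b₁ : Bd b t := by
    refine (((hb.update ?_).update (hb 0 (by norm_num))).update (by simp)).update ?_
    · exact size_le_of_le (Nat.div_le_self _ _) (hb 0 (by norm_num))
    · rw [Nat.size_one]; omega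
  have t15 : t 15 = s 0 := by simp [ht]
  obtain ⟨s', r₂, v6, v7, b₂, f₂⟩ := h₂ b t b₁ (by rw [t15]; exact hs) (by simp [ht])
    (by simp [ht])
  rw [t15] at v6 v7
  refine ⟨s', (r₁.seq r₂).mono ?_, ?_, v6, v7, b₂, f₁.trans fun i hi =>
    f₂ i (by simp at hi ⊢; omega)⟩
  · have e1 : b + 1 ≤ (b + 1) ^ 2 := Nat.le_self_pow (by norm_num) _
    calc _ ≤ K₁ * (b + 1) ^ 2 + K₂ * (b + 1) ^ 2 := by gcongr
      _ = _ := by ring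
  · rw [f₂ 5 (by simp)]; simp [ht]

/-- Prepare the simulation for the level `j` in register 8. -/
def setupProg : Prog :=
  .seq (.seq (.assign 9 (.const 1)) (.assign 15 (.reg 8)))
    (.seq powTwoLoop (.seq
      (.seq (.assign 12 (.bin .mul (.reg 5) (.reg 5)))
        (.assign 11 (.bin .add (.bin .mul (.reg 9) (.reg 12)) (.const 1))))
      (.seq (.assign workRegs (.reg 0)) (.seq (.assign (1 + workRegs) (.reg 1))
        (.assign (2 + workRegs) (.reg 2))))))

/-- The simulated program finds `p, g, h` in its first three registers and zeros elsewhere, exactly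
its own initial store; `v` and `w` remain hidden in the working registers. -/
theorem setupProg_runs : ∃ K, ∀ (H : Hybrid) b s, s 0 = H.p → s 1 = H.g → s 2 = H.h → s 3 = H.v →
    s 4 = H.w → s 5 = H.q → s 6 = H.n → s 7 = 2 ^ H.n → s 8 = H.j → s 10 = 0 →
    (∀ i, s (i + workRegs) = 0) → Bd b s → H.j + 1 ≤ b →
    (2 ^ H.j * (H.q * H.q) + 1).size ≤ b →
    ∃ s', Runs setupProg s s' (K * (b + 1) ^ 2) ∧ Shifted (load [H.p, H.g, H.h]) s' ∧
      H.Inv b [] s' := by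
  obtain ⟨K₁, h₁⟩ := (show Prog.Straight (.seq (.assign 9 (.const 1)) (.assign 15 (.reg 8)))
    by simp [Prog.Straight, Expr.Work, workRegs]).runs
  obtain ⟨K₂, h₂⟩ := powTwoLoop_runs
  obtain ⟨K₃, h₃⟩ := (show Prog.Straight (.seq (.assign 12 (.bin .mul (.reg 5) (.reg 5)))
        (.assign 11 (.bin .add (.bin .mul (.reg 9) (.reg 12)) (.const 1))))
    by simp [Prog.Straight, Expr.Work, workRegs]).runs
  refine ⟨K₁ + K₂ + K₃ + 6, fun H b s h0 h1 h2 h3 h4 h5 h6 h7 h8 h10 hz hb hj hsz => ?_⟩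
  obtain ⟨r₁, -⟩ := h₁ b s hb
  rw [show Prog.run _ s = Function.update (Function.update s 9 1) 15 H.j by
    simp [Prog.run, Expr.eval, h8]] at r₁
  set t := Function.update (Function.update s 9 1) 15 H.j with ht
  have b₁ : Bd b t := (hb.update (by rw [Nat.size_one]; omega)).update
    (size_le_of_self_le (by omega))
  obtain ⟨t₂, r₂, v9, b₂, f₂⟩ := h₂ b t b₁ (by simpa [ht] using hj) (by simp [ht])
  have f₂' : Frame [9, 15] s t₂ := fun i hi => by
    rw [f₂ i (by simp at hi ⊢; omega)]
    exact (((Frame.refl [9, 15] s).update (by simp) _).update (by simp) _) i hi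
  have t9 : t₂ 9 = 2 ^ H.j := by rw [v9]; simp [ht]
  obtain ⟨r₃, -⟩ := h₃ b t₂ b₂
  have t5 : t₂ 5 = H.q := (f₂' 5 (by simp)).trans h5
  rw [show Prog.run _ t₂ = Function.update (Function.update t₂ 12 (H.q * H.q)) 11
    (2 ^ H.j * (H.q * H.q) + 1) by simp [Prog.run, Expr.eval, Op.eval, t5, t9]] at r₃
  set t₃ := Function.update (Function.update t₂ 12 (H.q * H.q)) 11
    (2 ^ H.j * (H.q * H.q) + 1) with ht₃
  have hsz' : (H.q * H.q).size ≤ b := by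
    refine size_le_of_le ?_ hsz
    have := Nat.le_mul_of_pos_left (H.q * H.q) (show 0 < 2 ^ H.j by positivity)
    omega
  have b₃ : Bd b t₃ := (b₂.update hsz').update hsz
  have f₃ : Frame [9, 11, 12, 15] s t₃ := by
    have : Frame [9, 11, 12, 15] s t₂ := fun i hi => f₂' i (by simp at hi ⊢; omega)
    exact (this.update (by simp) _).update (by simp) _
  have r₄ := (Runs.assign workRegs (.reg 0) t₃).seq ((Runs.assign (1 + workRegs) (.reg 1) _).seq
    (Runs.assign (2 + workRegs) (.reg 2) _))
  have e0 : t₃ 0 = H.p := (f₃ 0 (by simp)).trans h0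
  have e1 : t₃ 1 = H.g := (f₃ 1 (by simp)).trans h1
  have e2 : t₃ 2 = H.h := (f₃ 2 (by simp)).trans h2
  have g0 := b₃ 0 (by norm_num)
  have g1 := b₃ 1 (by norm_num)
  have g2 := b₃ 2 (by norm_num)
  rw [e0] at g0
  rw [e1] at g1
  rw [e2] at g2
  simp only [Expr.eval, Expr.cost, workRegs, e0, e1, e2, Function.update_of_ne, ne_eq,
    Nat.reduceAdd, Nat.reduceEqDiff, not_false_eq_true,
    OfNat.one_ne_ofNat] at r₄
  refine ⟨_, (r₁.seq (r₂.seq (r₃.seq r₄))).mono ?_, ?_, ?_⟩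
  · have e1 : b + 1 ≤ (b + 1) ^ 2 := Nat.le_self_pow (by norm_num) _
    calc _ ≤ K₁ * (b + 1) ^ 2 + (K₂ * (b + 1) ^ 2 + (K₃ * (b + 1) ^ 2 + 6 * (b + 1) ^ 2)) := by
          gcongr; omega
      _ = _ := by ring
  · intro i
    rcases i with _ | _ | _ | i
    · simp [load, workRegs]
    · simp [load, workRegs]
    · simp [load, workRegs]
    · simp only [Function.update_apply, workRegs]
      rw [if_neg (by omega), if_neg (by omega), if_neg (by omega), f₃ _ (by simp), hz]
      simp [load]
  · have hf : ∀ i < workRegs, Function.update (Function.update (Function.update t₃ 25 H.p) 26 H.g)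
        27 H.h i = t₃ i := fun i hi => by
      simp only [workRegs] at hi
      rw [Function.update_of_ne (by omega), Function.update_of_ne (by omega),
        Function.update_of_ne (by omega)]
    have hr : H.Regs t₃ := by
      refine ⟨e0, e1, e2, (f₃ 3 (by simp)).trans h3, (f₃ 4 (by simp)).trans h4,
        (f₃ 5 (by simp)).trans h5, (f₃ 6 (by simp)).trans h6, (f₃ 7 (by simp)).trans h7,
        (f₃ 8 (by simp)).trans h8, by simp [ht₃, t9], by simp [ht₃], by simp [ht₃]⟩
    refine ⟨hr.congr fun i hi _ => hf i (by simp only [workRegs]; omega), ?_, by simp [ValidTable], ?_⟩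
    · rw [hf 10 (by norm_num), f₃ 10 (by simp), h10]; rfl
    · exact fun i hi => by rw [hf i hi]; exact b₃ i hi

/-- Run `A` with the oracle of a random hybrid, built from the tuple `(p, g, h, v, w)`. -/
def distinguisher (A : Prog) : Prog :=
  .seq sizeProg (.seq (.rand 8 (.reg 6)) (.seq setupProg (.seq (A.simulate queryProg)
    (.assign 0 (.bin .eq (.reg workRegs) (.const 1))))))

/-- The oracle of the hybrid with random function `f`. -/
def Hybrid.oracle (H : Hybrid) (f : Fin (2 ^ H.j) → Fin (H.q * H.q - 1 + 1)) : ℕ → ℕ :=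
  fun x => H.answer x (f ⟨x % 2 ^ H.j, Nat.mod_lt _ (by positivity)⟩)

/-- A hybrid has table entries of at most `3 * n + 1` bits, and `T` steps create at most `T`
entries; this explains `b`. Cubic cost for each of the `T` steps gives the fourth power. The
proposition `β` covers acceptance and rejection at once. -/
theorem distinguisher_ge : ∃ K, ∀ (A : Prog) (H : Hybrid) (T : ℕ) (β : Prop), H.Ok →
    H.n = H.p.size → ∃ b, b = (3 * H.n + 1) * (T + 1) + 1 ∧
    mean (uniformBelow H.n) (fun j => mean (PMF.uniformOfFintype
        (Fin (2 ^ j) → Fin (H.q * H.q - 1 + 1))) fun f =>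
        wp (Hybrid.oracle { H with j := j } f) T A (load [H.p, H.g, H.h])
          fun s t => ind (t ≤ T ∧ (s 0 = 1 ↔ β))) ≤
      wp noOracle (K * (b + 1) ^ 4) (distinguisher A) (load [H.p, H.g, H.h, H.v, H.w])
        fun s t => ind (t ≤ K * (b + 1) ^ 4 ∧ (s 0 = 1 ↔ β)) := by
  obtain ⟨K₁, h₁⟩ := sizeProg_runs
  obtain ⟨K₂, h₂⟩ := setupProg_runs
  obtain ⟨K₃, hK₃, h₃⟩ := Hybrid.answersQueries
  refine ⟨K₁ + K₂ + 2 * K₃ + 8, fun A H T β hH hn => ⟨_, rfl, ?_⟩⟩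
  set b := (3 * H.n + 1) * (T + 1) + 1 with hb_def
  set F := (K₁ + K₂ + 2 * K₃ + 8) * (b + 1) ^ 4 with hF
  have hTb : T ≤ b := by nlinarith
  have hnb : H.n + 1 ≤ b := by nlinarith
  have hdb : 3 * H.n + 1 ≤ b := by nlinarith
  have hdT : (3 * H.n + 1) * T ≤ b := by nlinarith
  have e1 : b + 1 ≤ (b + 1) ^ 4 := Nat.le_self_pow (by norm_num) _
  have e2 : (b + 1) ^ 2 ≤ (b + 1) ^ 4 := Nat.pow_le_pow_right (by omega) (by norm_num)
  have e3 : (b + 1) ^ 3 ≤ (b + 1) ^ 4 := Nat.pow_le_pow_right (by omega) (by norm_num)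
  have eD : K₃ * (b + 1) ^ 3 * T ≤ K₃ * (b + 1) ^ 4 := by
    rw [pow_succ _ 3, mul_assoc]; gcongr; omega
  have eF : K₁ * (b + 1) ^ 2 + K₂ * (b + 1) ^ 2 + 2 * (K₃ * (b + 1) ^ 4) + 8 * (b + 1) ≤ F := by
    calc _ ≤ K₁ * (b + 1) ^ 4 + K₂ * (b + 1) ^ 4 + 2 * (K₃ * (b + 1) ^ 4) + 8 * (b + 1) ^ 4 := by
          gcongr
      _ = F := by rw [hF]; ring
  have hDF : K₃ * (b + 1) ^ 3 ≤ F := by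
    have : K₃ * (b + 1) ^ 3 ≤ K₃ * (b + 1) ^ 4 := by gcongr
    omega
  have hp : H.p.size ≤ b := by omega
  have hlt : ∀ {x}, x < H.p → x.size ≤ b := fun h => size_le_of_le h.le hp
  have hload : ∀ i, (load [H.p, H.g, H.h, H.v, H.w] i).size ≤ b := by
    intro i
    rcases i with _ | _ | _ | _ | _ | i
    · exact hp
    · exact hlt hH.g_lt
    · exact hlt hH.h_lt
    · exact hlt hH.v_lt
    · exact hlt hH.w_lt
    · simp [load]
  obtain ⟨s₁, ⟨t₁, ht₁, r₁⟩, v5, v6, v7, b₁, f₁⟩ := h₁ b (load [H.p, H.g, H.h, H.v, H.w])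
    (fun i _ => hload i) (by change H.p.size + 1 ≤ b; omega)
  change s₁ 5 = H.q at v5
  change s₁ 6 = H.p.size at v6
  change s₁ 7 = 2 ^ H.p.size at v7
  rw [← hn] at v6 v7
  rw [distinguisher, wp_seq, r₁ _ _ (by omega), wp_seq, wp_rand,
    show Expr.eval (.reg 6) s₁ = H.n from v6]
  refine mean_mono_support fun j hj => ?_
  have hnpos : 0 < H.n := by
    rw [hn, Nat.size_pos]; have := hH.one_lt; omega
  have hjn : j < H.n := by have := mem_support_uniformBelow hj; omega
  set Hj : Hybrid := { H with j := j } with hHj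
  have hOk : Hj.Ok := ⟨hH.g_lt, hH.h_lt, hH.v_lt, hH.w_lt, hH.q_pos⟩
  -- The three factors `2 ^ j`, `q`, `q` are each at most `2 ^ n`.
  have hd : 2 ^ j * (H.q * H.q) + 1 < 2 ^ (3 * H.n + 1) := by
    have h1 : H.q < 2 ^ H.n := by
      rw [hn]; exact hH.q_le.trans_lt (Nat.lt_size_self _)
    have h2 : 2 ^ j ≤ 2 ^ H.n := Nat.pow_le_pow_right (by norm_num) hjn.le
    have h3 : 2 ^ j * (H.q * H.q) ≤ 2 ^ H.n * (2 ^ H.n * 2 ^ H.n) := by gcongr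
    have h4 : 2 ^ (3 * H.n + 1) = 2 * (2 ^ H.n * (2 ^ H.n * 2 ^ H.n)) := by ring
    have h5 : 2 ≤ 2 ^ H.n := Nat.le_self_pow (by omega) 2
    have h6 : 2 * (1 * 1) ≤ 2 ^ H.n * (2 ^ H.n * 2 ^ H.n) := by gcongr <;> omega
    omega
  set s₂ := Function.update s₁ 8 j with hs₂
  have b₂ : Bd b s₂ := b₁.update (size_le_of_self_le (by omega))
  have f₂ : Frame [5, 6, 7, 8, 15] (load [H.p, H.g, H.h, H.v, H.w]) s₂ := by
    have : Frame [5, 6, 7, 8, 15] (load [H.p, H.g, H.h, H.v, H.w]) s₁ := fun i hi =>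
      f₁ i (by simp at hi ⊢; omega)
    exact this.update (by simp) _
  obtain ⟨s₃, ⟨t₃, ht₃, r₃⟩, hS, hI⟩ := h₂ Hj b s₂ (f₂ 0 (by simp)) (f₂ 1 (by simp))
    (f₂ 2 (by simp)) (f₂ 3 (by simp)) (f₂ 4 (by simp)) (by simpa [hs₂, hHj, Hybrid.q] using v5)
    (by simpa [hs₂] using v6) (by simpa [hs₂] using v7) (by simp [hs₂, hHj]) (f₂ 10 (by simp))
    (fun i => (f₂ _ (by simp [workRegs])).trans (by simp [load, workRegs])) b₂
    (by simp only [hHj]; omega) (by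
      refine (Nat.size_le.2 ?_).trans hdb
      exact hd)
  have hQ := h₃ Hj b T (3 * H.n + 1) hOk (by simp only [hHj]; omega) hTb hd.le hdT
  have hcost : Expr.cost (.reg 6) s₁ ≤ b + 1 := by
    simpa [Expr.cost] using b₁ 6 (by norm_num)
  rw [wp_seq, r₃ _ _ (by omega), wp_seq]
  -- Replaces the random function drawn in advance by lazy sampling, which the program can carry
  -- out.
  have hlazy := lazyWp_nil (M := Hj.q * Hj.q) Hj.answer T (K := 2 ^ j)
    (key := fun x => x % 2 ^ j) (fun x => Nat.mod_lt _ (by positivity)) A (load [H.p, H.g, H.h])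
    (fun s t => ind (t ≤ T ∧ (s 0 = 1 ↔ β)))
  refine hlazy.symm.trans_le ?_
  have hM : 0 < Hj.q * Hj.q := Nat.mul_pos hOk.q_pos hOk.q_pos
  refine (hQ.le_wp hM (by positivity) (O := noOracle) (F := T) (F' := F) (by omega) hDF A _ [] s₃ T _
    (fun s t => ind (t ≤ K₃ * (b + 1) ^ 3 * T ∧ (s workRegs = 1 ↔ β))) hS hI (by simp)
    (fun s τ t ht => ind_false (by omega)) fun u τ u' t t' hu _ _ ht ht' => ?_).trans ?_
  · refine ind_mono fun ⟨_, h⟩ => ⟨ht'.trans (by gcongr), ?_⟩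
    rw [← h, show u' workRegs = u 0 from hu 0 ▸ by simp]
  · have hsz : ∀ i, (s₃ i).size ≤ b := by
      intro i
      by_cases hi : i < workRegs
      · exact hI.2.2.2 i hi
      · obtain ⟨k, rfl⟩ : ∃ k, i = k + workRegs := ⟨i - workRegs, by omega⟩
        rw [hS k]
        have := hload k
        rcases k with _ | _ | _ | k
        · exact this
        · exact this
        · exact this
        · simp [load]
    -- The cost of the final test depends on the output of `A`, whose bit length is bounded by `b`
    -- plus the time elapsed.
    refine wp_mono_size hsz fun u t hu => ?_
    rw [wp_assign]
    refine ind_mono fun ⟨ht, h⟩ => ⟨?_, ?_⟩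
    · have h25 := hu workRegs
      have : Expr.cost (.bin .eq (.reg workRegs) (.const 1)) u ≤ b + t + 5 := by
        have h1 : Nat.size 1 = 1 := Nat.size_one
        have h2 : (Op.eval .eq (u workRegs) 1).size ≤ 1 := by
          by_cases hu1 : u workRegs = 1 <;> simp [Op.eval, hu1]
        simp only [Expr.cost, Expr.eval]
        omega
      omega
    · rw [← h]
      by_cases hu1 : u workRegs = 1 <;> simp [Expr.eval, Op.eval, hu1]

/-- Lower bounds for two disjoint events are sharp if they already add up to one. -/
theorem eq_of_le_of_add_eq_one {a b a' b' : ENNReal} (ha : a ≤ a') (hb : b ≤ b')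
    (h : a + b = 1) (h' : a' + b' ≤ 1) : a = a' ∧ a' + b' = 1 := by
  have h1 : a' + b' = 1 := le_antisymm h' (h ▸ add_le_add ha hb)
  refine ⟨le_antisymm ha ?_, h1⟩
  have hb' : b' ≠ ⊤ := fun h => by simp [h] at h1
  rw [← ENNReal.add_le_add_iff_right hb', h1, ← h]
  gcongr

theorem range_map_singleton {s : Store} : (List.range [1].length).map s = [1] ↔ s 0 = 1 := by
  simp

theorem wp_ind_add_ind_not (O : ℕ → ℕ) (F : ℕ) (c : Prog) (s : Store) (T : ℕ) :
    wp O F c s (fun s t => ind (t ≤ T ∧ (s 0 = 1 ↔ True))) +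
      wp O F c s (fun s t => ind (t ≤ T ∧ (s 0 = 1 ↔ False))) =
      wp O F c s (fun _ t => ind (t ≤ T)) := by
  rw [← wp_add]
  congr 1; ext s t
  by_cases ht : t ≤ T <;> by_cases hs : s 0 = 1 <;> simp [ind, ht, hs]

/-- The distinguisher runs in polynomial time, and its acceptance probability is the average of those
of `A` with the oracles of the hybrids. -/
theorem distinguisher_spec : ∃ K, ∀ (A : Prog) (H : Hybrid) (T : ℕ), H.Ok →
    H.n = H.p.size →
    (∀ j < H.n, ∀ f, ∃ F, wp (Hybrid.oracle { H with j := j } f) F A (load [H.p, H.g, H.h])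
      (fun _ t => ind (t ≤ T)) = 1) →
    (∃ F, wp noOracle F (distinguisher A) (load [H.p, H.g, H.h, H.v, H.w])
      (fun _ t => ind (t ≤ K * ((3 * H.n + 1) * (T + 1) + 2) ^ 4)) = 1) ∧
    outProb (distinguisher A) noOracle [H.p, H.g, H.h, H.v, H.w] [1] =
      mean (uniformBelow H.n) fun j =>
        mean (PMF.uniformOfFintype (Fin (2 ^ j) → Fin (H.q * H.q - 1 + 1))) fun f =>
          outProb A (Hybrid.oracle { H with j := j } f) [H.p, H.g, H.h] [1] := by
  obtain ⟨K, hK⟩ := distinguisher_ge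
  refine ⟨K, fun A H T hH hn hA => ?_⟩
  obtain ⟨b, hb, h1⟩ := hK A H T True hH hn
  obtain ⟨b', hb', h2⟩ := hK A H T False hH hn
  obtain rfl : b = b' := hb.trans hb'.symm
  have hnpos : 0 < H.n := by
    rw [hn, Nat.size_pos]; have := hH.one_lt; omega
  -- The lower bounds for acceptance and rejection add up to one because `A` halts with every hybrid
  -- oracle. This yields both the acceptance probability and the halting of the distinguisher.
  obtain ⟨h3, h4⟩ := eq_of_le_of_add_eq_one h1 h2 (by
      rw [← mean_add, ← mean_const (uniformBelow H.n) 1]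
      refine mean_congr_support fun j hj => ?_
      have hjn : j < H.n := by have := mem_support_uniformBelow hj; omega
      rw [← mean_add, ← mean_const (PMF.uniformOfFintype
        (Fin (2 ^ j) → Fin (H.q * H.q - 1 + 1))) 1]
      refine mean_congr_support fun f _ => ?_
      obtain ⟨F, hF⟩ := hA j hjn f
      rw [wp_ind_add_ind_not, wp_halts_of_le hF le_rfl])
    (by rw [wp_ind_add_ind_not]; exact wp_le_one fun _ _ => ind_le_one _)
  rw [wp_ind_add_ind_not] at h4
  refine ⟨⟨K * (b + 1) ^ 4, ?_⟩, ?_⟩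
  · rw [show (3 * H.n + 1) * (T + 1) + 2 = b + 1 by omega]
    exact h4
  · rw [outProb_of_halts h4 le_rfl]
    simp only [range_map_singleton]
    simp only [iff_true] at h3
    rw [← h3]
    refine mean_congr_support fun j hj => mean_congr_support fun f _ => ?_
    have hjn : j < H.n := by have := mem_support_uniformBelow hj; omega
    obtain ⟨F, hF⟩ := hA j hjn f
    rw [outProb_of_halts hF le_rfl]
    simp only [range_map_singleton]

/-! ## Quadratic residues -/

theorem rep_lt {p : ℕ} [NeZero p] (y : QR p) : rep y < p := ZMod.val_lt _

theorem rep_injective {p : ℕ} [NeZero p] : Function.Injective (rep : QR p → ℕ) := fun _ _ h =>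
  Subtype.ext (Units.ext (ZMod.val_injective _ h))

theorem rep_mul {p : ℕ} (y z : QR p) : rep (y * z) = rep y * rep z % p := by
  simp [rep, ZMod.val_mul]

theorem rep_pow {p : ℕ} (y : QR p) (k : ℕ) : rep (y ^ k) = rep y ^ k % p := by
  induction k with
  | zero => simp [rep, ZMod.val_one_eq_one_mod]
  | succ k ih => rw [pow_succ, rep_mul, ih, pow_succ, Nat.mod_mul_mod]

theorem rep_pos {p : ℕ} [Fact (1 < p)] (y : QR p) : 0 < rep y := by
  rw [Nat.pos_iff_ne_zero]
  intro h
  have h0 : ((y : (ZMod p)ˣ) : ZMod p) = 0 := (ZMod.val_eq_zero _).1 h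
  exact (y : (ZMod p)ˣ).ne_zero h0

theorem fold_val {p : ℕ} (y : QR p) : (fold y).val = foldN p (p / 2) (rep y) := by
  unfold fold foldN
  by_cases h : rep y ≤ p / 2
  · rw [if_pos h, if_neg (by omega), ZMod.val_natCast]
  · rw [if_neg h, if_pos (by omega), ZMod.val_natCast]

namespace QRInstance

variable (G : QRInstance)

instance : Fact G.p.Prime := ⟨G.safe.1⟩

instance : Fact G.q.Prime := ⟨G.q_prime⟩

theorem p_eq : G.p = 2 * G.q + 1 := by
  obtain ⟨_, q, _, h⟩ := G.safe
  unfold QRInstance.q; omega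

instance : Fact (1 < G.p) := ⟨G.safe.1.one_lt⟩

theorem pow_q (y : QR G.p) : y ^ G.q = 1 := by
  obtain ⟨_, x, rfl⟩ := y
  apply Subtype.ext
  have : (x ^ 2) ^ G.q = 1 := by
    rw [← pow_mul, ← ZMod.units_pow_card_sub_one_eq_one G.p x]
    congr 1
    have := G.p_eq
    omega
  simpa using this

/-- The order divides the prime `q`. If it were one, the group would be trivial; but `4 = 2 ^ 2` is
a residue, and `4 = 1` would make the prime `p ≥ 5` divide `3`. -/
theorem orderOf_g : orderOf G.g = G.q := by
  have hdvd : orderOf G.g ∣ G.q := orderOf_dvd_of_pow_eq_one (G.pow_q _)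
  rcases (Nat.dvd_prime G.q_prime).1 hdvd with h | h
  · exfalso
    have hg : G.g = 1 := orderOf_eq_one_iff.1 h
    have hone : ∀ y : QR G.p, y = 1 := fun y => by
      obtain ⟨k, hk⟩ := Subgroup.mem_zpowers_iff.1 (G.generates y)
      rw [← hk, hg, one_zpow]
    have hp := G.p_eq
    have hq := G.q_prime.two_le
    have h2 : (2 : ZMod G.p) ≠ 0 := by
      intro h
      have : ((2 : ℕ) : ZMod G.p) = 0 := by exact_mod_cast h
      rw [ZMod.natCast_eq_zero_iff] at this
      have := Nat.le_of_dvd (by norm_num) this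
      omega
    have h4 := hone ⟨Units.mk0 2 h2 ^ 2, Units.mk0 2 h2, rfl⟩
    have h5 : (2 : ZMod G.p) ^ 2 = 1 := by
      simpa using congrArg (fun y : QR G.p => ((y : (ZMod G.p)ˣ) : ZMod G.p)) h4
    have h3 : ((3 : ℕ) : ZMod G.p) = 0 := by
      push_cast
      linear_combination h5
    rw [ZMod.natCast_eq_zero_iff] at h3
    have := Nat.le_of_dvd (by norm_num) h3
    omega
  · exact h

theorem card_QR : Nat.card (QR G.p) = G.q := by
  rw [← G.orderOf_g, ← Nat.card_zpowers, Subgroup.eq_top_iff' _ |>.2 G.generates]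
  exact (Nat.card_congr Subgroup.topEquiv.toEquiv).symm

/-- The power of the generator with exponent in `ℤ_q`. -/
def gpow (a : ZMod G.q) : QR G.p := G.g ^ a.val

theorem gpow_natCast (k : ℕ) : G.gpow k = G.g ^ k := by
  rw [gpow, ZMod.val_natCast]
  conv_rhs => rw [← pow_mod_orderOf, G.orderOf_g]

theorem gpow_add (a b : ZMod G.q) : G.gpow (a + b) = G.gpow a * G.gpow b := by
  conv_lhs => rw [← ZMod.natCast_zmod_val a, ← ZMod.natCast_zmod_val b, ← Nat.cast_add,
    gpow_natCast, pow_add]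
  rfl

theorem gpow_pow (a : ZMod G.q) (k : ℕ) : G.gpow a ^ k = G.gpow (a * k) := by
  conv_rhs => rw [← ZMod.natCast_zmod_val a, ← Nat.cast_mul, gpow_natCast, pow_mul]
  rfl

theorem g_pow (k : ℕ) : G.g ^ k = G.gpow k := (G.gpow_natCast k).symm

theorem gpow_injective : Function.Injective G.gpow := fun a b h => by
  have h' : G.g ^ a.val = G.g ^ b.val := h
  rw [pow_inj_mod, G.orderOf_g, Nat.mod_eq_of_lt (ZMod.val_lt a),
    Nat.mod_eq_of_lt (ZMod.val_lt b)] at h'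
  exact ZMod.val_injective _ h'

theorem gpow_surjective : Function.Surjective G.gpow := by
  have : Fintype (QR G.p) := Fintype.ofFinite _
  exact ((Fintype.bijective_iff_injective_and_card G.gpow).2 ⟨G.gpow_injective, by
    rw [ZMod.card, ← Nat.card_eq_fintype_card, G.card_QR]⟩).surjective

/-- For odd `q`, the function `f_p` is injective, since `-1` is not a quadratic residue. -/
theorem fold_injective (hq : G.q ≠ 2) : Function.Injective (fold : QR G.p → ZMod (G.p / 2)) := by
  intro y z h
  have hp := G.p_eq
  have hq' : G.p / 2 = G.q := rfl
  have hval := congrArg ZMod.val h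
  rw [fold_val, fold_val, hq'] at hval
  have hy := rep_lt y
  have hz := rep_lt z
  have hy0 := rep_pos y
  have hz0 := rep_pos z
  -- The numbers from `1` to `q` are distinct modulo `q`, with `q` itself in the role of `0`.
  have hmod : ∀ a b, 0 < a → a ≤ G.q → 0 < b → b ≤ G.q → a % G.q = b % G.q → a = b := by
    intro a b ha ha' hb hb' hab
    rcases ha'.lt_or_eq with h1 | h1 <;> rcases hb'.lt_or_eq with h2 | h2
    · rwa [Nat.mod_eq_of_lt h1, Nat.mod_eq_of_lt h2] at hab
    · rw [h2, Nat.mod_self, Nat.mod_eq_of_lt h1] at hab; omega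
    · rw [h1, Nat.mod_self, Nat.mod_eq_of_lt h2] at hab; omega
    · omega
  -- Otherwise `y = -z`, and raising to the odd power `q` gives `1 = -1`.
  have hne : rep y + rep z ≠ G.p := by
    intro hsum
    have h1 : ((y : (ZMod G.p)ˣ) : ZMod G.p) = -((z : (ZMod G.p)ˣ) : ZMod G.p) := by
      rw [eq_neg_iff_add_eq_zero, ← ZMod.natCast_zmod_val ((y : (ZMod G.p)ˣ) : ZMod G.p),
        ← ZMod.natCast_zmod_val ((z : (ZMod G.p)ˣ) : ZMod G.p), ← Nat.cast_add]
      rw [show ((y : (ZMod G.p)ˣ) : ZMod G.p).val + ((z : (ZMod G.p)ˣ) : ZMod G.p).val = G.p from hsum,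
        ZMod.natCast_self]
    have hpow : ∀ x : QR G.p, ((x : (ZMod G.p)ˣ) : ZMod G.p) ^ G.q = 1 := fun x => by
      simpa using congrArg (fun y : QR G.p => ((y : (ZMod G.p)ˣ) : ZMod G.p)) (G.pow_q x)
    have hodd : Odd G.q := G.q_prime.odd_of_ne_two hq
    have h2 := hpow y
    rw [h1, hodd.neg_pow, hpow z] at h2
    have h3 : ((2 : ℕ) : ZMod G.p) = 0 := by
      push_cast
      linear_combination -h2
    rw [ZMod.natCast_eq_zero_iff] at h3
    have := Nat.le_of_dvd (by norm_num) h3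
    have := G.q_prime.two_le
    omega
  apply rep_injective
  unfold foldN at hval
  split_ifs at hval with h1 h2 h2
  · have := hmod _ _ (by omega) (by omega) (by omega) (by omega) hval; omega
  · have := hmod _ _ (by omega) (by omega) (by omega) (by omega) hval; omega
  · have := hmod _ _ (by omega) (by omega) (by omega) (by omega) hval; omega
  · exact hmod _ _ (by omega) (by omega) (by omega) (by omega) hval

end QRInstance

/-! ## The tree on representatives -/

section Tree

variable (G : QRInstance) (u : QR G.p)

theorem stepN_rep (x y : ℕ) :
    stepN G.p G.q (rep G.g) (rep u) x y =
      (fold ((if x % 2 = 0 then G.g else u) ^ y)).val := by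
  rw [fold_val, rep_pow, stepN]
  split_ifs <;> rfl

/-- The first input bit is the lowest binary digit, so dropping it is division by two. -/
theorem foldl_step_val (n : ℕ) : ∀ (x : ℕ) (b : ZMod G.q),
    ((List.ofFn fun j : Fin n => x.testBit j).foldl
      (fun c bit => GGMParam.step ⟨G, u⟩ bit c) b).val =
      stepsN G.p G.q (rep G.g) (rep u) n x b.val := by
  induction n with
  | zero => intro x b; rfl
  | succ n ih =>
    intro x b
    have h0 : (GGMParam.step ⟨G, u⟩ (x.testBit 0) b).val =
        (fold ((if x % 2 = 0 then G.g else u) ^ b.val)).val := by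
      simp only [GGMParam.step, modexp]
      by_cases h : x % 2 = 0
      · simp only [Nat.testBit_zero, h, if_true]; rfl
      · simp only [Nat.testBit_zero, Nat.mod_two_ne_zero.1 h, decide_true, if_true]; rfl
    rw [List.ofFn_succ, List.foldl_cons, stepsN, stepN_rep, ← h0, ← ih]
    simp [Nat.testBit_succ]

theorem F_val {n : ℕ} (b : ZMod G.q) (x : Fin n → Bool) :
    (GGMParam.F ⟨G, u⟩ b x).val =
      stepsN G.p G.q (rep G.g) (rep u) n (Nat.ofBits x) b.val := by
  rw [← foldl_step_val, GGMParam.F]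
  congr 3
  ext j
  simp

end Tree

/-! ## The hybrids -/

theorem card_filter_of_bijective {α β : Type} [Fintype α] [DecidableEq β] {φ : α → β}
    (h : Function.Bijective φ) (b : β) : (Finset.univ.filter fun a => φ a = b).card = 1 := by
  obtain ⟨a, ha⟩ := h.surjective b
  rw [Finset.card_eq_one]
  refine ⟨a, ?_⟩
  ext a'
  simp only [Finset.mem_filter, Finset.mem_univ, true_and, Finset.mem_singleton]
  exact ⟨fun h' => h.injective (h'.trans ha.symm), fun h' => h' ▸ ha⟩

theorem mean_uniform_bijective {α β : Type} [Fintype α] [Nonempty α] [Fintype β] [Nonempty β]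
    {φ : α → β} (h : Function.Bijective φ) (f : β → ENNReal) :
    mean (PMF.uniformOfFintype α) (fun a => f (φ a)) = mean (PMF.uniformOfFintype β) f :=
  mean_uniform_equiv (Equiv.ofBijective φ h) f

/-- A number below `q ^ 2` as a pair of elements of `ℤ_q`. -/
def splitIndex (q : ℕ) (r : Fin (q * q - 1 + 1)) : ZMod q × ZMod q :=
  ((r.val % q : ℕ), (r.val / q : ℕ))

theorem splitIndex_bijective (q : ℕ) [NeZero q] : Function.Bijective (splitIndex q) := by
  have hq : 0 < q := NeZero.pos q
  have hqq : 0 < q * q := Nat.mul_pos hq hq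
  rw [Fintype.bijective_iff_injective_and_card]
  constructor
  · intro r r' h
    simp only [splitIndex, Prod.mk.injEq] at h
    have hlt : ∀ r : Fin (q * q - 1 + 1), r.val / q < q := fun r => by
      rw [Nat.div_lt_iff_lt_mul hq]; omega
    have h1 := congrArg ZMod.val h.1
    have h2 := congrArg ZMod.val h.2
    rw [ZMod.val_cast_of_lt (Nat.mod_lt _ hq), ZMod.val_cast_of_lt (Nat.mod_lt _ hq)] at h1
    rw [ZMod.val_cast_of_lt (hlt r), ZMod.val_cast_of_lt (hlt r')] at h2
    apply Fin.ext
    rw [← Nat.mod_add_div r.val q, ← Nat.mod_add_div r'.val q, h1, h2]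
  · simp only [Fintype.card_fin, Fintype.card_prod, ZMod.card]; omega

section Hybrids

variable (G : QRInstance)

/-- The hybrid built from the tuple `(p, g, u, v, w)`. -/
def tupleHybrid (u v w : QR G.p) (n j : ℕ) : Hybrid :=
  { p := G.p, g := rep G.g, h := rep u, v := rep v, w := rep w, n := n, j := j }

theorem tupleHybrid_ok (u v w : QR G.p) (n j : ℕ) : (tupleHybrid G u v w n j).Ok :=
  ⟨rep_lt _, rep_lt _, rep_lt _, rep_lt _, G.q_prime.pos⟩

theorem tupleHybrid_child (u v w : QR G.p) (n j x r : ℕ) :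
    (tupleHybrid G u v w n j).child x r =
      (fold ((if x / 2 ^ j % 2 = 0 then v else w) ^ (r % G.q) *
        (if x / 2 ^ j % 2 = 0 then G.g else u) ^ (r / G.q))).val := by
  rw [fold_val, rep_mul, rep_pow, rep_pow, Nat.mul_mod_mod, Hybrid.child]
  by_cases h : x / 2 ^ j % 2 = 0
  · have h' : x / 2 ^ (tupleHybrid G u v w n j).j % 2 = 0 := h
    simp only [if_pos h, if_pos h']; rfl
  · have h' : ¬ x / 2 ^ (tupleHybrid G u v w n j).j % 2 = 0 := h
    simp only [if_neg h, if_neg h']; rfl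

/-- The oracle that applies a random function to the first `j` bits, and the tree to the other ones. -/
def treeOracle (u : QR G.p) (n j : ℕ) (f : Fin (2 ^ j) → ZMod G.q) : ℕ → ℕ := fun x =>
  if x < 2 ^ n then stepsN G.p G.q (rep G.g) (rep u) (n - j) (x / 2 ^ j)
    (f ⟨x % 2 ^ j, Nat.mod_lt _ (by positivity)⟩).val
  else 0

/-- The probability that `A` accepts with the oracle of the `j`-th hybrid. -/
def hybridProb (A : Prog) (u : QR G.p) (n j : ℕ) : ENNReal :=
  mean (PMF.uniformOfFintype (Fin (2 ^ j) → ZMod G.q)) fun f =>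
    outProb A (treeOracle G u n j f) [G.p, rep G.g, rep u] [1]

/-- For a Diffie-Hellman tuple, the distinguisher simulates the `j`-th hybrid. -/
theorem mean_tupleHybrid_real (A : Prog) (a b : ZMod G.q) {n j : ℕ} (hj : j < n) :
    mean (PMF.uniformOfFintype (Fin (2 ^ j) → Fin (G.q * G.q - 1 + 1))) (fun f =>
      outProb A ((tupleHybrid G (G.gpow a) (G.gpow b) (G.gpow (a * b)) n j).oracle f)
        [G.p, rep G.g, rep (G.gpow a)] [1]) = hybridProb G A (G.gpow a) n j := by
  -- Both children come from the single seed `b * s + r`: `v ^ s * g ^ r` is `g` to this power, and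
  -- `w ^ s * u ^ r` is `u` to this power, as `w = v ^ a`.
  have h1 : ∀ f : Fin (2 ^ j) → Fin (G.q * G.q - 1 + 1),
      (tupleHybrid G (G.gpow a) (G.gpow b) (G.gpow (a * b)) n j).oracle f =
        treeOracle G (G.gpow a) n j fun z => b * (splitIndex G.q (f z)).1 +
          (splitIndex G.q (f z)).2 := by
    intro f
    ext x
    unfold Hybrid.oracle Hybrid.answer treeOracle
    change (if x < 2 ^ n then stepsN G.p G.q (rep G.g) (rep (G.gpow a)) (n - j - 1)
      (x / 2 ^ j / 2) _ else 0) = _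
    congr 1
    rw [tupleHybrid_child]
    change (stepsN _ _ _ _ _ _ (fold ((if x / 2 ^ j % 2 = 0 then G.gpow b else G.gpow (a * b)) ^
      ((f ⟨x % 2 ^ j, Nat.mod_lt _ (by positivity)⟩).val % G.q) *
      (if x / 2 ^ j % 2 = 0 then G.g else G.gpow a) ^
      ((f ⟨x % 2 ^ j, Nat.mod_lt _ (by positivity)⟩).val / G.q))).val) = _
    obtain ⟨k, hk⟩ : ∃ k, n - j = k + 1 := ⟨n - j - 1, by omega⟩
    rw [hk, Nat.add_sub_cancel, stepsN, stepN_rep]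
    congr 2
    simp only [splitIndex]
    congr 1
    split_ifs
    · rw [G.g_pow, G.g_pow, G.gpow_pow, ← G.gpow_add, ZMod.natCast_zmod_val]
    · rw [G.gpow_pow, G.gpow_pow, G.gpow_pow, ← G.gpow_add, ZMod.natCast_zmod_val]
      congr 1; ring
  simp only [h1]
  rw [hybridProb, mean_uniform_fun_comp (splitIndex G.q) 1
    (card_filter_of_bijective (splitIndex_bijective G.q))
    (fun f => outProb A (treeOracle G (G.gpow a) n j fun z => b * (f z).1 + (f z).2)
      [G.p, rep G.g, rep (G.gpow a)] [1])]
  refine mean_uniform_fun_comp (fun x : ZMod G.q × ZMod G.q => b * x.1 + x.2) G.q (fun y => ?_)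
    fun f => outProb A (treeOracle G (G.gpow a) n j f) [G.p, rep G.g, rep (G.gpow a)] [1]
  -- For every `s` exactly one `r` gives the seed `y`, so the seed is uniform for every `b`,
  -- including `b = 0`.
  have : (Finset.univ.filter fun x : ZMod G.q × ZMod G.q => b * x.1 + x.2 = y) =
      Finset.univ.image fun s : ZMod G.q => (s, y - b * s) := by
    ext ⟨s, r⟩
    simp only [Finset.mem_filter, Finset.mem_univ, true_and, Finset.mem_image, Prod.mk.injEq]
    constructor
    · rintro rfl; exact ⟨s, rfl, by ring⟩
    · rintro ⟨s', rfl, rfl⟩; ring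
  rw [this, Finset.card_image_of_injective _ fun s s' h => (Prod.mk.inj h).1, Finset.card_univ,
    ZMod.card]

/-- A function of `j + 1` bits is a pair of functions of the first `j` bits, one for each value of
the last bit, which has weight `2 ^ j`. -/
theorem pairs_bijective (α : Type) [Fintype α] (j : ℕ) :
    Function.Bijective fun (f : Fin (2 ^ (j + 1)) → α) (z : Fin (2 ^ j)) =>
      (f ⟨z, by have := z.2; rw [pow_succ]; omega⟩,
        f ⟨z + 2 ^ j, by have := z.2; rw [pow_succ]; omega⟩) := by
  classical
  rw [Fintype.bijective_iff_injective_and_card]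
  constructor
  · intro f f' h
    ext y
    by_cases hy : y.val < 2 ^ j
    · exact (Prod.mk.inj (congrFun h ⟨y, hy⟩)).1
    · have hy2 := lt_of_lt_of_eq y.2 (pow_succ 2 j)
      have := (Prod.mk.inj (congrFun h ⟨y - 2 ^ j, by omega⟩)).2
      simp only at this
      convert this using 2 <;> (apply Fin.ext; simp only; omega)
  · simp only [Fintype.card_fun, Fintype.card_fin, Fintype.card_prod]
    rw [← sq, ← pow_mul, pow_succ, mul_comm]

/-- For other tuples, the distinguisher simulates the hybrid with number `j + 1`. -/
theorem mean_tupleHybrid_random (A : Prog) (hq : G.q ≠ 2) {a b c : ZMod G.q} (hc : c ≠ a * b)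
    (n j : ℕ) :
    mean (PMF.uniformOfFintype (Fin (2 ^ j) → Fin (G.q * G.q - 1 + 1))) (fun f =>
      outProb A ((tupleHybrid G (G.gpow a) (G.gpow b) (G.gpow c) n j).oracle f)
        [G.p, rep G.g, rep (G.gpow a)] [1]) = hybridProb G A (G.gpow a) n (j + 1) := by
  classical
  -- The two children as a function of the exponents `(s, r)`: a linear map of determinant `a * b -
  -- c`, followed by injective maps.
  let ψ : ZMod G.q × ZMod G.q → ZMod G.q × ZMod G.q := fun x =>
    (fold (G.gpow (b * x.1 + x.2)), fold (G.gpow (c * x.1 + a * x.2)))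
  have hψ : Function.Bijective ψ := by
    rw [Fintype.bijective_iff_injective_and_card]
    refine ⟨fun ⟨s, r⟩ ⟨s', r'⟩ h => ?_, rfl⟩
    obtain ⟨h1, h2⟩ := Prod.mk.inj h
    replace h1 := G.gpow_injective (G.fold_injective hq h1)
    replace h2 := G.gpow_injective (G.fold_injective hq h2)
    simp only at h1 h2
    -- Elimination of `r - r'`.
    have h3 : (c - a * b) * (s - s') = 0 := by linear_combination h2 - a * h1
    have hs : s = s' := by
      rcases mul_eq_zero.1 h3 with h | h
      · exact absurd (sub_eq_zero.1 h) hc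
      · exact sub_eq_zero.1 h
    subst hs
    rw [add_right_inj] at h1
    rw [h1]
  let O : (Fin (2 ^ j) → ZMod G.q × ZMod G.q) → ℕ → ℕ := fun f x =>
    if x < 2 ^ n then stepsN G.p G.q (rep G.g) (rep (G.gpow a)) (n - j - 1) (x / 2 ^ j / 2)
      (if x / 2 ^ j % 2 = 0 then (f ⟨x % 2 ^ j, Nat.mod_lt _ (by positivity)⟩).1.val
        else (f ⟨x % 2 ^ j, Nat.mod_lt _ (by positivity)⟩).2.val)
    else 0
  have h1 : ∀ f : Fin (2 ^ j) → Fin (G.q * G.q - 1 + 1),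
      (tupleHybrid G (G.gpow a) (G.gpow b) (G.gpow c) n j).oracle f =
        O fun z => ψ (splitIndex G.q (f z)) := by
    intro f
    ext x
    unfold Hybrid.oracle Hybrid.answer
    change (if x < 2 ^ n then stepsN G.p G.q (rep G.g) (rep (G.gpow a)) (n - j - 1)
      (x / 2 ^ j / 2) _ else 0) = if x < 2 ^ n then _ else 0
    congr 1
    rw [tupleHybrid_child]
    change (stepsN _ _ _ _ _ _ (fold ((if x / 2 ^ j % 2 = 0 then G.gpow b else G.gpow c) ^
      ((f ⟨x % 2 ^ j, Nat.mod_lt _ (by positivity)⟩).val % G.q) *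
      (if x / 2 ^ j % 2 = 0 then G.g else G.gpow a) ^
      ((f ⟨x % 2 ^ j, Nat.mod_lt _ (by positivity)⟩).val / G.q))).val) = _
    congr 1
    simp only [ψ, splitIndex]
    split_ifs
    · rw [G.g_pow, G.gpow_pow, ← G.gpow_add]; rfl
    · rw [G.gpow_pow, G.gpow_pow, ← G.gpow_add]; rfl
  simp only [h1]
  rw [hybridProb, mean_uniform_fun_comp (splitIndex G.q) 1
    (card_filter_of_bijective (splitIndex_bijective G.q))
    (fun f => outProb A (O fun z => ψ (f z)) [G.p, rep G.g, rep (G.gpow a)] [1]),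
    mean_uniform_fun_comp ψ 1 (card_filter_of_bijective hψ)
    (fun f => outProb A (O f) [G.p, rep G.g, rep (G.gpow a)] [1]),
    ← mean_uniform_bijective (pairs_bijective (ZMod G.q) j)]
  congr 1
  ext f
  congr 1
  ext x
  simp only [O, treeOracle]
  congr 1
  rw [show n - (j + 1) = n - j - 1 by omega,
    show x / 2 ^ (j + 1) = x / 2 ^ j / 2 by rw [pow_succ, Nat.div_div_eq_div_mul]]
  congr 1
  -- Bit number `j` selects between the points `z` and `z + 2 ^ j`, as in `pairs_bijective`.
  have hm : x % 2 ^ (j + 1) = x % 2 ^ j + 2 ^ j * (x / 2 ^ j % 2) := Nat.mod_pow_succ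
  split_ifs with h
  · congr 2
    apply Fin.ext
    simp only [hm, h]; omega
  · congr 2
    apply Fin.ext
    have : x / 2 ^ j % 2 = 1 := by omega
    simp only [hm, this]; omega

theorem membershipQuery_F (u : QR G.p) {n : ℕ} (k : ZMod G.q) :
    membershipQuery (fun x : Fin n → Bool => GGMParam.F ⟨G, u⟩ k x) =
      fun x => if x < 2 ^ n then stepsN G.p G.q (rep G.g) (rep u) n x k.val else 0 := by
  ext x
  unfold membershipQuery
  split_ifs with hx
  · change (GGMParam.F ⟨G, u⟩ k _).val = _
    rw [F_val, Nat.ofBits_testBit, Nat.mod_eq_of_lt hx]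
  · rfl

/-- A random function on the single empty prefix is a random key. -/
theorem hybridProb_zero (A : Prog) (u : QR G.p) (n : ℕ) :
    hybridProb G A u n 0 = mean (PMF.uniformOfFintype (ZMod G.q)) fun k =>
      outProb A (membershipQuery fun x : Fin n → Bool => GGMParam.F ⟨G, u⟩ k x)
        [G.p, rep G.g, rep u] [1] := by
  have hb : Function.Bijective fun (k : ZMod G.q) (_ : Fin (2 ^ 0)) => k := by
    refine ⟨fun k k' h => congrFun h ⟨0, by norm_num⟩, fun f => ⟨f ⟨0, by norm_num⟩, ?_⟩⟩
    ext z
    have hz : z = ⟨0, by norm_num⟩ := Fin.ext (by have := z.2; simp only [pow_zero] at this; omega)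
    rw [hz]
  rw [hybridProb, ← mean_uniform_bijective hb]
  congr 1
  ext k
  rw [membershipQuery_F]
  congr 1
  ext x
  simp only [treeOracle, Nat.sub_zero, pow_zero, Nat.div_one]

theorem bits_surjective (n : ℕ) :
    Function.Surjective fun (i : Fin (2 ^ n)) (j : Fin n) => i.val.testBit j := fun x =>
  ⟨⟨Nat.ofBits x, Nat.ofBits_lt_two_pow x⟩, by ext j; simp⟩

/-- No tree levels remain, and numbers below `2 ^ n` correspond to bit strings. -/
theorem hybridProb_last (A : Prog) (u : QR G.p) (n : ℕ) :
    hybridProb G A u n n = mean (PMF.uniformOfFintype ((Fin n → Bool) → ZMod G.q)) fun R =>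
      outProb A (membershipQuery R) [G.p, rep G.g, rep u] [1] := by
  have hb : Function.Bijective fun (R : (Fin n → Bool) → ZMod G.q) (i : Fin (2 ^ n)) =>
      R fun j => i.val.testBit j := by
    rw [Fintype.bijective_iff_injective_and_card]
    refine ⟨fun R R' h => ?_, by simp⟩
    ext x
    obtain ⟨i, rfl⟩ := bits_surjective n x
    exact congrFun h i
  rw [hybridProb, ← mean_uniform_bijective hb]
  congr 1
  ext R
  congr 1
  ext x
  unfold treeOracle membershipQuery
  split_ifs with hx
  · simp [stepsN, Nat.mod_eq_of_lt hx]
  · rfl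

/-- The oracles of the hybrids are membership query oracles. -/
theorem exists_membershipQuery_eq (u v w : QR G.p) {n j : ℕ} (f) :
    ∃ R : (Fin n → Bool) → ZMod G.q,
      membershipQuery R = (tupleHybrid G u v w n j).oracle f := by
  refine ⟨fun x => ((tupleHybrid G u v w n j).oracle f (Nat.ofBits x) : ZMod G.q), ?_⟩
  ext x
  unfold membershipQuery
  split_ifs with hx
  · beta_reduce
    rw [Nat.ofBits_testBit, Nat.mod_eq_of_lt hx, ZMod.val_cast_of_lt]
    unfold Hybrid.oracle Hybrid.answer
    split_ifs
    · exact stepsN_lt G.q_prime.pos _ (foldN_lt G.q_prime.pos)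
    · exact G.q_prime.pos
  · unfold Hybrid.oracle Hybrid.answer
    rw [if_neg (show ¬ x < 2 ^ (tupleHybrid G u v w n j).n from hx)]

end Hybrids

/-! ## Security -/

/-- For `n ≥ 1` the polynomial is at most its coefficient sum `r.eval 1` times `n ^ r.natDegree`. -/
theorem eventually_polynomial_le_two_pow (r : Polynomial ℕ) :
    ∀ᶠ n : ℕ in atTop, r.eval n ≤ 2 ^ n := by
  have h1 : ∀ n : ℕ, 1 ≤ n → r.eval n ≤ r.eval 1 * n ^ r.natDegree := by
    intro n hn
    rw [Polynomial.eval_eq_sum_range, Polynomial.eval_eq_sum_range, Finset.sum_mul]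
    refine Finset.sum_le_sum fun i hi => ?_
    rw [one_pow, mul_one]
    exact Nat.mul_le_mul_left _ (Nat.pow_le_pow_right hn (by simp at hi; omega))
  have h2 := (tendsto_pow_const_div_const_pow_of_one_lt r.natDegree (one_lt_two (α := ℝ))).eventually
    (gt_mem_nhds (show (0 : ℝ) < 1 / (r.eval 1 + 1 : ℕ) by positivity))
  filter_upwards [h2, eventually_ge_atTop 1] with n hn hn1
  refine (h1 n hn1).trans ?_
  rw [div_lt_div_iff₀ (by positivity) (by positivity), one_mul] at hn
  have : n ^ r.natDegree * (r.eval 1 + 1) < 2 ^ n := by exact_mod_cast hn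
  rw [mul_add, mul_one, mul_comm] at this
  exact ((Nat.le_add_right _ _).trans_lt this).le

theorem polynomial_eval_mono (r : Polynomial ℕ) {m n : ℕ} (h : m ≤ n) : r.eval m ≤ r.eval n := by
  rw [Polynomial.eval_eq_sum_range, Polynomial.eval_eq_sum_range]
  gcongr

theorem eventually_eval_pos {r : Polynomial ℕ} (hr : r ≠ 0) : ∀ᶠ n : ℕ in atTop, 0 < r.eval n := by
  filter_upwards [eventually_gt_atTop 0] with n hn
  rw [Polynomial.eval_eq_sum_range]
  refine lt_of_lt_of_le ?_ (Finset.single_le_sum (fun i _ => Nat.zero_le _)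
    (Finset.mem_range.2 (Nat.lt_succ_self r.natDegree)))
  have := Polynomial.leadingCoeff_ne_zero.2 hr
  exact Nat.mul_pos (Nat.pos_of_ne_zero this) (by positivity)

theorem abs_toReal_sub_le {x y e : ENNReal} (hx : x ≠ ⊤) (hy : y ≠ ⊤) (he : e ≠ ⊤)
    (h1 : x ≤ y + e) (h2 : y ≤ x + e) : |x.toReal - y.toReal| ≤ e.toReal := by
  have h1' := ENNReal.toReal_mono (ENNReal.add_ne_top.2 ⟨hy, he⟩) h1
  have h2' := ENNReal.toReal_mono (ENNReal.add_ne_top.2 ⟨hx, he⟩) h2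
  rw [ENNReal.toReal_add hy he] at h1'
  rw [ENNReal.toReal_add hx he] at h2'
  rw [abs_le]; constructor <;> linarith

theorem mean_ggmGenerator (IG : ℕ → PMF QRInstance) (n : ℕ) (f : GGMParam → ENNReal) :
    mean (ggmGenerator IG n) f =
      mean (IG n) fun G => mean (PMF.uniformOfFintype (ZMod G.q)) fun a => f ⟨G, G.gpow a⟩ := by
  rw [ggmGenerator, mean_bind]
  congr 1
  ext G
  rw [mean_map]
  rfl

/-- Every residue is a power of `g`, so `h` is unrestricted. Hence `A` is known to halt for
arbitrary `u`, as required of an adversary against DDH. -/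
theorem mem_support_ggmGenerator (IG : ℕ → PMF QRInstance) (n : ℕ) (P : GGMParam) :
    P ∈ (ggmGenerator IG n).support ↔ P.toQRInstance ∈ (IG n).support := by
  rw [ggmGenerator, PMF.mem_support_bind_iff]
  constructor
  · rintro ⟨G, hG, h⟩
    obtain ⟨a, -, rfl⟩ := (PMF.mem_support_map_iff _ _ _).1 h
    exact hG
  · obtain ⟨G, u⟩ := P
    intro hG
    obtain ⟨a, rfl⟩ := G.gpow_surjective u
    exact ⟨G, hG, (PMF.mem_support_map_iff _ _ _).2
      ⟨a, PMF.mem_support_uniformOfFintype a, rfl⟩⟩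

/-- The probability that the distinguisher accepts the tuple `(p, g, u, v, w)`. -/
def tupleProb (A : Prog) (G : QRInstance) (u v w : QR G.p) : ENNReal :=
  outProb (distinguisher A) noOracle [G.p, rep G.g, rep u, rep v, rep w] [1]

/-- The mean of the hybrids `i`, …, `n + i - 1`. -/
def hybridMean (A : Prog) (G : QRInstance) (u : QR G.p) (i : ℕ) : ENNReal :=
  mean (uniformBelow G.p.size) fun j => hybridProb G A u G.p.size (j + i)

theorem hybridProb_le_one (A : Prog) (G : QRInstance) (u : QR G.p) (n j : ℕ) :
    hybridProb G A u n j ≤ 1 :=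
  mean_le_one fun _ => outProb_le_one

theorem hybridMean_le_one (A : Prog) (G : QRInstance) (u : QR G.p) (i : ℕ) :
    hybridMean A G u i ≤ 1 :=
  mean_le_one fun _ => hybridProb_le_one ..

theorem size_p_pos (G : QRInstance) : 0 < G.p.size := Nat.size_pos.2 G.safe.1.pos

/-- Written with sums only, since subtraction in `ENNReal` is truncated: both sides are the sum of
the hybrids `0` to `n`. -/
theorem telescope (A : Prog) (G : QRInstance) (u : QR G.p) :
    (G.p.size : ENNReal) * hybridMean A G u 0 + hybridProb G A u G.p.size G.p.size =
      G.p.size * hybridMean A G u 1 + hybridProb G A u G.p.size 0 := by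
  have hn := size_p_pos G
  have hc : (G.p.size : ENNReal) * (G.p.size : ENNReal)⁻¹ = 1 :=
    ENNReal.mul_inv_cancel (by exact_mod_cast hn.ne') (ENNReal.natCast_ne_top _)
  unfold hybridMean
  rw [mean_uniformBelow hn, mean_uniformBelow hn, ← mul_assoc, ← mul_assoc, hc, one_mul, one_mul]
  simp only [Nat.add_zero]
  rw [← Finset.sum_range_succ, ← Finset.sum_range_succ']

/-! ### The reduction from Diffie-Hellman tuples to neighbouring hybrids. -/

section Reduction

variable {IG : ℕ → PMF QRInstance} {A : Prog} {T : ℕ → ℕ}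

/-- `A` halts in time `T` on all inputs with the instance `G`. -/
def HaltsOn (A : Prog) (T : ℕ → ℕ) (G : QRInstance) : Prop :=
  ∀ (u : QR G.p) (R : (Fin G.p.size → Bool) → ZMod G.q), ∃ F,
    wp (membershipQuery R) F A (load [G.p, rep G.g, rep u])
      (fun _ t => ind (t ≤ T (inputLength [G.p, rep G.g, rep u]))) = 1

theorem HaltsOn.distinguisher_spec {G : QRInstance} (hA : HaltsOn A T G) (u v w : QR G.p) {j : ℕ}
    (f) : ∃ F, wp ((tupleHybrid G u v w G.p.size j).oracle f) F A (load [G.p, rep G.g, rep u])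
      (fun _ t => ind (t ≤ T (inputLength [G.p, rep G.g, rep u]))) = 1 := by
  obtain ⟨R, hR⟩ := exists_membershipQuery_eq G u v w (n := G.p.size) f
  rw [← hR]
  exact hA u R

theorem HaltsOn.tupleProb_eq {G : QRInstance} (hA : HaltsOn A T G) (u v w : QR G.p) :
    tupleProb A G u v w = mean (uniformBelow G.p.size) fun j =>
      mean (PMF.uniformOfFintype (Fin (2 ^ j) → Fin (G.q * G.q - 1 + 1))) fun f =>
        outProb A ((tupleHybrid G u v w G.p.size j).oracle f) [G.p, rep G.g, rep u] [1] := by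
  obtain ⟨K, hK⟩ := QRPRF.distinguisher_spec
  exact (hK A (tupleHybrid G u v w G.p.size 0) _ (tupleHybrid_ok ..) rfl
    fun j _ f => hA.distinguisher_spec u v w f).2

theorem HaltsOn.tupleProb_real {G : QRInstance} (hA : HaltsOn A T G) (a b : ZMod G.q) :
    tupleProb A G (G.gpow a) (G.gpow b) (G.gpow (a * b)) = hybridMean A G (G.gpow a) 0 := by
  rw [hA.tupleProb_eq]
  refine mean_congr_support fun j hj => mean_tupleHybrid_real G A a b ?_
  have := mem_support_uniformBelow hj
  have := size_p_pos G
  omega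

theorem HaltsOn.tupleProb_random {G : QRInstance} (hA : HaltsOn A T G) (hq : G.q ≠ 2)
    {a b c : ZMod G.q} (hc : c ≠ a * b) :
    tupleProb A G (G.gpow a) (G.gpow b) (G.gpow c) = hybridMean A G (G.gpow a) 1 := by
  rw [hA.tupleProb_eq]
  exact mean_congr_support fun j _ => mean_tupleHybrid_random G A hq hc _ _

theorem mean_ind_eq {q : ℕ} [NeZero q] (a : ZMod q) :
    mean (PMF.uniformOfFintype (ZMod q)) (fun c => ind (c = a)) = (q : ENNReal)⁻¹ := by
  classical
  rw [mean_uniform, ZMod.card, Finset.sum_eq_single a (fun b _ hb => ind_false hb)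
    (fun h => absurd (Finset.mem_univ a) h), ind_true rfl, mul_one]

/-- Only the event `c = a * b`, of probability `1 / q`, deviates from hybrid `j + 1`. -/
theorem HaltsOn.mean_tupleProb_le {G : QRInstance} (hA : HaltsOn A T G) (hq : G.q ≠ 2)
    (a b : ZMod G.q) :
    mean (PMF.uniformOfFintype (ZMod G.q))
        (fun c => tupleProb A G (G.gpow a) (G.gpow b) (G.gpow c)) ≤
      hybridMean A G (G.gpow a) 1 + (G.q : ENNReal)⁻¹ := by
  rw [← mean_const (PMF.uniformOfFintype (ZMod G.q)) (hybridMean A G (G.gpow a) 1),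
    ← mean_ind_eq (a * b), ← mean_add]
  refine mean_mono fun c => ?_
  by_cases hc : c = a * b
  · rw [ind_true hc]
    exact outProb_le_one.trans le_add_self
  · rw [hA.tupleProb_random hq hc]
    exact le_self_add

theorem HaltsOn.le_mean_tupleProb {G : QRInstance} (hA : HaltsOn A T G) (hq : G.q ≠ 2)
    (a b : ZMod G.q) :
    hybridMean A G (G.gpow a) 1 ≤ mean (PMF.uniformOfFintype (ZMod G.q))
        (fun c => tupleProb A G (G.gpow a) (G.gpow b) (G.gpow c)) + (G.q : ENNReal)⁻¹ := by
  rw [← mean_const (PMF.uniformOfFintype (ZMod G.q)) (hybridMean A G (G.gpow a) 1),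
    ← mean_ind_eq (a * b), ← mean_add]
  refine mean_mono fun c => ?_
  by_cases hc : c = a * b
  · rw [ind_true hc]
    exact (hybridMean_le_one ..).trans le_add_self
  · rw [hA.tupleProb_random hq hc]
    exact le_self_add

theorem polyTime_distinguisher {T : Polynomial ℕ}
    (hA : ∀ n, ∀ G ∈ (IG n).support, HaltsOn A (fun l => T.eval l) G) :
    PolyTime (distinguisher A) {r | ∃ (n : ℕ) (G : QRInstance) (u v w : QR G.p),
      G ∈ (IG n).support ∧ r = ([G.p, rep G.g, rep u, rep v, rep w], noOracle)} := by
  obtain ⟨K, hK⟩ := QRPRF.distinguisher_spec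
  rw [polyTime_iff]
  -- Both `n` and the length of the input to `A` are at most the length of the full tuple, and `T`
  -- is monotone.
  refine ⟨.C K * ((.C 3 * .X + 1) * (T + 1) + .C 2) ^ 4, ?_⟩
  rintro _ ⟨n, G, u, v, w, hG, rfl⟩
  obtain ⟨F, hF⟩ := (hK A (tupleHybrid G u v w G.p.size 0) _ (tupleHybrid_ok ..) rfl
    fun j _ f => (hA n G hG).distinguisher_spec u v w f).1
  refine ⟨F, le_antisymm (wp_le_one fun _ _ => ind_le_one _) ?_⟩
  rw [← hF]
  refine wp_mono fun s t => ind_mono fun ht => ht.trans ?_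
  simp only [Polynomial.eval_mul, Polynomial.eval_pow, Polynomial.eval_add, Polynomial.eval_C,
    Polynomial.eval_X, Polynomial.eval_one]
  set l := inputLength [G.p, rep G.g, rep u, rep v, rep w] with hl
  have h1 : G.p.size ≤ l := by simp only [hl, inputLength, List.map, List.sum_cons]; omega
  have h2 : T.eval (inputLength [G.p, rep G.g, rep u]) ≤ T.eval l :=
    polynomial_eval_mono T (by simp only [hl, inputLength, List.map, List.sum_cons]; omega)
  change K * ((3 * G.p.size + 1) * _ + 2) ^ 4 ≤ _
  gcongr

/-- The hybrid argument, for a fixed number of bits. -/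
theorem abs_hybrid_sub_le {n : ℕ} (hn : 4 ≤ n) (hsize : ∀ G ∈ (IG n).support, G.p.size = n)
    (hA : ∀ G ∈ (IG n).support, HaltsOn A T G) :
    |(mean (IG n) fun G => mean (PMF.uniformOfFintype (ZMod G.q)) fun a =>
        hybridProb G A (G.gpow a) G.p.size 0).toReal -
      (mean (IG n) fun G => mean (PMF.uniformOfFintype (ZMod G.q)) fun a =>
        hybridProb G A (G.gpow a) G.p.size G.p.size).toReal| ≤
    n * (|(mean (IG n) fun G => mean (PMF.uniformOfFintype (ZMod G.q)) fun a =>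
        mean (PMF.uniformOfFintype (ZMod G.q)) fun b =>
          tupleProb A G (G.gpow a) (G.gpow b) (G.gpow (a * b))).toReal -
      (mean (IG n) fun G => mean (PMF.uniformOfFintype (ZMod G.q)) fun a =>
        mean (PMF.uniformOfFintype (ZMod G.q)) fun b =>
        mean (PMF.uniformOfFintype (ZMod G.q)) fun c =>
          tupleProb A G (G.gpow a) (G.gpow b) (G.gpow c)).toReal| + 4 / 2 ^ n) := by
  set E : ((G : QRInstance) → ZMod G.q → ENNReal) → ENNReal := fun φ =>
    mean (IG n) fun G => mean (PMF.uniformOfFintype (ZMod G.q)) (φ G) with hE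
  have hE1 : ∀ {φ : (G : QRInstance) → ZMod G.q → ENNReal}, (∀ G a, φ G a ≤ 1) → E φ ≠ ⊤ :=
    fun h => mean_ne_top fun _ => mean_le_one fun _ => h _ _
  have hEmono : ∀ {φ ψ : (G : QRInstance) → ZMod G.q → ENNReal},
      (∀ G ∈ (IG n).support, ∀ a, φ G a ≤ ψ G a) → E φ ≤ E ψ :=
    fun h => mean_mono_support fun G hG => mean_mono (h G hG)
  have hEadd : ∀ φ ψ : (G : QRInstance) → ZMod G.q → ENNReal,
      E (fun G a => φ G a + ψ G a) = E φ + E ψ := fun φ ψ => by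
    simp only [hE, mean_add]
  have hEmul : ∀ (c : ENNReal) (φ : (G : QRInstance) → ZMod G.q → ENNReal),
      E (fun G a => c * φ G a) = c * E φ := fun c φ => by
    simp only [hE, mean_const_mul]
  have hEconst : ∀ c : ENNReal, E (fun _ _ => c) = c := fun c => by simp only [hE, mean_const]
  let H : ℕ → ENNReal := fun i => E fun G a => hybridMean A G (G.gpow a) i
  -- An `n`-bit `p = 2 * q + 1` has `q ≥ 2 ^ (n - 2)`, hence `1 / q ≤ e`; for `n ≥ 4` this also
  -- excludes `q = 2`.
  let e : ENNReal := 4 / 2 ^ n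
  have he : e ≠ ⊤ := ENNReal.div_ne_top (by simp) (by simp)
  have hq : ∀ G ∈ (IG n).support, G.q ≠ 2 ∧ (G.q : ENNReal)⁻¹ ≤ e := by
    intro G hG
    have h1 : 2 ^ (n - 1) ≤ G.p := by
      rw [← Nat.lt_size, hsize G hG]; omega
    have h2 : 2 ^ (n - 1) = 2 * 2 ^ (n - 2) := by
      rw [← pow_succ']; congr 1; omega
    have h3 : 2 ^ n = 4 * 2 ^ (n - 2) := by
      rw [show n = n - 2 + 2 by omega, pow_add]; simp; ring
    have h4 : 2 ^ 2 ≤ 2 ^ (n - 2) := Nat.pow_le_pow_right (by norm_num) (by omega)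
    have h5 := G.p_eq
    refine ⟨by omega, ?_⟩
    rw [ENNReal.le_div_iff_mul_le (by simp) (by simp), mul_comm, ← div_eq_mul_inv]
    refine ENNReal.div_le_of_le_mul ?_
    have : 2 ^ n ≤ 4 * G.q := by omega
    exact_mod_cast this
  have hreal : E (fun G a => mean (PMF.uniformOfFintype (ZMod G.q)) fun b =>
      tupleProb A G (G.gpow a) (G.gpow b) (G.gpow (a * b))) = H 0 := by
    refine le_antisymm (hEmono fun G hG a => ?_) (hEmono fun G hG a => ?_) <;>
      simp only [(hA G hG).tupleProb_real, mean_const, le_refl]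
  let X := E fun G a => mean (PMF.uniformOfFintype (ZMod G.q)) fun b =>
    mean (PMF.uniformOfFintype (ZMod G.q)) fun c => tupleProb A G (G.gpow a) (G.gpow b) (G.gpow c)
  have hX : X ≠ ⊤ := hE1 fun _ _ => mean_le_one fun _ => mean_le_one fun _ => outProb_le_one
  have hH : ∀ i, H i ≠ ⊤ := fun i => hE1 fun _ _ => hybridMean_le_one ..
  have hP : ∀ k : QRInstance → ℕ, E (fun G a => hybridProb G A (G.gpow a) G.p.size (k G)) ≠ ⊤ :=
    fun _ => hE1 fun _ _ => hybridProb_le_one ..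
  have h1 : X ≤ H 1 + e := by
    rw [← hEconst e, ← hEadd]
    refine hEmono fun G hG a => ?_
    rw [← mean_const (PMF.uniformOfFintype (ZMod G.q)) (hybridMean A G (G.gpow a) 1 + e)]
    exact mean_mono fun b => ((hA G hG).mean_tupleProb_le (hq G hG).1 a b).trans
      (add_le_add_right (hq G hG).2 _)
  have h2 : H 1 ≤ X + e := by
    rw [← hEconst e, ← hEadd]
    refine hEmono fun G hG a => ?_
    rw [← mean_const (PMF.uniformOfFintype (ZMod G.q)) (hybridMean A G (G.gpow a) 1),
      ← mean_const (PMF.uniformOfFintype (ZMod G.q)) e, ← mean_add]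
    exact mean_mono fun b => ((hA G hG).le_mean_tupleProb (hq G hG).1 a b).trans
      (add_le_add_right (hq G hG).2 _)
  have h3 := abs_toReal_sub_le hX (hH 1) he h1 h2
  -- The number of hybrids can leave the mean because it is `n` on the whole support.
  have h4 : n * H 0 + E (fun G a => hybridProb G A (G.gpow a) G.p.size G.p.size) =
      n * H 1 + E (fun G a => hybridProb G A (G.gpow a) G.p.size 0) := by
    rw [← hEmul, ← hEmul, ← hEadd, ← hEadd]
    refine le_antisymm (hEmono fun G hG a => ?_) (hEmono fun G hG a => ?_) <;>
      (have := telescope A G (G.gpow a); rw [hsize G hG] at this ⊢; rw [this])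
  have h5 := congrArg ENNReal.toReal h4
  rw [ENNReal.toReal_add (ENNReal.mul_ne_top (by simp) (hH 0)) (hP fun G => G.p.size),
    ENNReal.toReal_add (ENNReal.mul_ne_top (by simp) (hH 1)) (hP fun _ => 0),
    ENNReal.toReal_mul, ENNReal.toReal_mul, ENNReal.toReal_natCast] at h5
  have h6 : e.toReal = 4 / 2 ^ n := by simp [e, ENNReal.toReal_div]
  rw [h6] at h3
  change |(E fun G a => hybridProb G A (G.gpow a) G.p.size 0).toReal -
    (E fun G a => hybridProb G A (G.gpow a) G.p.size G.p.size).toReal| ≤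
    n * (|ENNReal.toReal (E _) - X.toReal| + _)
  rw [hreal, show (E fun G a => hybridProb G A (G.gpow a) G.p.size 0).toReal -
    (E fun G a => hybridProb G A (G.gpow a) G.p.size G.p.size).toReal =
    n * ((H 0).toReal - (H 1).toReal) by linarith, abs_mul, Nat.abs_cast]
  gcongr
  calc |(H 0).toReal - (H 1).toReal| ≤ |(H 0).toReal - X.toReal| + |X.toReal - (H 1).toReal| :=
        abs_sub_le _ _ _
    _ ≤ _ := by gcongr

end Reduction

theorem indistinguishable_of_ddh {IG : ℕ → PMF QRInstance}
    (hsize : ∀ᶠ n in atTop, ∀ G ∈ (IG n).support, G.p.size = n) (hDDH : DDH IG) (A : Prog)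
    (hA : PolyTime A {r | ∃ (n : ℕ) (P : GGMParam) (f : (Fin P.p.size → Bool) → ZMod P.q),
      P ∈ (ggmGenerator IG n).support ∧ r = (P.enc, membershipQuery f)}) :
    Indistinguishable
      (fun n => mean (ggmGenerator IG n) fun P : GGMParam =>
        mean (PMF.uniformOfFintype (ZMod P.q)) fun k =>
          outProb A (membershipQuery fun x : Fin P.p.size → Bool => P.F k x) P.enc [1])
      (fun n => mean (ggmGenerator IG n) fun P : GGMParam =>
        mean (PMF.uniformOfFintype ((Fin P.p.size → Bool) → ZMod P.q)) fun R =>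
          outProb A (membershipQuery R) P.enc [1]) := by
  rw [polyTime_iff] at hA
  obtain ⟨T, hT⟩ := hA
  have hhalt : ∀ n, ∀ G ∈ (IG n).support, HaltsOn A (fun l => T.eval l) G := fun n G hG u R =>
    hT _ ⟨n, ⟨G, u⟩, R, (mem_support_ggmGenerator IG n _).2 hG, rfl⟩
  intro r hr
  -- DDH is used with `2 * n * r`, and `8 * n * r ≤ 2 ^ n` makes `4 / 2 ^ n` at most `1 / (2 * n *
  -- r)`. The factor `n` of the hybrid argument turns the two errors into `1 / r`.
  have hr' : Polynomial.C 2 * Polynomial.X * r ≠ 0 := by simp [hr]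
  filter_upwards [hsize, hDDH _ (polyTime_distinguisher hhalt) _ hr', eventually_eval_pos hr,
    eventually_polynomial_le_two_pow (Polynomial.C 8 * Polynomial.X * r), eventually_ge_atTop 4]
    with n hn hd hpos h8 h4
  have h1 := abs_hybrid_sub_le h4 hn (hhalt n)
  erw [mean_ggmGenerator, mean_ggmGenerator]
  simp only [hybridProb_zero, hybridProb_last] at h1
  refine lt_of_le_of_lt h1 ?_
  simp only [Polynomial.eval_mul, Polynomial.eval_C, Polynomial.eval_X] at hd h8
  have hd' : |(mean (IG n) fun G => mean (PMF.uniformOfFintype (ZMod G.q)) fun a =>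
        mean (PMF.uniformOfFintype (ZMod G.q)) fun b =>
          tupleProb A G (G.gpow a) (G.gpow b) (G.gpow (a * b))).toReal -
      (mean (IG n) fun G => mean (PMF.uniformOfFintype (ZMod G.q)) fun a =>
        mean (PMF.uniformOfFintype (ZMod G.q)) fun b =>
        mean (PMF.uniformOfFintype (ZMod G.q)) fun c =>
          tupleProb A G (G.gpow a) (G.gpow b) (G.gpow c)).toReal| < 1 / ((2 * n * r.eval n : ℕ) : ℝ) := by
    convert hd using 10 with G a b
    -- The exponent is a product of natural numbers here, and is reduced modulo the order `q` of
    -- `g`.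
    · rw [G.g_pow (a.val * b.val), Nat.cast_mul, ZMod.natCast_zmod_val, ZMod.natCast_zmod_val]
      rfl
    · rfl
  have h8' : ((8 * n * r.eval n : ℕ) : ℝ) ≤ 2 ^ n := by exact_mod_cast h8
  push_cast at hd' h8'
  have hn0 : (0 : ℝ) < n := by exact_mod_cast (by omega : 0 < n)
  have hr0 : (0 : ℝ) < (r.eval n : ℕ) := by exact_mod_cast hpos
  have h9 : (4 : ℝ) / 2 ^ n ≤ 1 / (2 * n * (r.eval n : ℕ)) := by
    rw [div_le_div_iff₀ (by positivity) (by positivity)]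
    linarith
  calc _ < (n : ℝ) * (1 / (2 * n * (r.eval n : ℕ)) + 1 / (2 * n * (r.eval n : ℕ))) :=
        mul_lt_mul_of_pos_left (add_lt_add_of_lt_of_le hd' h9) hn0
    _ = _ := by field_simp; norm_num

/-! ## Efficiency -/

theorem size_load_le (l : List ℕ) (i : ℕ) : (load l i).size ≤ inputLength l := by
  induction l generalizing i with
  | nil => simp [load, inputLength]
  | cons a l ih =>
    cases i with
    | zero => simp [load, inputLength]; omega
    | succ i => have := ih i; simp [load, inputLength] at this ⊢; omega

theorem Runs.halts {c : Prog} {s s' : Store} {T : ℕ} (h : Runs c s s' T) (O : ℕ → ℕ) :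
    wp O T c s (fun _ t => ind (t ≤ T)) = 1 := by
  obtain ⟨t, ht, h⟩ := h
  rw [h O T ht, ind_true ht]

theorem Runs.outProb_eq_one {c : Prog} {l : List ℕ} {s' : Store} {T : ℕ} (h : Runs c (load l) s' T)
    (O : ℕ → ℕ) {v : List ℕ} (hv : (List.range v.length).map s' = v) : outProb c O l v = 1 := by
  obtain ⟨t, ht, h⟩ := h
  refine le_antisymm outProb_le_one ?_
  rw [← ind_true hv, ← h O t le_rfl fun s _ => ind ((List.range v.length).map s = v)]
  exact le_outProb fun _ _ => le_rfl

/-- Evaluation of the tree. -/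
def evalProg : Prog :=
  .seq sizeProg (.seq (.seq (.assign 21 (.reg 3)) (.seq (.assign 22 (.reg 4)) (.assign 23 (.reg 6))))
    (.seq stepLoop (.assign 0 (.reg 21))))

theorem evalProg_runs : ∃ K, ∀ b s, Bd b s → (s 0).size + 1 ≤ b → 1 < s 0 → s 1 < s 0 → s 2 < s 0 →
    ∃ s', Runs evalProg s s' (K * (b + 1) ^ 3) ∧
      s' 0 = stepsN (s 0) (s 0 / 2) (s 1) (s 2) (s 0).size (s 4) (s 3) := by
  obtain ⟨K₁, h₁⟩ := sizeProg_runs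
  obtain ⟨K₂, h₂⟩ := (show Prog.Straight (.seq (.assign 21 (.reg 3)) (.seq (.assign 22 (.reg 4))
    (.assign 23 (.reg 6)))) by simp [Prog.Straight, Expr.Work, workRegs]).runs
  obtain ⟨K₃, h₃⟩ := stepLoop_runs
  refine ⟨K₁ + K₂ + K₃ + 1, fun b s hb hs hp hg hh => ?_⟩
  obtain ⟨s₁, r₁, e5, e6, -, b₁, f₁⟩ := h₁ b s hb hs
  obtain ⟨r₂, -⟩ := h₂ b s₁ b₁
  rw [show Prog.run _ s₁ = Function.update (Function.update (Function.update s₁ 21 (s₁ 3)) 22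
    (s₁ 4)) 23 (s₁ 6) by simp [Prog.run, Expr.eval]] at r₂
  set s₂ := Function.update (Function.update (Function.update s₁ 21 (s₁ 3)) 22
    (s₁ 4)) 23 (s₁ 6) with hs₂
  have b₂ : Bd b s₂ := ((b₁.update (b₁ 3 (by norm_num))).update (b₁ 4 (by norm_num))).update
    (b₁ 6 (by norm_num))
  have e : s₂ 0 = s 0 ∧ s₂ 1 = s 1 ∧ s₂ 2 = s 2 ∧ s₂ 5 = s 0 / 2 ∧ s₂ 21 = s 3 ∧ s₂ 22 = s 4 ∧
      s₂ 23 = (s 0).size := by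
    simp [hs₂, Function.update, e5, e6, f₁ 0, f₁ 1, f₁ 2, f₁ 3, f₁ 4]
  obtain ⟨e0, e1, e2, e5', e21, e22, e23⟩ := e
  obtain ⟨s₃, r₃, h21, b₃, -⟩ := h₃ b s₂ b₂ (by omega) (by omega) (by omega) (by omega)
  refine ⟨_, (r₁.seq (r₂.seq (r₃.seq (Runs.assign 0 (.reg 21) s₃)))).mono ?_, ?_⟩
  · have hc : (Expr.reg 21).cost s₃ ≤ b + 1 := by simpa [Expr.cost] using b₃ 21 (by norm_num)
    have h1 : s₂ 23 + 1 ≤ b + 1 := by omega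
    have h2 : K₁ * (b + 1) ^ 2 ≤ K₁ * (b + 1) ^ 3 :=
      Nat.mul_le_mul_left _ (Nat.pow_le_pow_right (by omega) (by omega))
    have h3 : K₂ * (b + 1) ≤ K₂ * (b + 1) ^ 3 :=
      Nat.mul_le_mul_left _ (Nat.le_self_pow (by omega) _)
    have h4 : (s₂ 23 + 1) * (K₃ * (b + 1) ^ 2) ≤ K₃ * (b + 1) ^ 3 := by
      calc _ ≤ (b + 1) * (K₃ * (b + 1) ^ 2) := Nat.mul_le_mul_right _ h1
        _ = _ := by ring
    have h5 : b + 2 ≤ (b + 1) ^ 3 := by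
      have : 1 ≤ b := by omega
      nlinarith [sq_nonneg b]
    have h6 : (K₁ + K₂ + K₃ + 1) * (b + 1) ^ 3 = K₁ * (b + 1) ^ 3 + K₂ * (b + 1) ^ 3 +
      K₃ * (b + 1) ^ 3 + (b + 1) ^ 3 := by ring
    rw [h6]
    omega
  · simp [Expr.eval, h21, e0, e1, e2, e5', e21, e22, e23]

theorem exists_evaluation : ∃ c : Prog,
    PolyTime c {r | ∃ (P : GGMParam) (k : ZMod P.q) (x : Fin P.p.size → Bool),
      r = (P.enc ++ [k.val, Nat.ofBits x], noOracle)} ∧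
    ∀ (P : GGMParam) (k : ZMod P.q) (x : Fin P.p.size → Bool),
      outProb c noOracle (P.enc ++ [k.val, Nat.ofBits x]) [(P.F k x).val] = 1 := by
  obtain ⟨K, hK⟩ := evalProg_runs
  have key : ∀ (P : GGMParam) (k : ZMod P.q) (x : Fin P.p.size → Bool), ∃ s',
      Runs evalProg (load (P.enc ++ [k.val, Nat.ofBits x])) s'
        (K * (inputLength (P.enc ++ [k.val, Nat.ofBits x]) + 1) ^ 3) ∧ s' 0 = (P.F k x).val := by
    rintro ⟨G, u⟩ k x
    obtain ⟨s', h1, h2⟩ := hK _ (load [G.p, rep G.g, rep u, k.val, Nat.ofBits x])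
      (fun i _ => size_load_le _ i) (by simp [load, inputLength]) G.safe.1.one_lt (rep_lt _)
      (rep_lt _)
    exact ⟨s', h1, h2.trans (F_val G u k x).symm⟩
  refine ⟨evalProg, (polyTime_iff _ _).2 ⟨.C K * (.X + 1) ^ 3, ?_⟩, fun P k x => ?_⟩
  · rintro _ ⟨P, k, x, rfl⟩
    obtain ⟨s', h1, -⟩ := key P k x
    exact ⟨_, by simpa using h1.halts noOracle⟩
  · obtain ⟨s', h1, h2⟩ := key P k x
    exact h1.outProb_eq_one _ (by simp [h2])

theorem mean_ind_self {α : Type} (μ : PMF α) (a : α) : mean μ (fun x => ind (x = a)) = μ a := by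
  rw [mean, tsum_eq_single a fun b hb => by rw [ind_false hb, mul_zero], ind_true rfl, mul_one]

theorem exists_key_selection : ∃ c : Prog,
    PolyTime c {r | ∃ P : GGMParam, r = (P.enc, noOracle)} ∧
    ∀ P : GGMParam, Samples c P.enc (fun k : ZMod P.q => [k.val])
      (PMF.uniformOfFintype (ZMod P.q)) := by
  refine ⟨.rand 0 (.bin .div (.reg 0) (.const 2)), (polyTime_iff _ _).2 ⟨.C 2 * .X + .C 7, ?_⟩,
    fun P k => ?_⟩
  · rintro _ ⟨P, rfl⟩
    -- No fuel is needed without loops.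
    refine ⟨0, ?_⟩
    rw [wp_rand, mean_const, ind_true]
    have h1 : (P.p / 2).size ≤ P.p.size := Nat.size_le_size (Nat.div_le_self _ _)
    have h2 : (2 : ℕ).size = 2 := by decide
    simp [Expr.cost, Expr.eval, Op.eval, load, GGMParam.enc, inputLength, h2]
    omega
  · rw [outProb_eq]
    simp only [wp_rand, ciSup_const]
    change mean (uniformBelow P.q) _ = _
    rw [← mean_zmod (q := P.q) (fun r => ind (_ = _)), ← mean_ind_self]
    congr 1
    ext a
    refine ind_congr ?_
    simp [(ZMod.val_injective P.q).eq_iff]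

theorem mean_tsum {α β : Type} (μ : PMF α) (f : β → α → ENNReal) :
    mean μ (fun a => ∑' x, f x a) = ∑' x, mean μ (f x) := by
  unfold mean
  simp_rw [← ENNReal.tsum_mul_left]
  exact ENNReal.tsum_comm

theorem wp_tsum {β : Type} (O : ℕ → ℕ) (F : ℕ) (c : Prog) (s : Store)
    (f : β → Store → ℕ → ENNReal) :
    wp O F c s (fun s t => ∑' x, f x s t) = ∑' x, wp O F c s (f x) := by
  unfold wp
  rw [← mean_tsum]
  congr 1
  ext o
  rcases o with _ | ⟨s, t⟩ <;> simp [onHalt]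

/-! ### Output distributions from bounds on means over runs. -/

section Sampling

variable {α : Type} {c : Prog} {l : List ℕ} {enc : α → List ℕ} {k T F₀ : ℕ} {μ : PMF α}

/-- With an injective encoding of fixed length, the registers encode at most one `x`, so at most one
term is nonzero. -/
theorem tsum_ind_le (hinj : Function.Injective enc) (hlen : ∀ x, (enc x).length = k) (s : Store)
    {f : α → ENNReal} {y : ENNReal} (h : ∀ x, (List.range k).map s = enc x → f x ≤ y) :
    ∑' x, ind ((List.range (enc x).length).map s = enc x) * f x ≤ y := by
  simp only [hlen]
  by_cases hx : ∃ x, (List.range k).map s = enc x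
  · obtain ⟨x, hx⟩ := hx
    rw [tsum_eq_single x fun x' hx' => ?_, ind_true hx, one_mul]
    · exact h x hx
    · rw [ind_false fun h' => hx' (hinj (h'.symm.trans hx)), zero_mul]
  · rw [ENNReal.tsum_eq_zero.2 fun x => by rw [ind_false fun h' => hx ⟨x, h'⟩, zero_mul]]
    exact zero_le

/-- The mean of a function of the output of a sampling program, as a mean over its runs. -/
theorem Samples.mean_le_wp (hs : Samples c l enc μ) (hinj : Function.Injective enc)
    (hlen : ∀ x, (enc x).length = k)
    (hT : wp noOracle F₀ c (load l) (fun _ t => ind (t ≤ T)) = 1) {F : ℕ} (hF : T ≤ F)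
    {f : α → ENNReal} {φ : Store → ℕ → ENNReal}
    (h : ∀ x s t, (∀ i, (s i).size ≤ inputLength l + t) → t ≤ T → (List.range k).map s = enc x →
      f x ≤ φ s t) : mean μ f ≤ wp noOracle F c (load l) φ := by
  have h1 : mean μ f = wp noOracle F c (load l) fun s t =>
      ∑' x, f x * ind (t ≤ T ∧ (List.range (enc x).length).map s = enc x) := by
    rw [wp_tsum]
    refine tsum_congr fun x => ?_
    rw [wp_const_mul, ← outProb_of_halts hT hF, hs x, mul_comm]
  rw [h1]
  refine wp_mono_size (size_load_le l) fun s t hst => ?_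
  by_cases ht : t ≤ T
  · simp only [ht, true_and, mul_comm (f _)]
    exact tsum_ind_le hinj hlen s fun x hx => h x s t hst ht hx
  · simp [ht, ind]

/-- It suffices to bound the probabilities of the outputs from below. -/
theorem samples_of_le (hinj : Function.Injective enc) (hlen : ∀ x, (enc x).length = k)
    (hT : wp noOracle F₀ c (load l) (fun _ t => ind (t ≤ T)) = 1)
    (h : ∀ x, μ x ≤ outProb c noOracle l (enc x)) : Samples c l enc μ := by
  have h1 : ∑' x, outProb c noOracle l (enc x) ≤ 1 := by
    simp only [outProb_of_halts hT le_rfl]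
    rw [← wp_tsum]
    refine wp_le_one fun s t => le_trans (ENNReal.tsum_le_tsum fun x => ?_)
      (tsum_ind_le hinj hlen s (f := fun _ => 1) fun _ _ => le_rfl)
    rw [mul_one]
    exact ind_mono And.right
  intro x
  by_contra hne
  -- One strict inequality would push the total output probability above one.
  have h2 := ENNReal.tsum_lt_tsum (i := x) (by rw [μ.tsum_coe]; exact ENNReal.one_ne_top) h
    (lt_of_le_of_ne (h x) (Ne.symm hne))
  rw [μ.tsum_coe] at h2
  exact absurd h1 (not_le.2 h2)

end Sampling

/-- Prepare the computation of `g ^ r mod p`, with `r` in register 8. -/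
def powInit : Prog :=
  .seq (.assign 18 (.const 1)) (.seq (.assign 19 (.reg 1)) (.assign 20 (.reg 8)))

/-- Output the parameterization and the descriptions of key space, domain and codomain. -/
def outputProg : Prog :=
  .seq (.assign 2 (.reg 18)) (.seq (.assign 3 (.reg 5)) (.assign 4 (.reg 6)))

/-- From `p, g`, the output of the instance generator of the collection. -/
def extendProg : Prog :=
  .seq sizeProg (.seq (.rand 8 (.reg 5)) (.seq powInit (.seq powLoop outputProg)))

/-- A lower bound for an arbitrary `f` of the six output registers: `f = 1` gives halting, and
indicators give the output probabilities. -/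
theorem extendProg_ge : ∃ K, ∀ b s, Bd b s → (s 0).size + 1 ≤ b → 1 < s 0 → s 1 < s 0 →
    ∀ (F : ℕ), K * (b + 1) ^ 2 ≤ F → ∀ (f : List ℕ → ENNReal) (φ : Store → ℕ → ENNReal),
    (∀ s' t, t ≤ K * (b + 1) ^ 2 → f ((List.range 6).map s') ≤ φ s' t) →
    mean (uniformBelow (s 0 / 2)) (fun r =>
      f [s 0, s 1, s 1 ^ r % s 0, s 0 / 2, (s 0).size, s 0 / 2]) ≤
      wp noOracle F extendProg s φ := by
  obtain ⟨K₁, h₁⟩ := sizeProg_runs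
  obtain ⟨K₂, h₂⟩ := (show powInit.Straight by
    simp [powInit, Prog.Straight, Expr.Work, workRegs]).runs
  obtain ⟨K₃, h₃⟩ := powLoop_runs
  obtain ⟨K₄, h₄⟩ := (show outputProg.Straight by
    simp [outputProg, Prog.Straight, Expr.Work, workRegs]).runs
  refine ⟨K₁ + 1 + K₂ + K₃ + K₄, fun b s hb hs hp hg F hF f φ hφ => ?_⟩
  obtain ⟨s₁, ⟨t₁, ht₁, r₁⟩, e5, e6, -, b₁, f₁⟩ := h₁ b s hb hs
  have hb2 : ∀ a : ℕ, a * (b + 1) ≤ a * (b + 1) ^ 2 := fun a =>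
    Nat.mul_le_mul_left _ (Nat.le_self_pow (by omega) _)
  have hb3 : b + 2 ≤ (b + 1) ^ 2 := by
    have : 1 ≤ b := by omega
    nlinarith
  have hsum : (K₁ + 1 + K₂ + K₃ + K₄) * (b + 1) ^ 2 = K₁ * (b + 1) ^ 2 + (b + 1) ^ 2 +
    K₂ * (b + 1) ^ 2 + K₃ * (b + 1) ^ 2 + K₄ * (b + 1) ^ 2 := by ring
  have hK₂ := hb2 K₂
  have hK₄ := hb2 K₄
  rw [hsum] at hF hφ
  rw [extendProg, wp_seq, r₁ _ _ (by omega), wp_seq, wp_rand]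
  simp only [Expr.eval, e5]
  refine mean_mono_support fun r hr => ?_
  have hr' := mem_support_uniformBelow hr
  have hc : (Expr.reg 5).cost s₁ ≤ b + 1 := by simpa [Expr.cost] using b₁ 5 (by norm_num)
  have hsb := b₁ 5 (by norm_num)
  have b₂ : Bd b (Function.update s₁ 8 r) := b₁.update (size_le_of_le (by omega) hsb)
  set s₂ := Function.update s₁ 8 r with hs₂
  obtain ⟨⟨t₂, ht₂, r₂⟩, -⟩ := h₂ b s₂ b₂
  rw [show powInit.run s₂ = Function.update (Function.update (Function.update s₂ 18 1) 19 (s₂ 1))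
    20 (s₂ 8) by simp [powInit, Prog.run, Expr.eval]] at r₂
  set s₃ := Function.update (Function.update (Function.update s₂ 18 1) 19 (s₂ 1)) 20 (s₂ 8)
    with hs₃
  have b₃ : Bd b s₃ := ((b₂.update (by simp; omega)).update (b₂ 1 (by norm_num))).update
    (b₂ 8 (by norm_num))
  have e : s₃ 0 = s 0 ∧ s₃ 1 = s 1 ∧ s₃ 5 = s 0 / 2 ∧ s₃ 6 = (s 0).size ∧ s₃ 18 = 1 ∧
      s₃ 19 = s 1 ∧ s₃ 20 = r := by
    simp [hs₃, hs₂, Function.update, e5, e6, f₁ 0, f₁ 1]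
  obtain ⟨e0, e1, e5', e6', e18, e19, e20⟩ := e
  obtain ⟨s₄, ⟨t₃, ht₃, r₃⟩, h18, b₄, f₄⟩ := h₃ b s₃ b₃ (by omega) (by omega)
  obtain ⟨⟨t₄, ht₄, r₄⟩, -⟩ := h₄ b s₄ b₄
  rw [wp_seq, r₂ _ _ (by omega), wp_seq, r₃ _ _ (by omega), r₄ _ _ (by omega)]
  refine le_of_eq_of_le ?_ (hφ _ _ (by omega))
  congr 1
  rw [show List.range 6 = [0, 1, 2, 3, 4, 5] from rfl]
  simp [outputProg, Prog.run, Expr.eval, Function.update, h18, f₄ 0, f₄ 1, f₄ 5, f₄ 6, e0, e1, e5',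
    e6', e18, e19, e20]

/-- A parameterization with descriptions of key space, domain and codomain. -/
def fullEnc (P : GGMParam) : List ℕ := P.enc ++ [P.q, P.p.size, P.q]

theorem fullEnc_injective : Function.Injective fullEnc := fun _ _ h =>
  GGMParam.enc_injective (List.append_inj_left h rfl)

theorem enc_injective : Function.Injective QRInstance.enc := by
  intro G G' h
  have : (⟨G, G.g⟩ : GGMParam) = ⟨G', G'.g⟩ := GGMParam.enc_injective (by
    simp only [QRInstance.enc, List.cons.injEq] at h
    simp [GGMParam.enc, h.1, h.2.1])
  exact congrArg GGMParam.toQRInstance this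

theorem exists_instance_generation {IG : ℕ → PMF QRInstance}
    (h : EfficientGenerator QRInstance.enc IG) :
    EfficientGenerator fullEnc (ggmGenerator IG) := by
  obtain ⟨c, hc, hs⟩ := h
  obtain ⟨T, hT⟩ := (polyTime_iff _ _).1 hc
  obtain ⟨K, hK⟩ := extendProg_ge
  have hone : ∀ G : QRInstance, 1 < G.p := fun G => G.safe.1.one_lt
  -- After the given generator, registers have at most as many bits as input length and running time
  -- together; one more bit leaves room for `2 ^ n` in `sizeProg`.
  let B : ℕ → ℕ := fun n => inputLength (unary n) + T.eval (inputLength (unary n)) + 1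
  let D : ℕ → ℕ := fun n => T.eval (inputLength (unary n)) + K * (B n + 1) ^ 2
  have key : ∀ n (f : List ℕ → ENNReal) (φ : Store → ℕ → ENNReal),
      (∀ s t, t ≤ D n → f ((List.range 6).map s) ≤ φ s t) →
      mean (ggmGenerator IG n) (fun P => f (fullEnc P)) ≤
        wp noOracle (D n) (.seq c extendProg) (load (unary n)) φ := by
    intro n f φ hfφ
    obtain ⟨F₀, hF₀⟩ := hT _ ⟨n, rfl⟩
    rw [mean_ggmGenerator, wp_seq]
    change wp noOracle F₀ c (load (unary n))
      (fun _ t => ind (t ≤ T.eval (inputLength (unary n)))) = 1 at hF₀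
    refine (hs n).mean_le_wp enc_injective (k := 2) (fun _ => rfl) hF₀ (Nat.le_add_right _ _)
      fun G s t hst ht hG => ?_
    have hG' : s 0 = G.p ∧ s 1 = rep G.g := by
      simpa [List.range_succ, QRInstance.enc] using hG
    obtain ⟨h0, h1⟩ := hG'
    have hb : ∀ i, (s i).size + 1 ≤ B n := fun i => by have := hst i; simp only [B]; omega
    refine le_trans (le_of_eq ?_) (hK (B n) s (fun i _ => (Nat.le_succ _).trans (hb i)) (hb 0)
      (h0 ▸ hone G) (h0 ▸ h1 ▸ rep_lt _) (D n) (Nat.le_add_left _ _) f _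
      fun s' t' ht' => hfφ s' _ (by simp only [D]; omega))
    rw [h0, h1]
    change _ = mean (uniformBelow G.q) _
    rw [← mean_zmod]
    congr 1
    ext a
    rw [← rep_pow]
    rfl
  refine ⟨.seq c extendProg, (polyTime_iff _ _).2
    ⟨T + .C K * (.X + T + 1 + 1) ^ 2, ?_⟩, fun n => ?_⟩
  · rintro _ ⟨n, rfl⟩
    refine ⟨D n, le_antisymm (wp_le_one fun _ _ => ind_le_one _) ?_⟩
    refine le_of_eq_of_le (mean_const _ 1).symm (key n (fun _ => 1) _ fun s t ht => ?_)
    rw [ind_true]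
    simpa [D, B] using ht
  · have h1 : wp noOracle (D n) (.seq c extendProg) (load (unary n)) (fun _ t => ind (t ≤ D n)) = 1 :=
      le_antisymm (wp_le_one fun _ _ => ind_le_one _) <|
        le_of_eq_of_le (mean_const _ 1).symm (key n (fun _ => 1) _ fun s t ht => by rw [ind_true ht])
    refine samples_of_le fullEnc_injective (k := 6) (fun _ => rfl) h1 fun P => ?_
    rw [← mean_ind_self]
    refine le_trans (le_of_eq ?_) ((key n (fun v => ind (v = fullEnc P))
      (fun s _ => ind ((List.range 6).map s = fullEnc P)) fun _ _ _ => le_rfl).trans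
        (le_outProb fun _ _ => le_rfl))
    congr 1
    ext Q
    exact ind_congr fullEnc_injective.eq_iff.symm

/-- The support for each large `n` is nonempty and consists of `n`-bit instances, so bit lengths are
unbounded. -/
theorem infinite_ggmParam {IG : ℕ → PMF QRInstance}
    (hsize : ∀ᶠ n in atTop, ∀ G ∈ (IG n).support, G.p.size = n) : Infinite GGMParam := by
  by_contra hfin
  rw [not_infinite_iff_finite] at hfin
  obtain ⟨M, hM⟩ := (Set.finite_range fun P : GGMParam => P.p.size).bddAbove
  obtain ⟨n, h1, h2⟩ := (hsize.and (eventually_gt_atTop M)).exists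
  obtain ⟨G, hG⟩ := (IG n).support_nonempty
  have := hM ⟨(⟨G, G.g⟩ : GGMParam), rfl⟩
  have := h1 G hG
  simp only at *
  omega

end QRPRF

end

theorem claim1 (IG : ℕ → PMF QRPRF.QRInstance) (hIG : QRPRF.IsInstanceGenerator IG)
    (hDDH : QRPRF.DDH IG) :
    QRPRF.ggmCollection.IsClassicalSecurePRF (QRPRF.ggmGenerator IG) := by
  refine ⟨⟨QRPRF.infinite_ggmParam hIG.2, ?_, QRPRF.exists_instance_generation hIG.1,
    QRPRF.exists_key_selection, QRPRF.exists_evaluation⟩,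
    QRPRF.indistinguishable_of_ddh hIG.2 hDDH⟩
  filter_upwards [hIG.2] with n hn P hP
  exact hn _ ((QRPRF.mem_support_ggmGenerator IG n P).1 hP)
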